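/- Let $(M,g)$ be an oriented smooth Riemannian $4$-manifold with Levi-Civita connection $\nabla$. Put $R(X,Y)=\nabla_{[X,Y]}-[\nabla_X,\nabla_Y]$, give $\Lambda^2TM$ the metric $g(v_1\wedge v_2,v_3\wedge v_4)=\tfrac12\det[g(v_i,v_j)]$ and the induced connection, let $\mathcal R:\Lambda^2TM\to\Lambda^2TM$ be the curvature operator, $g(\mathcal R(X\wedge Y),Z\wedge T)=g(R(X,Y)Z,T)$, and for $a\in\Lambda^2T_pM$ let $K_a$ be the skew-symmetric endomorphism of $T_pM$ with $g(K_aX,Y)=2g(a,X\wedge Y)$. Let $\Lambda^2_+TM$ be the $(+1)$-eigenbundle of the Hodge star, oriented so that $E_1\wedge E_2+E_3\wedge E_4$, $E_1\wedge E_3+E_4\wedge E_2$, $E_1\wedge E_4+E_2\wedge E_3$ is an oriented orthonormal basis whenever $(E_1,\dots,E_4)$ is an oriented orthonormal basis of $T_pM$, and let $\times$ be the corresponding vector cross product on $\Lambda^2_+T_pM$. Let $\pi:\mathcal Z\to M$ be the bundle of unit vectors of $\Lambda^2_+TM$ (the twistor space). The connection $\nabla$ gives a splitting $T\mathcal Z=\mathcal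 H\oplus\mathcal V$ into horizontal and vertical parts, where $\mathcal V_\sigma=\ker\pi_{*\sigma}$ is identified with the orthogonal complement of $\mathbb R\sigma$ in $\Lambda^2_+T_{\pi(\sigma)}M$; write $X^h_\sigma$ for the horizontal lift of $X\in T_{\pi(\sigma)}M$ to $\sigma$, and $\mathcal V A$ for the vertical part of $A\in T\mathcal Z$. For $t>0$ let $h_t=\pi^*g+t\,g^v$, where $g^v(A,B)=g(\mathcal VA,\mathcal VB)$, and let $D$ be the Levi-Civita connection of $(\mathcal Z,h_t)$. Let $f:\mathcal Z\to\mathcal Z$ be a smooth map with $\pi\circ f=\pi$, let $\mathcal J_f$ be the almost complex structure on $\mathcal Z$ with $\mathcal J_fV=\sigma\times V$ for $V\in\mathcal V_\sigma$ and $\mathcal J_fX^h_\sigma=(K_{f(\sigma)}X)^h_\sigma$, and let $\Omega(A,B)=h_t(\mathcal J_fA,B)$. Then for every $\sigma\in\mathcal Z$, $p=\pi(\sigma)$, all $X,Y,Z\in T_pM$ and all $U,V,W\in\mathcal V_\sigma$: $$(D_{X^h_\sigma}\Omega)(Y^h_\sigma,Z^h_\sigma)=2g(\mathcal V f_*(X^h_\sigma),Y\wedge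 Z);$$ $$(D_{X^h_\sigma}\Omega)(Y^h_\sigma,U)=-\frac t2\,g(\mathcal R(U),X\wedge Y)+\frac t2\,g(\mathcal R(\sigma\times U),X\wedge K_{f(\sigma)}Y);$$ $$(D_U\Omega)(Y^h_\sigma,Z^h_\sigma)=-\frac t2\,g(\mathcal R(\sigma\times U),Y\wedge K_{f(\sigma)}Z+K_{f(\sigma)}Y\wedge Z)+2g(f_*U,Y\wedge Z);$$ $$(D_{X^h_\sigma}\Omega)(U,V)=0,\qquad (D_U\Omega)(Y^h_\sigma,V)=0,\qquad (D_U\Omega)(V,W)=0.$$ -/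

import Mathlib

open scoped Manifold ContDiff Bundle Topology RealInnerProductSpace
open Bundle Module

noncomputable section

namespace TwistorGeometry

section LinearAlgebra
variable {V : Type*} [NormedAddCommGroup V] [InnerProductSpace ℝ V]

/-- The decomposable 2-vector `x ∧ y`. -/
def wedge (x y : V) : ⋀[ℝ]^2 V := exteriorPower.ιMulti ℝ 2 ![x, y]

/-- The inner product on `Λ²V` with `g(x ∧ y, z ∧ w) = ½ det`, that is
`½ (g(x, z) g(y, w) - g(x, w) g(y, z))`. -/
def bivInner : ⋀[ℝ]^2 V →ₗ[ℝ] ⋀[ℝ]^2 V →ₗ[ℝ] ℝ :=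
  (1 / 2 : ℝ) • (exteriorPower.pairingDual ℝ V 2 ∘ₗ exteriorPower.map 2 (innerₗ V))

lemma bivInner_wedge (a b c d : V) :
    bivInner (wedge a b) (wedge c d)
      = 1 / 2 * (⟪a, c⟫ * ⟪b, d⟫ - ⟪a, d⟫ * ⟪b, c⟫) := by
  simp [bivInner, wedge, exteriorPower.pairingDual_ιMulti_ιMulti, Matrix.det_fin_two]
  ring

lemma wedge_add_left (a b c : V) : wedge (a + b) c = wedge a c + wedge b c := by
  exact (exteriorPower.ιMulti ℝ 2 (M := V)).map_vecCons_add ![c] a b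

lemma wedge_smul_left (r : ℝ) (a c : V) : wedge (r • a) c = r • wedge a c := by
  exact (exteriorPower.ιMulti ℝ 2 (M := V)).map_vecCons_smul ![c] r a

lemma wedge_swap (a c : V) : wedge a c = - wedge c a := by
  have := (exteriorPower.ιMulti ℝ 2 (M := V)).map_swap ![c, a] (i := 0) (j := 1) (by decide)
  rw [wedge, wedge, ← this]
  congr 1
  ext i; fin_cases i <;> simp

lemma wedge_self (a : V) : wedge a a = 0 :=
  (exteriorPower.ιMulti ℝ 2 (M := V)).map_eq_zero_of_eq ![a, a] (i := 0) (j := 1) (by simp) (by decide)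

lemma wedge_add_right (a b c : V) : wedge a (b + c) = wedge a b + wedge a c := by
  rw [wedge_swap, wedge_add_left, wedge_swap b, wedge_swap c]; simp [add_comm]

lemma wedge_smul_right (r : ℝ) (a c : V) : wedge a (r • c) = r • wedge a c := by
  rw [wedge_swap, wedge_smul_left, wedge_swap c]; simp

/-- `x ∧ y` as a bilinear map. -/
def wedgeₗ : V →ₗ[ℝ] V →ₗ[ℝ] ⋀[ℝ]^2 V :=
  LinearMap.mk₂ ℝ wedge wedge_add_left wedge_smul_left wedge_add_right wedge_smul_right

lemma bivector_ext {N : Type*} [AddCommGroup N] [Module ℝ N] {f g : ⋀[ℝ]^2 V →ₗ[ℝ] N}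
    (h : ∀ x y, f (wedge x y) = g (wedge x y)) : f = g := by
  apply exteriorPower.linearMap_ext
  ext m
  have : m = ![m 0, m 1] := by ext i; fin_cases i <;> rfl
  rw [this]
  exact h _ _

lemma wedge_eq_sum {ι : Type*} [Fintype ι] (e : OrthonormalBasis ι ℝ V) (x y : V) :
    wedge x y = ∑ i, ∑ j, (⟪e i, x⟫ * ⟪e j, y⟫) • wedge (e i) (e j) := by
  conv_lhs => rw [← e.sum_repr' x, ← e.sum_repr' y]
  change wedgeₗ _ _ = _
  simp only [map_sum, map_smul, LinearMap.sum_apply, LinearMap.smul_apply]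
  rw [Finset.sum_comm]
  refine Finset.sum_congr rfl fun i _ => ?_
  rw [Finset.smul_sum]
  refine Finset.sum_congr rfl fun j _ => ?_
  rw [smul_smul, mul_comm]; rfl

lemma bivector_eq_sum {ι : Type*} [Fintype ι] (e : OrthonormalBasis ι ℝ V) (a : ⋀[ℝ]^2 V) :
    a = ∑ i, ∑ j, bivInner a (wedge (e i) (e j)) • wedge (e i) (e j) := by
  have : (LinearMap.id : ⋀[ℝ]^2 V →ₗ[ℝ] ⋀[ℝ]^2 V) = ∑ i, ∑ j, (bivInner.flip
    (wedge (e i) (e j))).smulRight (wedge (e i) (e j)) := by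
    apply bivector_ext
    intro x y
    simp only [LinearMap.id_apply, LinearMap.sum_apply, LinearMap.smulRight_apply,
      LinearMap.flip_apply, bivInner_wedge]
    have h1 := wedge_eq_sum e x y
    have h2 := wedge_eq_sum e y x
    rw [wedge_swap, neg_eq_iff_eq_neg] at h2
    have h3 : wedge x y = (1 / 2 : ℝ) • wedge x y + (1 / 2 : ℝ) • wedge x y := by module
    rw [h3]
    nth_rewrite 1 [h1]
    rw [h2]
    simp only [Finset.smul_sum, smul_neg, ← Finset.sum_neg_distrib, ← Finset.sum_add_distrib]
    refine Finset.sum_congr rfl fun i _ => Finset.sum_congr rfl fun j _ => ?_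
    rw [real_inner_comm (e i) x, real_inner_comm (e j) y, real_inner_comm (e j) x, real_inner_comm (e i) y]
    module
  conv_lhs => rw [← LinearMap.id_apply (R := ℝ) a, this]
  simp


lemma bivInner_comm (a b : ⋀[ℝ]^2 V) : bivInner a b = bivInner b a := by
  have : (bivInner : ⋀[ℝ]^2 V →ₗ[ℝ] _) = bivInner.flip := by
    apply bivector_ext
    intro x y
    apply bivector_ext
    intro z w
    simp only [LinearMap.flip_apply, bivInner_wedge, real_inner_comm]
    ring_nf
  exact LinearMap.congr_fun₂ this a b

/-- The bivectors `e₁∧e'₂ + e₃∧e'₄`, `e₁∧e'₃ + e₄∧e'₂`, `e₁∧e'₄ + e₂∧e'₃`, as a bilinear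
expression in `(e, e')`. -/
def sdPair (e e' : Fin 4 → V) : Fin 3 → ⋀[ℝ]^2 V :=
  ![wedge (e 0) (e' 1) + wedge (e 2) (e' 3),
    wedge (e 0) (e' 2) + wedge (e 3) (e' 1),
    wedge (e 0) (e' 3) + wedge (e 1) (e' 2)]

/-- `s₁ = e₁∧e₂ + e₃∧e₄`, `s₂ = e₁∧e₃ + e₄∧e₂`, `s₃ = e₁∧e₄ + e₂∧e₃`. For an oriented
orthonormal basis `e` this is an oriented orthonormal basis of the self-dual bivectors. -/
def sdFrame (e : Fin 4 → V) : Fin 3 → ⋀[ℝ]^2 V := sdPair e e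

lemma bivInner_basis (e : OrthonormalBasis (Fin 4) ℝ V) (i j k l : Fin 4) :
    bivInner (wedge (e i) (e j)) (wedge (e k) (e l)) =
      1 / 2 * ((if i = k then (1 : ℝ) else 0) * (if j = l then 1 else 0) -
        (if i = l then 1 else 0) * (if j = k then 1 else 0)) := by
  simp only [bivInner_wedge, orthonormal_iff_ite.mp e.orthonormal]

lemma bivInner_sdFrame (e : OrthonormalBasis (Fin 4) ℝ V) (i j : Fin 3) :
    bivInner (sdFrame e i) (sdFrame e j) = if i = j then 1 else 0 := by
  fin_cases i <;> fin_cases j <;>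
  simp [sdFrame, sdPair, bivInner_basis] <;> norm_num

lemma bivInner_sum_sdFrame (e : OrthonormalBasis (Fin 4) ℝ V) (y : Fin 3 → ℝ) (i : Fin 3) :
    bivInner (∑ j, y j • sdFrame e j) (sdFrame e i) = y i := by
  simp [bivInner_sdFrame, map_sum]

lemma bivInner_sum_sum (e : OrthonormalBasis (Fin 4) ℝ V) (y : Fin 3 → ℝ) :
    bivInner (∑ j, y j • sdFrame e j) (∑ j, y j • sdFrame e j) = ∑ i, y i ^ 2 := by
  rw [map_sum]
  simp only [map_smul, bivInner_sum_sdFrame, smul_eq_mul, pow_two]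

variable [Fact (finrank ℝ V = 4)]

/-- `vol(a ∧ b)` for two bivectors, where `vol` is the volume form of the oriented inner product
space. -/
def volPairing (o : Orientation ℝ V (Fin 4)) : ⋀[ℝ]^2 V →ₗ[ℝ] ⋀[ℝ]^2 V →ₗ[ℝ] ℝ :=
  ((LinearMap.mul ℝ (ExteriorAlgebra ℝ V)).compl₁₂ (⋀[ℝ]^2 V).subtype
    (⋀[ℝ]^2 V).subtype).compr₂
      (ExteriorAlgebra.liftAlternating (Pi.single 4 o.volumeForm))

lemma volPairing_wedge (o : Orientation ℝ V (Fin 4)) (a b c d : V) :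
    volPairing o (wedge a b) (wedge c d) = o.volumeForm ![a, b, c, d] := by
  have : (wedge a b : ExteriorAlgebra ℝ V) * (wedge c d : ExteriorAlgebra ℝ V)
      = ExteriorAlgebra.ιMulti ℝ 4 ![a, b, c, d] := by
    simp [wedge, ExteriorAlgebra.ιMulti_apply, mul_assoc]
  simp only [volPairing, LinearMap.compr₂_apply, LinearMap.compl₁₂_apply, Submodule.subtype_apply,
    LinearMap.mul_apply', this, ExteriorAlgebra.liftAlternating_apply_ιMulti, Pi.single_eq_same]


/-- A positively oriented orthonormal basis. -/
def orientedBasis (o : Orientation ℝ V (Fin 4)) : OrthonormalBasis (Fin 4) ℝ V :=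
  o.finOrthonormalBasis (by norm_num) Fact.out

lemma orientedBasis_orientation (o : Orientation ℝ V (Fin 4)) :
    (orientedBasis o).toBasis.orientation = o :=
  Orientation.finOrthonormalBasis_orientation _ _ _

/-- The Hodge star on bivectors. It is determined by `2 g(*a, b) = vol(a ∧ b)`, see
`bivInner_hodgeStar`; the factor `2` compensates the factor `½` in `g`. -/
def hodgeStar (o : Orientation ℝ V (Fin 4)) : ⋀[ℝ]^2 V →ₗ[ℝ] ⋀[ℝ]^2 V :=
  (1 / 2 : ℝ) • ∑ i, ∑ j, ((volPairing o).flip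
    (wedge (orientedBasis o i) (orientedBasis o j))).smulRight
      (wedge (orientedBasis o i) (orientedBasis o j))

lemma bivInner_hodgeStar (o : Orientation ℝ V (Fin 4)) (a b : ⋀[ℝ]^2 V) :
    2 * bivInner (hodgeStar o a) b = volPairing o a b := by
  conv_rhs => rw [bivector_eq_sum (orientedBasis o) b]
  simp only [map_sum, map_smul, hodgeStar, LinearMap.smul_apply, LinearMap.sum_apply,
    LinearMap.smulRight_apply, LinearMap.flip_apply, smul_eq_mul, ← mul_assoc]
  norm_num
  refine Finset.sum_congr rfl fun i _ => Finset.sum_congr rfl fun j _ => ?_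
  rw [bivInner_comm b, mul_comm]

lemma hodgeStar_eq_self_iff (o : Orientation ℝ V (Fin 4)) (e : OrthonormalBasis (Fin 4) ℝ V)
    (a : ⋀[ℝ]^2 V) :
    hodgeStar o a = a ↔ ∀ i j, volPairing o a (wedge (e i) (e j)) =
      2 * bivInner a (wedge (e i) (e j)) := by
  constructor
  · intro h i j
    rw [← bivInner_hodgeStar, h]
  · intro h
    rw [bivector_eq_sum e (hodgeStar o a), bivector_eq_sum e a]
    refine Finset.sum_congr rfl fun i _ => Finset.sum_congr rfl fun j _ => ?_
    rw [← bivector_eq_sum e a]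
    congr 1
    have := h i j
    rw [← bivInner_hodgeStar] at this
    linarith

/-- The Levi-Civita symbol. -/
def leviCivitaSymbol (i j k l : Fin 4) : ℤ :=
  Matrix.det (Matrix.of fun a b : Fin 4 => if ![i, j, k, l] b = a then (1 : ℤ) else 0)

lemma volPairing_basis (o : Orientation ℝ V (Fin 4)) (e : OrthonormalBasis (Fin 4) ℝ V)
    (he : e.toBasis.orientation = o) (i j k l : Fin 4) :
    volPairing o (wedge (e i) (e j)) (wedge (e k) (e l)) = leviCivitaSymbol i j k l := by
  rw [volPairing_wedge, o.volumeForm_robust e he, Basis.det_apply, leviCivitaSymbol, Int.cast_det]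
  congr 1
  ext a b
  rw [Basis.toMatrix_apply]
  have : (![e i, e j, e k, e l] : Fin 4 → V) b = e.toBasis (![i, j, k, l] b) := by
    fin_cases b <;> simp
  rw [this, Basis.repr_self, Finsupp.single_apply]
  simp [Matrix.map_apply]

lemma leviCivitaSymbol_eq (i j k l : Fin 4) : 12 * leviCivitaSymbol i j k l =
    ((j.val : ℤ) - i.val) * (k.val - i.val) * (l.val - i.val) * (k.val - j.val) *
      (l.val - j.val) * (l.val - k.val) := by
  have h : (Matrix.of fun a b : Fin 4 => if ![i, j, k, l] b = a then (1 : ℤ) else 0).transpose *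
      Matrix.vandermonde (fun a : Fin 4 => (a.val : ℤ)) =
        Matrix.vandermonde (fun b => ((![i, j, k, l] b).val : ℤ)) := by
    ext b c
    simp [Matrix.mul_apply, Matrix.vandermonde_apply]
  have h' := congrArg Matrix.det h
  rw [Matrix.det_mul, Matrix.det_transpose, Matrix.det_vandermonde, Matrix.det_vandermonde] at h'
  have i0 : Finset.Ioi (0 : Fin 4) = {1, 2, 3} := by decide
  have i1 : Finset.Ioi (1 : Fin 4) = {2, 3} := by decide
  have i2 : Finset.Ioi (2 : Fin 4) = {3} := by decide
  have i3 : Finset.Ioi (3 : Fin 4) = ∅ := by decide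
  simp only [Fin.prod_univ_four, i0, i1, i2, i3] at h'
  simp at h'
  rw [leviCivitaSymbol]
  linarith

lemma leviCivitaSymbol_cast (i j k l : Fin 4) : (leviCivitaSymbol i j k l : ℝ) =
    ((j.val : ℝ) - i.val) * (k.val - i.val) * (l.val - i.val) * (k.val - j.val) *
      (l.val - j.val) * (l.val - k.val) / 12 := by
  have := congrArg (Int.cast : ℤ → ℝ) (leviCivitaSymbol_eq i j k l)
  push_cast at this
  linarith

lemma hodgeStar_sdFrame (o : Orientation ℝ V (Fin 4)) (e : OrthonormalBasis (Fin 4) ℝ V)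
    (he : e.toBasis.orientation = o) (i : Fin 3) : hodgeStar o (sdFrame e i) = sdFrame e i := by
  rw [hodgeStar_eq_self_iff o e]
  intro k l
  fin_cases i <;> fin_cases k <;> fin_cases l <;>
  simp [sdFrame, sdPair, volPairing_basis o e he, bivInner_basis, leviCivitaSymbol_cast] <;> norm_num

lemma eq_sum_sdFrame (o : Orientation ℝ V (Fin 4)) (e : OrthonormalBasis (Fin 4) ℝ V)
    (he : e.toBasis.orientation = o) (a : ⋀[ℝ]^2 V) (ha : hodgeStar o a = a) :
    a = ∑ i, bivInner a (sdFrame e i) • sdFrame e i := by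
  rw [hodgeStar_eq_self_iff o e] at ha
  have key : ∀ k l, ∑ i, ∑ j, bivInner a (wedge (e i) (e j)) *
      volPairing o (wedge (e i) (e j)) (wedge (e k) (e l)) =
        2 * bivInner a (wedge (e k) (e l)) := by
    intro k l
    rw [← ha k l]
    conv_rhs => rw [bivector_eq_sum e a]
    simp
  have h1 := key 2 3
  have h2 := key 3 1
  have h3 := key 1 2
  have sw : ∀ i j, bivInner a (wedge (e i) (e j)) = - bivInner a (wedge (e j) (e i)) := by
    intro i j; rw [wedge_swap]; simp
  simp only [volPairing_basis o e he, leviCivitaSymbol_cast, Fin.sum_univ_four] at h1 h2 h3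
  norm_num at h1 h2 h3
  rw [sw 1 0] at h1
  rw [sw 2 0] at h2
  rw [sw 3 0] at h3
  conv_lhs => rw [bivector_eq_sum e a]
  have e1 : bivInner a (wedge (e 2) (e 3)) = bivInner a (wedge (e 0) (e 1)) := by linarith
  have e2 : bivInner a (wedge (e 3) (e 1)) = bivInner a (wedge (e 0) (e 2)) := by linarith
  have e3 : bivInner a (wedge (e 1) (e 2)) = bivInner a (wedge (e 0) (e 3)) := by linarith
  simp only [Fin.sum_univ_four, Fin.sum_univ_three, sdFrame, sdPair, wedge_self, map_add,
    Matrix.cons_val_zero, Matrix.cons_val_one, Matrix.cons_val]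
  rw [wedge_swap (e 1) (e 0), wedge_swap (e 2) (e 0), wedge_swap (e 3) (e 0),
    wedge_swap (e 3) (e 2), wedge_swap (e 1) (e 3), wedge_swap (e 2) (e 1)]
  simp only [map_neg, map_zero, e1, e2, e3]
  module

/-- The cross product of the oriented Euclidean 3-space of self-dual bivectors, the orientation
being given by `(s₁, s₂, s₃)` for an oriented orthonormal basis of `V`. -/
def cross (o : Orientation ℝ V (Fin 4)) (a b : ⋀[ℝ]^2 V) : ⋀[ℝ]^2 V :=
  ∑ k, (crossProduct (fun i => bivInner a (sdFrame (orientedBasis o) i))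
    (fun i => bivInner b (sdFrame (orientedBasis o) i)) k) • sdFrame (orientedBasis o) k

/-- The unit sphere in the space of self-dual bivectors: the fibre of the twistor space. -/
@[ext]
structure TwistorFiber (o : Orientation ℝ V (Fin 4)) where
  /-- The underlying bivector. -/
  vec : ⋀[ℝ]^2 V
  selfDual : hodgeStar o vec = vec
  unit : bivInner vec vec = 1

/-- Coordinates with respect to `(s₁, s₂, s₃)` identify the fibre with the unit sphere of `ℝ³`. -/
def fiberEquiv (o : Orientation ℝ V (Fin 4)) (e : OrthonormalBasis (Fin 4) ℝ V)
    (he : e.toBasis.orientation = o) :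
    TwistorFiber o ≃ Metric.sphere (0 : EuclideanSpace ℝ (Fin 3)) 1 where
  toFun σ := ⟨WithLp.toLp 2 fun i => bivInner σ.vec (sdFrame e i), by
    rw [mem_sphere_zero_iff_norm, EuclideanSpace.norm_eq, Real.sqrt_eq_one]
    refine Eq.trans ?_ σ.unit
    conv_rhs => rw [eq_sum_sdFrame o e he σ.vec σ.selfDual]
    rw [bivInner_sum_sum]
    simp⟩
  invFun y := ⟨∑ i, y.1 i • sdFrame e i, by simp [map_sum, hodgeStar_sdFrame o e he], by
      have h := y.2
      rw [mem_sphere_zero_iff_norm, EuclideanSpace.norm_eq, Real.sqrt_eq_one] at h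
      refine Eq.trans ?_ h
      rw [bivInner_sum_sum]
      simp⟩
  left_inv σ := TwistorFiber.ext (eq_sum_sdFrame o e he σ.vec σ.selfDual).symm
  right_inv y := by
    apply Subtype.ext
    ext i
    exact bivInner_sum_sdFrame e (fun j => y.1 j) i

lemma fiberEquiv_fiberEquiv_symm (o : Orientation ℝ V (Fin 4))
    (e e' : OrthonormalBasis (Fin 4) ℝ V) (he : e.toBasis.orientation = o)
    (he' : e'.toBasis.orientation = o) (y : Metric.sphere (0 : EuclideanSpace ℝ (Fin 3)) 1)
    (j : Fin 3) :
    (fiberEquiv o e' he' ((fiberEquiv o e he).symm y)).1 j =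
      ∑ i, y.1 i * bivInner (sdFrame e i) (sdFrame e' j) := by
  change bivInner (∑ i, y.1 i • sdFrame e i) (sdFrame e' j) = _
  simp [map_sum]

end LinearAlgebra

section Endo
variable {V : Type*} [NormedAddCommGroup V] [InnerProductSpace ℝ V] [FiniteDimensional ℝ V]

/-- The endomorphism `K_a` of `V` with `g(K_a x, y) = 2 g(a, x ∧ y)`, see `inner_bivEndo`. -/
def bivEndo (a : ⋀[ℝ]^2 V) (x : V) : V :=
  ∑ i, (2 * bivInner a (wedge x (stdOrthonormalBasis ℝ V i))) • stdOrthonormalBasis ℝ V i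

lemma inner_bivEndo (a : ⋀[ℝ]^2 V) (x y : V) :
    ⟪bivEndo a x, y⟫ = 2 * bivInner a (wedge x y) := by
  have h : wedge x y = wedgeₗ x y := rfl
  conv_rhs => rw [h, ← (stdOrthonormalBasis ℝ V).sum_repr' y]
  simp only [bivEndo, sum_inner, inner_smul_left, map_sum, map_smul, Finset.mul_sum]
  refine Finset.sum_congr rfl fun i _ => ?_
  simp [wedgeₗ]; ring

/-- The curvature operator `ℛ` of an algebraic curvature tensor `R`, characterised by
`g(ℛ(x ∧ y), z ∧ w) = g(R(x, y) z, w)`, see `bivInner_curvatureOperator`. -/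
def curvatureOperator (R : V → V → V → V) (a : ⋀[ℝ]^2 V) : ⋀[ℝ]^2 V :=
  let e := stdOrthonormalBasis ℝ V
  ∑ i, ∑ j, ∑ k, ∑ l, (bivInner a (wedge (e k) (e l)) * ⟪R (e k) (e l) (e i), e j⟫) •
    wedge (e i) (e j)

lemma bivInner_curvatureOperator (R : V →ₗ[ℝ] V →ₗ[ℝ] V →ₗ[ℝ] V)
    (h₁ : ∀ x y z, R x y z = - R y x z) (h₂ : ∀ x y z w, ⟪R x y z, w⟫ = - ⟪R x y w, z⟫)
    (x y z w : V) :
    bivInner (curvatureOperator (fun x y z => R x y z) (wedge x y)) (wedge z w) = ⟪R x y z, w⟫ := by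
  let e := stdOrthonormalBasis ℝ V
  have e1 : ∀ u v : V, R u v = ∑ k, ∑ l, (⟪e k, u⟫ * ⟪e l, v⟫) • R (e k) (e l) := by
    intro u v
    conv_lhs => rw [← e.sum_repr' u, ← e.sum_repr' v]
    simp only [map_sum, map_smul, LinearMap.sum_apply, LinearMap.smul_apply, Finset.smul_sum,
      smul_smul]
    rw [Finset.sum_comm]
    simp only [mul_comm]
  have e2 : ∀ S : V →ₗ[ℝ] V, ∀ u v : V,
      ⟪S u, v⟫ = ∑ i, ∑ j, ⟪e i, u⟫ * ⟪e j, v⟫ * ⟪S (e i), e j⟫ := by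
    intro S u v
    conv_lhs => rw [← e.sum_repr' u, ← e.sum_repr' v]
    simp only [map_sum, map_smul, sum_inner, inner_sum, inner_smul_left, inner_smul_right,
      Finset.mul_sum]
    rw [Finset.sum_comm]
    refine Finset.sum_congr rfl fun i _ => Finset.sum_congr rfl fun j _ => ?_
    simp; ring
  have e3 : R x y = ∑ k, ∑ l, bivInner (wedge x y) (wedge (e k) (e l)) • R (e k) (e l) := by
    have h : R x y = (1 / 2 : ℝ) • R x y - (1 / 2 : ℝ) • R y x := by
      ext u
      simp only [LinearMap.sub_apply, LinearMap.smul_apply]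
      rw [h₁ y x]; module
    rw [h, e1 x y, e1 y x]
    simp only [Finset.smul_sum, ← Finset.sum_sub_distrib, bivInner_wedge]
    refine Finset.sum_congr rfl fun i _ => Finset.sum_congr rfl fun j _ => ?_
    rw [real_inner_comm (e i) x, real_inner_comm (e j) y, real_inner_comm (e j) x,
      real_inner_comm (e i) y]
    module
  have e4 : ⟪R x y z, w⟫ =
      ∑ i, ∑ j, ⟪R x y (e i), e j⟫ * bivInner (wedge (e i) (e j)) (wedge z w) := by
    have h : ⟪R x y z, w⟫ = 1 / 2 * ⟪R x y z, w⟫ - 1 / 2 * ⟪R x y w, z⟫ := by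
      rw [h₂ x y w z]; ring
    rw [h, e2 (R x y) z w, e2 (R x y) w z]
    simp only [Finset.mul_sum, ← Finset.sum_sub_distrib, bivInner_wedge]
    refine Finset.sum_congr rfl fun i _ => Finset.sum_congr rfl fun j _ => ?_
    ring
  rw [e4]
  simp only [curvatureOperator, map_sum, map_smul, LinearMap.sum_apply, LinearMap.smul_apply,
    smul_eq_mul]
  refine Finset.sum_congr rfl fun i _ => Finset.sum_congr rfl fun j _ => ?_
  rw [e3]
  simp only [LinearMap.sum_apply, LinearMap.smul_apply, sum_inner, inner_smul_left, Finset.sum_mul]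
  rfl

end Endo

/-- The Euclidean plane. -/
abbrev E2 := EuclideanSpace ℝ (Fin 2)
/-- Euclidean 3-space. -/
abbrev E3 := EuclideanSpace ℝ (Fin 3)
/-- Euclidean 4-space, the model space of the base manifold. -/
abbrev E4 := EuclideanSpace ℝ (Fin 4)
/-- The model with corners of 4-manifolds without boundary. -/
abbrev I4 := 𝓘(ℝ, E4)

section Mfd
variable {M : Type*} [TopologicalSpace M] [ChartedSpace E4 M]

instance instFiniteDimensionalTangent (p : M) : FiniteDimensional ℝ (TangentSpace I4 p) :=
  inferInstanceAs (FiniteDimensional ℝ E4)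

instance instFactFinrankTangent (p : M) : Fact (finrank ℝ (TangentSpace I4 p) = 4) :=
  ⟨(finrank_euclideanSpace_fin : finrank ℝ E4 = 4)⟩

end Mfd

/-- An orientation of the 4-manifold `M`: an orientation of every tangent space such that near every
point there is a smooth positively oriented local frame. -/
structure ManifoldOrientation (M : Type*) [TopologicalSpace M] [ChartedSpace E4 M]
    [IsManifold I4 ∞ M] where
  /-- The orientation of each tangent space. -/
  orient : ∀ p : M, Orientation ℝ (TangentSpace I4 p) (Fin 4)
  exists_frame : ∀ p : M, ∃ (U : Set M) (s : Fin 4 → Π q : M, TangentSpace I4 q)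
    (hs : IsLocalFrameOn I4 E4 ∞ s U), IsOpen U ∧ p ∈ U ∧
      ∀ q (hq : q ∈ U), (hs.toBasisAt hq).orientation = orient q

section Frames
variable {M : Type*} [TopologicalSpace M] [ChartedSpace E4 M] [IsManifold I4 ∞ M]
  [RiemannianBundle (fun p : M => TangentSpace I4 p)]

/-- A positively oriented orthonormal basis at every point which is a smooth frame on the open set
`domain` (outside of `domain` the choice is irrelevant). -/
structure OrientedFrame (o : ManifoldOrientation M) where
  /-- The open set on which the frame is smooth. -/
  domain : Set M
  isOpen_domain : IsOpen domain
  /-- The orthonormal bases. -/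
  basis : ∀ q : M, OrthonormalBasis (Fin 4) ℝ (TangentSpace I4 q)
  orientation_eq : ∀ q, (basis q).toBasis.orientation = o.orient q
  contMDiffOn : ∀ i, ContMDiffOn I4 (I4.prod 𝓘(ℝ, E4)) ∞ (T% (fun q => basis q i)) domain

/-- The twistor space: the unit sphere bundle in the bundle of self-dual bivectors. -/
@[ext]
structure TwistorSpace (o : ManifoldOrientation M) where
  /-- The bundle projection `π`. -/
  base : M
  /-- The point of the fibre. -/
  fiber : TwistorFiber (o.orient base)

variable [IsContMDiffRiemannianBundle I4 ∞ E4 (fun p : M => TangentSpace I4 p)]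

lemma gs_orientation {V : Type*} [NormedAddCommGroup V] [InnerProductSpace ℝ V]
    [FiniteDimensional ℝ V] (h : finrank ℝ V = Fintype.card (Fin 4)) (b : Basis (Fin 4) ℝ V) :
    (InnerProductSpace.gramSchmidtOrthonormalBasis h b).toBasis.orientation = b.orientation := by
  rw [Basis.orientation_eq_iff_det_pos, InnerProductSpace.gramSchmidtOrthonormalBasis_det]
  apply Finset.prod_pos
  intro i _
  have hn : InnerProductSpace.gramSchmidtNormed ℝ b i ≠ 0 := by
    intro h0
    have := InnerProductSpace.gramSchmidtNormed_unit_length (𝕜 := ℝ) i b.linearIndependent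
    rw [h0] at this
    simp at this
  rw [InnerProductSpace.gramSchmidtOrthonormalBasis_apply h hn]
  have hz := InnerProductSpace.gramSchmidt_ne_zero (𝕜 := ℝ) i b.linearIndependent
  rw [InnerProductSpace.gramSchmidtNormed]
  conv_rhs => rw [InnerProductSpace.gramSchmidt_def'' ℝ b i]
  simp only [inner_smul_left, inner_add_right, inner_sum, inner_smul_right]
  rw [Finset.sum_eq_zero]
  · simp
    positivity
  · intro j hj
    rw [InnerProductSpace.gramSchmidt_orthogonal ℝ b (Finset.mem_Iio.mp hj).ne']
    simp

lemma contMDiffOn_gramSchmidt {U : Set M} {s : Fin 4 → Π q : M, TangentSpace I4 q}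
    (hs : IsLocalFrameOn I4 E4 ∞ s U) (i : Fin 4) :
    ContMDiffOn I4 (I4.prod 𝓘(ℝ, E4)) ∞ (T% (fun q => InnerProductSpace.gramSchmidt ℝ (fun j => s j q) i)) U := by
  induction i using WellFoundedLT.induction with
  | ind i ih =>
    have hne : ∀ j, ∀ q ∈ U, InnerProductSpace.gramSchmidt ℝ (fun j => s j q) j ≠ 0 :=
      fun j q hq => InnerProductSpace.gramSchmidt_ne_zero (𝕜 := ℝ) j (hs.linearIndependent hq)
    have h : ∀ q, InnerProductSpace.gramSchmidt ℝ (fun j => s j q) i = s i q -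
        ∑ j ∈ Finset.Iio i, (⟪InnerProductSpace.gramSchmidt ℝ (fun j => s j q) j, s i q⟫ /
          ⟪InnerProductSpace.gramSchmidt ℝ (fun j => s j q) j,
            InnerProductSpace.gramSchmidt ℝ (fun j => s j q) j⟫) •
              InnerProductSpace.gramSchmidt ℝ (fun j => s j q) j := by
      intro q
      rw [eq_sub_iff_add_eq]
      simp only [real_inner_self_eq_norm_sq]
      exact (InnerProductSpace.gramSchmidt_def'' ℝ (fun j => s j q) i).symm
    simp only [h]
    refine ContMDiffOn.sub_section (hs.contMDiffOn i) (ContMDiffOn.sum_section fun j hj => ?_)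
    have hj' := ih j (Finset.mem_Iio.mp hj)
    refine ContMDiffOn.smul_section ?_ hj'
    refine ContMDiffOn.div₀ ?_ ?_ ?_
    · exact hj'.inner_bundle (hs.contMDiffOn i)
    · exact hj'.inner_bundle hj'
    · intro q hq
      exact inner_self_ne_zero.mpr (hne j q hq)

lemma exists_orientedFrame (o : ManifoldOrientation M) (p : M) :
    ∃ F : OrientedFrame o, p ∈ F.domain := by
  classical
  obtain ⟨U, s, hs, hU, hp, ho⟩ := o.exists_frame p
  have hc : ∀ q : M, finrank ℝ (TangentSpace I4 q) = Fintype.card (Fin 4) := fun q => by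
    simpa using (instFactFinrankTangent q).out
  refine ⟨⟨U, hU, fun q => if hq : q ∈ U then
    InnerProductSpace.gramSchmidtOrthonormalBasis (hc q) (hs.toBasisAt hq)
    else orientedBasis (o.orient q), ?_, ?_⟩, hp⟩
  · intro q
    split_ifs with hq
    · rw [gs_orientation, ho q hq]
    · exact orientedBasis_orientation _
  · intro i
    have key : ContMDiffOn I4 (I4.prod 𝓘(ℝ, E4)) ∞ (T% (fun q =>
        (‖InnerProductSpace.gramSchmidt ℝ (fun j => s j q) i‖⁻¹ : ℝ) •
          InnerProductSpace.gramSchmidt ℝ (fun j => s j q) i)) U := by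
      have h1 := contMDiffOn_gramSchmidt hs i
      refine ContMDiffOn.smul_section ?_ h1
      have hne : ∀ q ∈ U, InnerProductSpace.gramSchmidt ℝ (fun j => s j q) i ≠ 0 :=
        fun q hq => InnerProductSpace.gramSchmidt_ne_zero (𝕜 := ℝ) i (hs.linearIndependent hq)
      refine ContMDiffOn.inv₀ ?_ (fun q hq => norm_ne_zero_iff.mpr (hne q hq))
      simp only [norm_eq_sqrt_real_inner]
      intro q hq
      refine ContMDiffWithinAt.comp (t := Set.univ) q
        (g := Real.sqrt) (I' := 𝓘(ℝ, ℝ)) ?_ (h1.inner_bundle h1 q hq) (fun _ _ => Set.mem_univ _)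
      exact (Real.contDiffAt_sqrt (inner_self_ne_zero.mpr (hne q hq))).contMDiffAt.contMDiffWithinAt
    refine key.congr fun q hq => ?_
    have hb : (hs.toBasisAt hq : Fin 4 → TangentSpace I4 q) = fun j => s j q := by
      ext1 j; simp
    simp only [dif_pos hq]
    congr 1
    rw [InnerProductSpace.gramSchmidtOrthonormalBasis_apply, InnerProductSpace.gramSchmidtNormed, hb]
    · rfl
    · intro h0
      have := InnerProductSpace.gramSchmidtNormed_unit_length (𝕜 := ℝ) i (hs.toBasisAt hq).linearIndependent
      rw [h0] at this
      simp at this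

end Frames

instance instFactFinrankE3 : Fact (finrank ℝ E3 = 2 + 1) := ⟨finrank_euclideanSpace_fin⟩

section Mfd
variable {M : Type*} [TopologicalSpace M] [ChartedSpace E4 M] [IsManifold I4 ∞ M]
  [RiemannianBundle (fun p : M => TangentSpace I4 p)] {o : ManifoldOrientation M}

/-- The fibre coordinate `y_i(σ) = g(σ, s_i)` of a local oriented orthonormal frame. -/
def TwistorSpace.coord (F : OrientedFrame o) (i : Fin 3) (σ : TwistorSpace o) : ℝ :=
  bivInner σ.fiber.vec (sdFrame (F.basis σ.base) i)

/-- The trivialisation `σ ↦ (π(σ), y(σ))` of the twistor space defined by a frame. -/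
def OrientedFrame.triv (F : OrientedFrame o) :
    TwistorSpace o ≃ M × Metric.sphere (0 : E3) 1 where
  toFun σ := (σ.base, fiberEquiv _ (F.basis σ.base) (F.orientation_eq _) σ.fiber)
  invFun z := ⟨z.1, (fiberEquiv _ (F.basis z.1) (F.orientation_eq _)).symm z.2⟩
  left_inv σ := by cases σ; simp
  right_inv z := by simp

/-- The chart of the twistor space built from a frame, a chart of `M` and a stereographic
projection of the unit sphere. -/
def OrientedFrame.chart (F : OrientedFrame o) (φ : OpenPartialHomeomorph M E4)
    (v : Metric.sphere (0 : E3) 1) : PartialEquiv (TwistorSpace o) (E4 × E2) :=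
  F.triv.toPartialEquiv.trans
    ((φ.toPartialEquiv.restr F.domain).prod (stereographic' 2 v).toPartialEquiv)

lemma OrientedFrame.chart_source (F : OrientedFrame o) (φ : OpenPartialHomeomorph M E4)
    (v : Metric.sphere (0 : E3) 1) (σ : TwistorSpace o) : σ ∈ (F.chart φ v).source ↔
      (σ.base ∈ φ.source ∧ σ.base ∈ F.domain) ∧ (F.triv σ).2 ≠ v := by
  simp [OrientedFrame.chart, PartialEquiv.trans_source, OrientedFrame.triv]

lemma OrientedFrame.chart_target (F : OrientedFrame o) (φ : OpenPartialHomeomorph M E4)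
    (v : Metric.sphere (0 : E3) 1) (z : E4 × E2) : z ∈ (F.chart φ v).target ↔
      z.1 ∈ φ.target ∧ φ.symm z.1 ∈ F.domain := by
  simp [OrientedFrame.chart, PartialEquiv.trans_target]

/-- The `ℝ³`-valued change of fibre coordinates between two frames. -/
def OrientedFrame.trans (F F' : OrientedFrame o) (φ : OpenPartialHomeomorph M E4)
    (v : Metric.sphere (0 : E3) 1) (z : E4 × E2) : E3 :=
  WithLp.toLp 2 fun j => ∑ i, ((stereographic' 2 v).symm z.2 : E3) i *
    bivInner (sdFrame (F.basis (φ.symm z.1)) i) (sdFrame (F'.basis (φ.symm z.1)) j)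

lemma OrientedFrame.trans_eq (F F' : OrientedFrame o) (φ : OpenPartialHomeomorph M E4)
    (v : Metric.sphere (0 : E3) 1) (z : E4 × E2) :
    F.trans F' φ v z = ((F'.triv ((F.chart φ v).symm z)).2 : E3) := by
  ext j
  exact (fiberEquiv_fiberEquiv_symm _ _ _ (F.orientation_eq _) (F'.orientation_eq _) _ j).symm

/-- The coordinate domain over which two charts can be compared. -/
def overlap (F F' : OrientedFrame o) (φ φ' : OpenPartialHomeomorph M E4) : Set E4 :=
  φ.target ∩ φ.symm ⁻¹' (F.domain ∩ (F'.domain ∩ φ'.source))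

lemma isOpen_overlap (F F' : OrientedFrame o) (φ φ' : OpenPartialHomeomorph M E4) :
    IsOpen (overlap F F' φ φ') :=
  φ.symm.isOpen_inter_preimage
    (F.isOpen_domain.inter (F'.isOpen_domain.inter φ'.open_source))

lemma transition_source (F F' : OrientedFrame o) (φ φ' : OpenPartialHomeomorph M E4)
    (v v' : Metric.sphere (0 : E3) 1) :
    ((F.chart φ v).symm.trans (F'.chart φ' v')).source =
      (overlap F F' φ φ' ×ˢ Set.univ) ∩ F.trans F' φ v ⁻¹' {(v' : E3)}ᶜ := by
  ext z
  rw [PartialEquiv.trans_source, PartialEquiv.symm_source, Set.mem_inter_iff, Set.mem_preimage,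
    OrientedFrame.chart_target, OrientedFrame.chart_source, Set.mem_inter_iff, Set.mem_preimage, Set.mem_compl_singleton_iff,
    OrientedFrame.trans_eq, Set.mem_prod, ne_eq, ne_eq, Subtype.ext_iff]
  have : ((F.chart φ v).symm z).base = φ.symm z.1 := rfl
  rw [this]
  simp only [overlap, Set.mem_inter_iff, Set.mem_preimage, Set.mem_univ]
  tauto

variable [IsContMDiffRiemannianBundle I4 ∞ E4 (fun p : M => TangentSpace I4 p)]

lemma contMDiffOn_bivInner_sdFrame (F F' : OrientedFrame o) (i j : Fin 3) :
    ContMDiffOn I4 𝓘(ℝ, ℝ) ∞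
      (fun q => bivInner (sdFrame (F.basis q) i) (sdFrame (F'.basis q) j))
      (F.domain ∩ F'.domain) := by
  have h : ∀ a b, ContMDiffOn I4 𝓘(ℝ, ℝ) ∞ (fun q => ⟪F.basis q a, F'.basis q b⟫)
      (F.domain ∩ F'.domain) := fun a b =>
    ((F.contMDiffOn a).mono Set.inter_subset_left).inner_bundle
      ((F'.contMDiffOn b).mono Set.inter_subset_right)
  have h2 : ∀ a b c d, ContMDiffOn I4 𝓘(ℝ, ℝ) ∞ (fun q =>
      bivInner (wedge (F.basis q a) (F.basis q b)) (wedge (F'.basis q c) (F'.basis q d)))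
      (F.domain ∩ F'.domain) := fun a b c d => by
    simp only [bivInner_wedge]
    exact contMDiffOn_const.mul (((h a c).mul (h b d)).sub ((h a d).mul (h b c)))
  fin_cases i <;> fin_cases j <;>
  · simp only [sdFrame, sdPair, map_add, LinearMap.add_apply, Fin.zero_eta, Fin.mk_one,
      Fin.reduceFinMk, Matrix.cons_val_zero, Matrix.cons_val_one, Matrix.cons_val]
    exact ((h2 _ _ _ _).add (h2 _ _ _ _)).add ((h2 _ _ _ _).add (h2 _ _ _ _))

lemma contDiff_stereographic'_symm (v : Metric.sphere (0 : E3) 1) :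
    ContDiff ℝ ∞ (fun u : E2 => ((stereographic' 2 v).symm u : E3)) := by
  let U := (OrthonormalBasis.fromOrthogonalSpanSingleton (𝕜 := ℝ) 2
    (ne_zero_of_mem_unit_sphere v)).repr
  exact (contDiff_stereoInvFunAux (m := ∞) (v := v.val) |>.comp
    (ℝ ∙ (v : E3))ᗮ.subtypeL.contDiff).comp U.symm.contDiff

lemma contDiffOn_trans (F F' : OrientedFrame o) {φ : OpenPartialHomeomorph M E4}
    (hφ : φ ∈ atlas E4 M) (φ' : OpenPartialHomeomorph M E4) (v : Metric.sphere (0 : E3) 1) :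
    ContDiffOn ℝ ∞ (F.trans F' φ v) (overlap F F' φ φ' ×ˢ Set.univ) := by
  rw [contDiffOn_euclidean]
  intro j
  change ContDiffOn ℝ ∞ (fun z : E4 × E2 => ∑ i, ((stereographic' 2 v).symm z.2 : E3) i *
    bivInner (sdFrame (F.basis (φ.symm z.1)) i) (sdFrame (F'.basis (φ.symm z.1)) j)) _
  refine ContDiffOn.sum fun i _ => ContDiffOn.mul ?_ ?_
  · exact ((contDiff_euclidean.mp (contDiff_stereographic'_symm v) i).comp contDiff_snd).contDiffOn
  · rw [← contMDiffOn_iff_contDiffOn]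
    have h1 := contMDiffOn_symm_of_mem_maximalAtlas (I := I4) (n := ∞)
      (IsManifold.subset_maximalAtlas hφ)
    have h3 := (contMDiffOn_bivInner_sdFrame F F' i j).comp (t := F.domain ∩ F'.domain)
      (h1.mono (Set.inter_subset_left (t := φ.symm ⁻¹' (F.domain ∩ (F'.domain ∩ φ'.source)))))
      (fun x hx => ⟨hx.2.1, hx.2.2.1⟩)
    rw [contMDiffOn_iff_contDiffOn] at h3
    rw [contMDiffOn_iff_contDiffOn]
    exact h3.comp contDiff_fst.contDiffOn (fun z hz => hz.1)

lemma isOpen_transition_source (F F' : OrientedFrame o) {φ : OpenPartialHomeomorph M E4}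
    (hφ : φ ∈ atlas E4 M) (φ' : OpenPartialHomeomorph M E4) (v v' : Metric.sphere (0 : E3) 1) :
    IsOpen ((F.chart φ v).symm.trans (F'.chart φ' v')).source := by
  rw [transition_source]
  exact (contDiffOn_trans F F' hφ φ' v).continuousOn.isOpen_inter_preimage
    ((isOpen_overlap F F' φ φ').prod isOpen_univ) isOpen_compl_singleton

lemma contDiffOn_transition (F F' : OrientedFrame o) {φ φ' : OpenPartialHomeomorph M E4}
    (hφ : φ ∈ atlas E4 M) (hφ' : φ' ∈ atlas E4 M) (v v' : Metric.sphere (0 : E3) 1) :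
    ContDiffOn ℝ ∞ ((F.chart φ v).symm.trans (F'.chart φ' v'))
      ((F.chart φ v).symm.trans (F'.chart φ' v')).source := by
  let U' := (OrthonormalBasis.fromOrthogonalSpanSingleton (𝕜 := ℝ) 2
    (ne_zero_of_mem_unit_sphere v')).repr
  have e : ∀ z, ((F.chart φ v).symm.trans (F'.chart φ' v')) z =
      (φ' (φ.symm z.1), U' (stereoToFun (v' : E3) (F.trans F' φ v z))) := by
    intro z
    rw [OrientedFrame.trans_eq]
    rfl
  refine ContDiffOn.congr (f := fun z => (φ' (φ.symm z.1),
    U' (stereoToFun (v' : E3) (F.trans F' φ v z)))) ?_ (fun z _ => e z)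
  rw [transition_source]
  refine ContDiffOn.prodMk ?_ ?_
  · have h1 := contMDiffOn_symm_of_mem_maximalAtlas (I := I4) (n := ∞)
      (IsManifold.subset_maximalAtlas hφ)
    have h2 := contMDiffOn_of_mem_maximalAtlas (I := I4) (n := ∞)
      (IsManifold.subset_maximalAtlas hφ')
    have h3 : ContMDiffOn I4 I4 ∞ (φ' ∘ φ.symm) (overlap F F' φ φ') :=
      h2.comp (h1.mono Set.inter_subset_left) (fun x hx => hx.2.2.2)
    rw [contMDiffOn_iff_contDiffOn] at h3
    exact h3.comp contDiff_fst.contDiffOn (fun z hz => hz.1.1)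
  · have H := U'.contDiff.comp_contDiffOn (contDiffOn_stereoToFun (n := ∞) (v := (v' : E3)))
    refine H.comp ((contDiffOn_trans F F' hφ φ' v).mono Set.inter_subset_left) ?_
    intro z hz
    have hz2 := hz.2
    rw [Set.mem_preimage, Set.mem_compl_singleton_iff, OrientedFrame.trans_eq, ne_eq,
      ← Subtype.ext_iff, sphere_ext_iff, ← OrientedFrame.trans_eq, real_inner_comm] at hz2
    simpa using hz2

end Mfd

section Charted
variable {M : Type*} [TopologicalSpace M] [ChartedSpace E4 M] [IsManifold I4 ∞ M]
  [RiemannianBundle (fun p : M => TangentSpace I4 p)]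
  [IsContMDiffRiemannianBundle I4 ∞ E4 (fun p : M => TangentSpace I4 p)]
  (o : ManifoldOrientation M)

/-- A local oriented orthonormal frame which is smooth near `p`. -/
def frameAt (p : M) : OrientedFrame o := (exists_orientedFrame o p).choose

lemma mem_frameAt_domain (p : M) : p ∈ (frameAt o p).domain :=
  (exists_orientedFrame o p).choose_spec

/-- The smooth atlas of the twistor space. -/
def twistorCore : ChartedSpaceCore (E4 × E2) (TwistorSpace o) where
  atlas := {c | ∃ (F : OrientedFrame o) (φ : OpenPartialHomeomorph M E4)
    (v : Metric.sphere (0 : E3) 1), φ ∈ atlas E4 M ∧ c = F.chart φ v}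
  chartAt σ := (frameAt o σ.base).chart (chartAt E4 σ.base) (-((frameAt o σ.base).triv σ).2)
  mem_chart_source σ := by
    rw [OrientedFrame.chart_source]
    exact ⟨⟨mem_chart_source E4 σ.base, mem_frameAt_domain o σ.base⟩,
      ne_neg_of_mem_unit_sphere ℝ _⟩
  chart_mem_atlas σ := ⟨_, _, _, chart_mem_atlas E4 σ.base, rfl⟩
  open_source := by
    rintro _ _ ⟨F, φ, v, hφ, rfl⟩ ⟨F', φ', v', -, rfl⟩
    exact isOpen_transition_source F F' hφ φ' v v'
  continuousOn_toFun := by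
    rintro _ _ ⟨F, φ, v, hφ, rfl⟩ ⟨F', φ', v', hφ', rfl⟩
    exact (contDiffOn_transition F F' hφ hφ' v v').continuousOn

instance instTopologicalSpaceTwistor : TopologicalSpace (TwistorSpace o) :=
  (twistorCore o).toTopologicalSpace

instance instChartedSpaceTwistor : ChartedSpace (E4 × E2) (TwistorSpace o) :=
  (twistorCore o).toChartedSpace

/-- The model with corners of the twistor space. -/
abbrev I6 := 𝓘(ℝ, E4 × E2)

instance instIsManifoldTwistor : IsManifold I6 ∞ (TwistorSpace o) := by
  refine isManifold_of_contDiffOn I6 ∞ (TwistorSpace o) ?_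
  intro e e' he he'
  obtain ⟨_, ⟨c, rfl⟩, ⟨_, ⟨⟨F, φ, v, hφ, rfl⟩, rfl⟩, h⟩⟩ := he
  obtain ⟨_, ⟨c, rfl⟩, ⟨_, ⟨⟨F', φ', v', hφ', rfl⟩, rfl⟩, h'⟩⟩ := he'
  rw [Set.mem_singleton_iff.mp h, Set.mem_singleton_iff.mp h']
  have := contDiffOn_transition F F' hφ hφ' v v'
  simp only [modelWithCornersSelf_coe, modelWithCornersSelf_coe_symm, Function.comp_id,
    Function.id_comp, Set.range_id, Set.inter_univ, Set.preimage_id]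
  exact this

end Charted

section LeviCivita
variable {E : Type*} [NormedAddCommGroup E] [NormedSpace ℝ E]
  {N : Type*} [TopologicalSpace N] [ChartedSpace E N]

/-- The derivative `v(φ)` of a function in the direction of a tangent vector. -/
def dirDeriv (φ : N → ℝ) (x : N) (v : TangentSpace 𝓘(ℝ, E) x) : ℝ :=
  mvfderiv 𝓘(ℝ, E) φ x v

/-- The right-hand side of the Koszul formula for `2 G(∇_X Y, Z)`. -/
def koszul (G : ∀ x : N, TangentSpace 𝓘(ℝ, E) x → TangentSpace 𝓘(ℝ, E) x → ℝ)
    (X Y Z : Π x : N, TangentSpace 𝓘(ℝ, E) x) (x : N) : ℝ :=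
  dirDeriv (fun y => G y (Y y) (Z y)) x (X x) + dirDeriv (fun y => G y (X y) (Z y)) x (Y x)
    - dirDeriv (fun y => G y (X y) (Y y)) x (Z x)
    + G x (VectorField.mlieBracket 𝓘(ℝ, E) X Y x) (Z x)
    - G x (VectorField.mlieBracket 𝓘(ℝ, E) X Z x) (Y x)
    - G x (VectorField.mlieBracket 𝓘(ℝ, E) Y Z x) (X x)

variable [IsManifold 𝓘(ℝ, E) 1 N]

/-- The Levi-Civita covariant derivative `∇_v Y` at `x` of the (pseudo-)Riemannian metric `G`: the
vector `w` such that `2 G(w, Z)` is given by the Koszul formula for all vector fields `X`, `Z` that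
are differentiable at `x`, with `X x = v`. For a smooth metric and `Y` differentiable at `x` there is
exactly one such vector. -/
def leviCivita (G : ∀ x : N, TangentSpace 𝓘(ℝ, E) x → TangentSpace 𝓘(ℝ, E) x → ℝ) {x : N}
    (v : TangentSpace 𝓘(ℝ, E) x) (Y : Π y : N, TangentSpace 𝓘(ℝ, E) y) : TangentSpace 𝓘(ℝ, E) x :=
  Classical.epsilon fun w => ∀ X Z : Π y : N, TangentSpace 𝓘(ℝ, E) y,
    MDifferentiableAt 𝓘(ℝ, E) (𝓘(ℝ, E).prod 𝓘(ℝ, E)) (T% X) x →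
    MDifferentiableAt 𝓘(ℝ, E) (𝓘(ℝ, E).prod 𝓘(ℝ, E)) (T% Z) x →
    X x = v → 2 * G x w (Z x) = koszul G X Y Z x

/-- The curvature tensor with the sign convention `R(X, Y) = ∇_[X,Y] - [∇_X, ∇_Y]`, computed with
the extensions of the three vectors that are constant in a local trivialisation. -/
def curvature (G : ∀ x : N, TangentSpace 𝓘(ℝ, E) x → TangentSpace 𝓘(ℝ, E) x → ℝ) (x : N)
    (u v w : TangentSpace 𝓘(ℝ, E) x) : TangentSpace 𝓘(ℝ, E) x :=
  let X : Π y : N, TangentSpace 𝓘(ℝ, E) y := FiberBundle.extend E u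
  let Y : Π y : N, TangentSpace 𝓘(ℝ, E) y := FiberBundle.extend E v
  let Z : Π y : N, TangentSpace 𝓘(ℝ, E) y := FiberBundle.extend E w
  leviCivita G (VectorField.mlieBracket 𝓘(ℝ, E) X Y x) Z
    - (leviCivita G u (fun y => leviCivita G (Y y) Z) - leviCivita G v (fun y => leviCivita G (X y) Z))

/-- The covariant derivative `(∇_a η)(b, c) = a(η(B, C)) - η(∇_a B, c) - η(b, ∇_a C)` of a 2-form `η`
with respect to the Levi-Civita connection of `G`, where `B`, `C` are smooth local extensions of
`b`, `c`. -/
def covDerivTwoForm (G η : ∀ x : N, TangentSpace 𝓘(ℝ, E) x → TangentSpace 𝓘(ℝ, E) x → ℝ) (x : N)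
    (a b c : TangentSpace 𝓘(ℝ, E) x) : ℝ :=
  let B : Π y : N, TangentSpace 𝓘(ℝ, E) y := FiberBundle.extend E b
  let C : Π y : N, TangentSpace 𝓘(ℝ, E) y := FiberBundle.extend E c
  dirDeriv (fun y => η y (B y) (C y)) x a - η x (leviCivita G a B) c - η x b (leviCivita G a C)

end LeviCivita

section Twistor
variable {M : Type*} [TopologicalSpace M] [ChartedSpace E4 M] [IsManifold I4 ∞ M]
  [RiemannianBundle (fun p : M => TangentSpace I4 p)]

/-- The Riemannian metric of `M`. -/
def baseMetric (p : M) (u v : TangentSpace I4 p) : ℝ := ⟪u, v⟫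

/-- The curvature operator `ℛ` of `M` at `p`, with `g(ℛ(X ∧ Y), Z ∧ T) = g(R(X, Y) Z, T)`. -/
def baseCurvatureOperator (p : M) :
    ⋀[ℝ]^2 (TangentSpace I4 p) → ⋀[ℝ]^2 (TangentSpace I4 p) :=
  curvatureOperator (curvature (baseMetric (M := M)) p)

/-- The covariant derivative `∇_v s_i` in `Λ²TM` of the section `s_i` defined by a frame, by the
Leibniz rule `∇(E ∧ E') = ∇E ∧ E' + E ∧ ∇E'`. -/
def nablaSdFrame {o : ManifoldOrientation M} (F : OrientedFrame o) (i : Fin 3) {p : M}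
    (v : TangentSpace I4 p) : ⋀[ℝ]^2 (TangentSpace I4 p) :=
  let dF : Fin 4 → TangentSpace I4 p := fun a => leviCivita (baseMetric (M := M)) v (fun q => F.basis q a)
  sdPair dF (F.basis p) i + sdPair (F.basis p) dF i

variable [IsContMDiffRiemannianBundle I4 ∞ E4 (fun p : M => TangentSpace I4 p)]
  {o : ManifoldOrientation M}

namespace TwistorSpace

/-- The differential `π_*` of the projection. -/
def projDeriv (σ : TwistorSpace o) (A : TangentSpace I6 σ) : TangentSpace I4 σ.base :=
  mfderiv I6 I4 (TwistorSpace.base (o := o)) σ A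

/-- The vertical part `𝒱A` of a tangent vector of the twistor space, as an element of `Λ²T_pM`. It is
the connection map `∑ dy_i(A) s_i + y_i ∇_{π_* A} s_i`; for a section `s` it sends `s_* X` to `∇_X s`,
so that its kernel is the horizontal space. -/
def vertPart (σ : TwistorSpace o) (A : TangentSpace I6 σ) : ⋀[ℝ]^2 (TangentSpace I4 σ.base) :=
  ∑ i, (dirDeriv (coord (frameAt o σ.base) i) σ A • sdFrame ((frameAt o σ.base).basis σ.base) i +
    coord (frameAt o σ.base) i σ • nablaSdFrame (frameAt o σ.base) i (projDeriv σ A))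

/-- `U` lies in the vertical space `𝒱_σ`, the orthogonal complement of `σ` in `Λ²₊T_pM`. -/
def IsVertical (σ : TwistorSpace o) (U : ⋀[ℝ]^2 (TangentSpace I4 σ.base)) : Prop :=
  hodgeStar (o.orient σ.base) U = U ∧ bivInner σ.fiber.vec U = 0

/-- The tangent vector at `σ` with `π_* A = X` and vertical part `U`. It exists and is unique for `U`
in the vertical space `𝒱_σ`. -/
def lift (σ : TwistorSpace o) (X : TangentSpace I4 σ.base)
    (U : ⋀[ℝ]^2 (TangentSpace I4 σ.base)) : TangentSpace I6 σ :=
  Classical.epsilon fun A => projDeriv σ A = X ∧ vertPart σ A = U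

/-- The horizontal lift `X^h` at `σ`. -/
def hLift (σ : TwistorSpace o) (X : TangentSpace I4 σ.base) : TangentSpace I6 σ := σ.lift X 0

/-- The element `U` of `𝒱_σ` as a vertical tangent vector of the twistor space. -/
def vLift (σ : TwistorSpace o) (U : ⋀[ℝ]^2 (TangentSpace I4 σ.base)) : TangentSpace I6 σ :=
  σ.lift 0 U

/-- The metric `h_t = π^* g + t g^v`. -/
def metric (t : ℝ) (σ : TwistorSpace o) (A B : TangentSpace I6 σ) : ℝ :=
  ⟪σ.projDeriv A, σ.projDeriv B⟫ + t * bivInner (σ.vertPart A) (σ.vertPart B)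

/-- The fibre preserving map of the twistor space given by maps of the fibres. -/
@[reducible]
def fibreMap (f : ∀ p : M, TwistorFiber (o.orient p) → TwistorFiber (o.orient p))
    (σ : TwistorSpace o) : TwistorSpace o := ⟨σ.base, f σ.base σ.fiber⟩

/-- The vertical part `𝒱 f_* A` at `f(σ)` of the image of `A` under the differential of `f`. -/
def vertPush (f : ∀ p : M, TwistorFiber (o.orient p) → TwistorFiber (o.orient p))
    (σ : TwistorSpace o) (A : TangentSpace I6 σ) : ⋀[ℝ]^2 (TangentSpace I4 σ.base) :=
  vertPart (fibreMap f σ) (mfderiv I6 I6 (fibreMap f) σ A)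

/-- The almost complex structure `𝒥_f`: `X^h ↦ (K_{f(σ)} X)^h` and `U ↦ σ × U`. -/
def almostComplex (f : ∀ p : M, TwistorFiber (o.orient p) → TwistorFiber (o.orient p))
    (σ : TwistorSpace o) (A : TangentSpace I6 σ) : TangentSpace I6 σ :=
  σ.lift (bivEndo (fibreMap f σ).fiber.vec (σ.projDeriv A))
    (cross (o.orient σ.base) σ.fiber.vec (σ.vertPart A))

/-- The Kähler form `Ω(A, B) = h_t(𝒥_f A, B)`. -/
def kaehlerForm (f : ∀ p : M, TwistorFiber (o.orient p) → TwistorFiber (o.orient p))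
    (t : ℝ) (σ : TwistorSpace o) (A B : TangentSpace I6 σ) : ℝ :=
  metric t σ (almostComplex f σ A) B

/-- The covariant derivative `(D_A Ω)(B, C)` with respect to the Levi-Civita connection of `h_t`. -/
def kaehlerFormDeriv (f : ∀ p : M, TwistorFiber (o.orient p) → TwistorFiber (o.orient p))
    (t : ℝ) (σ : TwistorSpace o) (A B C : TangentSpace I6 σ) : ℝ :=
  covDerivTwoForm (metric t) (kaehlerForm f t) σ A B C

end TwistorSpace
end Twistor

end TwistorGeometry

end

open TwistorGeometry

/-! Over the domain of an oriented orthonormal frame `F` of M, a point of the twistor space is a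
pair (p, y) with y a unit vector of ℝ³, the coordinates with respect to (s₁, s₂, s₃). The induced
connection on self-dual bivectors is an ℝ³-valued form α (`sdConn`) acting by y ↦ α × y. Hence the
vertical part of A has coordinates dy(A) + α(π_* A) × y (`vertCoord`), and it may be computed in any
frame (`vertPart_eq`).

Since Ω(B, C) = h_t(𝒥B, C) and 𝒥 is skew, 2 (D_A Ω)(B, C) = 2 A(Ω(B, C)) + κ(A, B, P) - κ(A, C, Q).
Here κ is the Koszul expression of h_t, and P, Q are any differentiable fields with the values 𝒥C,
𝒥B at the point (`two_mul_covDerivTwoForm`). All fields are taken of the form `stdField F x c`: the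
projection has constant components x in the frame and the vertical part is c × y. Every tangent
vector is a value of such a field, because (y × u) × y = u for u orthogonal to the unit vector y.
The bracket of two such fields projects to the bracket on M. Its vertical part is the curvature of
the bundle of self-dual bivectors applied to y, plus terms algebraic in α and the constants c
(`vertCoord_mlieBracket_stdField`). So κ splits into 2 g(∇_X X', X'') on M and t times an algebraic
expression on the fibre (`koszul_stdField`).

Three groups of terms remain. The derivative of the coordinates of f together with the base terms
g(∇_X Y, K Z) and g(∇_X Z, K Y) gives 2 g(𝒱 f_* A, Y ∧ Z), since ∇ acts on Λ² as a derivation and is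
skew (`bivInner_connection`). The fibre terms without curvature cancel identically
(`fibreForm_parallel`), which is the infinitesimal form of the fact that a round 2-sphere is Kähler.
What is left is linear in the curvature, and the selfadjointness of ℛ brings it to the form g(ℛ(U),
X ∧ Y).

The outcome is one formula for arbitrary A, B, C (`kaehlerFormDeriv_eq`). The six stated formulas
are obtained from it by letting projections or vertical parts vanish. -/

noncomputable section

namespace TwistorGeometry

/-! ### Directional derivatives of functions and the Lie bracket as a commutator -/

section VectorFields
variable {E : Type*} [NormedAddCommGroup E] [NormedSpace ℝ E]
  {N : Type*} [TopologicalSpace N] [ChartedSpace E N]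

/-- A vector field is differentiable at a point. -/
abbrev FieldDiffAt [IsManifold 𝓘(ℝ, E) 1 N] (X : Π x : N, TangentSpace 𝓘(ℝ, E) x) (x : N) : Prop :=
  MDifferentiableAt 𝓘(ℝ, E) (𝓘(ℝ, E).prod 𝓘(ℝ, E)) (T% X) x

/-- A function is differentiable at a point. -/
abbrev FunDiffAt (f : N → ℝ) (x : N) : Prop := MDifferentiableAt 𝓘(ℝ, E) 𝓘(ℝ, ℝ) f x

section dirDeriv
variable {f g : N → ℝ} {x : N}

lemma dirDeriv_add (hf : MDifferentiableAt 𝓘(ℝ, E) 𝓘(ℝ, ℝ) f x)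
    (hg : MDifferentiableAt 𝓘(ℝ, E) 𝓘(ℝ, ℝ) g x) (v : TangentSpace 𝓘(ℝ, E) x) :
    dirDeriv (fun y => f y + g y) x v = dirDeriv f x v + dirDeriv g x v := by
  unfold dirDeriv
  rw [mvfderiv_fun_add hf hg]; rfl

lemma dirDeriv_sub (hf : MDifferentiableAt 𝓘(ℝ, E) 𝓘(ℝ, ℝ) f x)
    (hg : MDifferentiableAt 𝓘(ℝ, E) 𝓘(ℝ, ℝ) g x) (v : TangentSpace 𝓘(ℝ, E) x) :
    dirDeriv (fun y => f y - g y) x v = dirDeriv f x v - dirDeriv g x v := by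
  unfold dirDeriv
  rw [mvfderiv_fun_sub hf hg]; rfl

lemma dirDeriv_mul (hf : MDifferentiableAt 𝓘(ℝ, E) 𝓘(ℝ, ℝ) f x)
    (hg : MDifferentiableAt 𝓘(ℝ, E) 𝓘(ℝ, ℝ) g x) (v : TangentSpace 𝓘(ℝ, E) x) :
    dirDeriv (fun y => f y * g y) x v = f x * dirDeriv g x v + g x * dirDeriv f x v := by
  unfold dirDeriv
  rw [mvfderiv_fun_mul hf hg]; rfl

lemma dirDeriv_const (c : ℝ) (v : TangentSpace 𝓘(ℝ, E) x) :
    dirDeriv (fun _ => c) x v = 0 := by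
  unfold dirDeriv
  rw [mvfderiv_const]; rfl

lemma dirDeriv_const_mul (c : ℝ) (hf : MDifferentiableAt 𝓘(ℝ, E) 𝓘(ℝ, ℝ) f x)
    (v : TangentSpace 𝓘(ℝ, E) x) :
    dirDeriv (fun y => c * f y) x v = c * dirDeriv f x v := by
  rw [dirDeriv_mul mdifferentiableAt_const hf, dirDeriv_const]; ring

/-- The sum rule needs differentiability of the partial sums, so one induction carries both
statements. Where only differentiability is wanted, the lemma is applied with direction 0. -/
lemma dirDeriv_sum {ι : Type*} (s : Finset ι) {f : ι → N → ℝ}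
    (hf : ∀ i ∈ s, MDifferentiableAt 𝓘(ℝ, E) 𝓘(ℝ, ℝ) (f i) x) (v : TangentSpace 𝓘(ℝ, E) x) :
    MDifferentiableAt 𝓘(ℝ, E) 𝓘(ℝ, ℝ) (fun y => ∑ i ∈ s, f i y) x ∧
    dirDeriv (fun y => ∑ i ∈ s, f i y) x v = ∑ i ∈ s, dirDeriv (f i) x v := by
  classical
  induction s using Finset.induction_on with
  | empty => simpa using ⟨mdifferentiableAt_const, dirDeriv_const 0 v⟩
  | insert a s ha ih =>
    obtain ⟨h1, h2⟩ := ih fun i hi => hf i (Finset.mem_insert_of_mem hi)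
    have h0 := hf a (Finset.mem_insert_self a s)
    simp only [Finset.sum_insert ha]
    exact ⟨h0.add h1, by rw [dirDeriv_add h0 h1, h2]⟩

lemma dirDeriv_congr (h : f =ᶠ[𝓝 x] g) (v : TangentSpace 𝓘(ℝ, E) x) :
    dirDeriv f x v = dirDeriv g x v := by
  have h1 : mfderiv 𝓘(ℝ, E) 𝓘(ℝ, ℝ) f x v = mfderiv 𝓘(ℝ, E) 𝓘(ℝ, ℝ) g x v := by
    rw [h.mfderiv_eq]; rfl
  exact h1

lemma dirDeriv_vec_add (v w : TangentSpace 𝓘(ℝ, E) x) :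
    dirDeriv f x (v + w) = dirDeriv f x v + dirDeriv f x w := map_add _ _ _

lemma dirDeriv_vec_smul (c : ℝ) (v : TangentSpace 𝓘(ℝ, E) x) :
    dirDeriv f x (c • v) = c * dirDeriv f x v := map_smul _ _ _

end dirDeriv

/-- A vector field read in the chart at `x`. -/
def chartField (x : N) (X : Π x : N, TangentSpace 𝓘(ℝ, E) x) (z : E) : E :=
  VectorField.mpullbackWithin 𝓘(ℝ, E) 𝓘(ℝ, E) (extChartAt 𝓘(ℝ, E) x).symm X
    (Set.range 𝓘(ℝ, E)) z

variable [IsManifold 𝓘(ℝ, E) ∞ N] [CompleteSpace E]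

lemma isManifold_minSmoothness_two : IsManifold 𝓘(ℝ, E) (minSmoothness ℝ 2) N := by
  rw [minSmoothness_of_isRCLikeNormedField]; infer_instance

lemma isManifold_minSmoothness_three : IsManifold 𝓘(ℝ, E) (minSmoothness ℝ 3) N := by
  rw [minSmoothness_of_isRCLikeNormedField]; infer_instance

attribute [local instance] isManifold_minSmoothness_two isManifold_minSmoothness_three

lemma differentiableAt_chartField {x : N} {X : Π x : N, TangentSpace 𝓘(ℝ, E) x}
    (hX : FieldDiffAt X x) :
    DifferentiableAt ℝ (chartField x X) (extChartAt 𝓘(ℝ, E) x x) := by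
  have h : DifferentiableWithinAt ℝ (chartField x X) _ _ := (mdifferentiableWithinAt_univ.mpr hX)
    |>.differentiableWithinAt_mpullbackWithin_vectorField
  rwa [Set.preimage_univ, ModelWithCorners.range_eq_univ, Set.univ_inter,
    differentiableWithinAt_univ] at h

lemma dirDeriv_eq_fderiv_chartField {f : N → ℝ} {x : N} {X : Π x : N, TangentSpace 𝓘(ℝ, E) x}
    {z : E} (hz : z ∈ (extChartAt 𝓘(ℝ, E) x).target)
    (hf : FunDiffAt (E := E) f ((extChartAt 𝓘(ℝ, E) x).symm z)) :
    dirDeriv f ((extChartAt 𝓘(ℝ, E) x).symm z) (X ((extChartAt 𝓘(ℝ, E) x).symm z)) =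
      fderiv ℝ (f ∘ (extChartAt 𝓘(ℝ, E) x).symm) z (chartField x X z) := by
  set φ := extChartAt 𝓘(ℝ, E) x
  have hinv := isInvertible_mfderivWithin_extChartAt_symm (I := 𝓘(ℝ, E)) hz
  have hd : MDifferentiableAt 𝓘(ℝ, E) 𝓘(ℝ, E) φ.symm z := by
    have := (contMDiffWithinAt_extChartAt_symm_range (I := 𝓘(ℝ, E)) (n := 1) x hz)
      |>.mdifferentiableWithinAt one_ne_zero
    rwa [ModelWithCorners.range_eq_univ, mdifferentiableWithinAt_univ] at this
  have h : mfderiv 𝓘(ℝ, E) 𝓘(ℝ, ℝ) (f ∘ φ.symm) z (chartField (E := E) x X z) =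
      mfderiv 𝓘(ℝ, E) 𝓘(ℝ, ℝ) f (φ.symm z)
        (mfderiv 𝓘(ℝ, E) 𝓘(ℝ, E) φ.symm z (chartField (E := E) x X z)) := mfderiv_comp_apply z hf hd _
  rw [mfderiv_eq_fderiv] at h
  refine Eq.trans ?_ h.symm
  have h3 : mfderiv 𝓘(ℝ, E) 𝓘(ℝ, E) φ.symm z (chartField (E := E) x X z) = X (φ.symm z) := by
    have h2 : mfderiv 𝓘(ℝ, E) 𝓘(ℝ, E) φ.symm z =
        mfderivWithin 𝓘(ℝ, E) 𝓘(ℝ, E) φ.symm (Set.range 𝓘(ℝ, E)) z := by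
      rw [ModelWithCorners.range_eq_univ, mfderivWithin_univ]
    rw [h2]
    -- `chartField` applies the inverse of the differential of the inverse chart; that differential
    -- is invertible on the target, so applying it again returns X.
    exact (hinv.inverse_apply_eq.mp rfl).symm
  rw [h3]
  rfl

lemma two_le_infty : (2 : ℕ∞ω) ≤ ∞ := WithTop.coe_le_coe.mpr le_top

lemma contDiffAt_comp_extChartAt_symm {f : N → ℝ} {x : N} {n : ℕ∞ω} (hn : n ≤ ∞)
    (hf : ContMDiffAt 𝓘(ℝ, E) 𝓘(ℝ, ℝ) n f x) :
    ContDiffAt ℝ n (f ∘ (extChartAt 𝓘(ℝ, E) x).symm) (extChartAt 𝓘(ℝ, E) x x) := by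
  have : IsManifold 𝓘(ℝ, E) n N := IsManifold.of_le hn
  rw [← contMDiffAt_iff_contDiffAt]
  refine ContMDiffAt.comp_of_eq hf ?_ (extChartAt_to_inv x)
  have := contMDiffWithinAt_extChartAt_symm_range (I := 𝓘(ℝ, E)) (n := n) x
    (mem_extChartAt_target x)
  rwa [ModelWithCorners.range_eq_univ, contMDiffWithinAt_univ] at this

lemma eventually_funDiffAt {f : N → ℝ} {x : N} (hf : ContMDiffAt 𝓘(ℝ, E) 𝓘(ℝ, ℝ) 1 f x) :
    ∀ᶠ y in 𝓝 x, FunDiffAt (E := E) f y :=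
  ((contMDiffAt_iff_contMDiffAt_nhds (by simp)).mp hf).mono
    fun _ hy => hy.mdifferentiableAt one_ne_zero

lemma dirDeriv_field_eventuallyEq {f : N → ℝ} {x : N}
    (hf : ContMDiffAt 𝓘(ℝ, E) 𝓘(ℝ, ℝ) 1 f x) (X : Π x : N, TangentSpace 𝓘(ℝ, E) x) :
    (fun y => dirDeriv f y (X y)) =ᶠ[𝓝 x]
      (fun z => fderiv ℝ (f ∘ (extChartAt 𝓘(ℝ, E) x).symm) z (chartField x X z)) ∘
        extChartAt 𝓘(ℝ, E) x := by
  filter_upwards [eventually_funDiffAt hf, extChartAt_source_mem_nhds (I := 𝓘(ℝ, E)) x]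
    with y hy hs
  have h := dirDeriv_eq_fderiv_chartField (f := f) (X := X)
    ((extChartAt 𝓘(ℝ, E) x).map_source hs) (by rwa [(extChartAt 𝓘(ℝ, E) x).left_inv hs])
  rw [(extChartAt 𝓘(ℝ, E) x).left_inv hs] at h
  exact h

lemma differentiableAt_fderiv_chartField {f : N → ℝ} {x : N}
    (hf : ContMDiffAt 𝓘(ℝ, E) 𝓘(ℝ, ℝ) 2 f x) {X : Π x : N, TangentSpace 𝓘(ℝ, E) x}
    (hX : FieldDiffAt X x) :
    DifferentiableAt ℝ (fun z => fderiv ℝ (f ∘ (extChartAt 𝓘(ℝ, E) x).symm) z (chartField x X z))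
      (extChartAt 𝓘(ℝ, E) x x) := by
  have h := contDiffAt_comp_extChartAt_symm (E := E) two_le_infty hf
  exact ((h.fderiv_right (m := 1) (by norm_num)).differentiableAt one_ne_zero).clm_apply
    (differentiableAt_chartField hX)

lemma mdifferentiableAt_dirDeriv {f : N → ℝ} {x : N}
    (hf : ContMDiffAt 𝓘(ℝ, E) 𝓘(ℝ, ℝ) 2 f x) {X : Π x : N, TangentSpace 𝓘(ℝ, E) x}
    (hX : FieldDiffAt X x) : FunDiffAt (E := E) (fun y => dirDeriv f y (X y)) x := by
  refine MDifferentiableAt.congr_of_eventuallyEq ?_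
    (dirDeriv_field_eventuallyEq (hf.of_le (by norm_num)) X)
  exact (differentiableAt_fderiv_chartField hf hX).mdifferentiableAt.comp x
    (mdifferentiableAt_extChartAt (mem_chart_source E x))

/-- Reading everything in the single chart at x turns Y(X f) into an ordinary iterated derivative in
E, where the symmetry of second derivatives is available. -/
lemma dirDeriv_dirDeriv {f : N → ℝ} {x : N}
    (hf : ContMDiffAt 𝓘(ℝ, E) 𝓘(ℝ, ℝ) 2 f x) {X Y : Π x : N, TangentSpace 𝓘(ℝ, E) x}
    (hX : FieldDiffAt X x) :
    dirDeriv (fun y => dirDeriv f y (X y)) x (Y x) =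
      fderiv ℝ (fun z => fderiv ℝ (f ∘ (extChartAt 𝓘(ℝ, E) x).symm) z (chartField x X z))
        (extChartAt 𝓘(ℝ, E) x x) (chartField x Y (extChartAt 𝓘(ℝ, E) x x)) := by
  have h := dirDeriv_eq_fderiv_chartField (f := fun y => dirDeriv f y (X y)) (X := Y)
    (mem_extChartAt_target (I := 𝓘(ℝ, E)) x)
    (by rw [extChartAt_to_inv]; exact mdifferentiableAt_dirDeriv hf hX)
  rw [extChartAt_to_inv] at h
  rw [h]
  congr 1
  refine Filter.EventuallyEq.fderiv_eq ?_
  have h1 := dirDeriv_field_eventuallyEq (hf.of_le (by norm_num)) X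
  have hc : Filter.Tendsto (extChartAt 𝓘(ℝ, E) x).symm (𝓝 (extChartAt 𝓘(ℝ, E) x x)) (𝓝 x) := by
    have := continuousAt_extChartAt_symm (I := 𝓘(ℝ, E)) x
    rwa [ContinuousAt, extChartAt_to_inv] at this
  filter_upwards [hc.eventually h1, extChartAt_target_mem_nhds (I := 𝓘(ℝ, E)) x] with z hz ht
  simp only [Function.comp_apply] at hz ⊢
  rw [hz, (extChartAt 𝓘(ℝ, E) x).right_inv ht]

/-- The Lie bracket acts on functions as the commutator of derivations. -/
lemma dirDeriv_mlieBracket {f : N → ℝ} {x : N}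
    (hf : ContMDiffAt 𝓘(ℝ, E) 𝓘(ℝ, ℝ) 2 f x) {X Y : Π x : N, TangentSpace 𝓘(ℝ, E) x}
    (hX : FieldDiffAt X x) (hY : FieldDiffAt Y x) :
    dirDeriv f x (VectorField.mlieBracket 𝓘(ℝ, E) X Y x) =
      dirDeriv (fun y => dirDeriv f y (Y y)) x (X x) -
        dirDeriv (fun y => dirDeriv f y (X y)) x (Y x) := by
  set F := f ∘ (extChartAt 𝓘(ℝ, E) x).symm
  have hF : ContDiffAt ℝ 2 F (extChartAt 𝓘(ℝ, E) x x) :=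
    contDiffAt_comp_extChartAt_symm (E := E) two_le_infty hf
  have hF' : DifferentiableAt ℝ (fderiv ℝ F) (extChartAt 𝓘(ℝ, E) x x) :=
    (hF.fderiv_right (m := 1) (by norm_num)).differentiableAt one_ne_zero
  have hb : dirDeriv f x (VectorField.mlieBracket 𝓘(ℝ, E) X Y x) =
      fderiv ℝ F (extChartAt 𝓘(ℝ, E) x x) (VectorField.lieBracket ℝ (chartField x X) (chartField x Y)
        (extChartAt 𝓘(ℝ, E) x x)) := by
    have h := dirDeriv_eq_fderiv_chartField (f := f) (X := VectorField.mlieBracket 𝓘(ℝ, E) X Y)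
      (mem_extChartAt_target (I := 𝓘(ℝ, E)) x)
      (by rw [extChartAt_to_inv]; exact hf.mdifferentiableAt (by norm_num))
    rw [extChartAt_to_inv] at h
    rw [h]
    congr 1
    have hi := isInvertible_mfderiv_extChartAt (I := 𝓘(ℝ, E)) (mem_extChartAt_source x)
    refine (isInvertible_mfderivWithin_extChartAt_symm
      (mem_extChartAt_target (I := 𝓘(ℝ, E)) x)).inverse_apply_eq.mpr ?_
    -- The point φ⁻¹(φ x) equals x only propositionally and the tangent space depends on it; a free
    -- base point y makes the substitution possible.
    have hb : ∀ y, y = x → (mfderiv 𝓘(ℝ, E) 𝓘(ℝ, E) (extChartAt 𝓘(ℝ, E) x) y) (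
        VectorField.mlieBracket 𝓘(ℝ, E) X Y y) =
          VectorField.lieBracket ℝ (chartField x X) (chartField x Y) (extChartAt 𝓘(ℝ, E) x x) := by
      rintro y rfl
      symm
      refine hi.inverse_apply_eq.mp ?_
      rw [VectorField.mlieBracket, VectorField.mlieBracketWithin_apply, Set.preimage_univ,
        Set.univ_inter, ← VectorField.lieBracketWithin_univ]
      congr 2
      exact (ModelWithCorners.range_eq_univ 𝓘(ℝ, E)).symm
    have hc := congrArg (fun L => L (VectorField.mlieBracket 𝓘(ℝ, E) X Y
      ((extChartAt 𝓘(ℝ, E) x).symm (extChartAt 𝓘(ℝ, E) x x))))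
        (mfderivWithin_extChartAt_symm_comp_mfderiv_extChartAt (I := 𝓘(ℝ, E))
          (mem_extChartAt_target x))
    rw [← hb _ (extChartAt_to_inv (I := 𝓘(ℝ, E)) x)]
    exact hc.symm
  rw [hb, dirDeriv_dirDeriv hf hX, dirDeriv_dirDeriv hf hY, VectorField.lieBracket_eq]
  rw [fderiv_clm_apply hF' (differentiableAt_chartField hX),
    fderiv_clm_apply hF' (differentiableAt_chartField hY)]
  -- Both iterated derivatives contain the second derivative of F on the pair (X, Y). By symmetry
  -- these terms cancel, and DF applied to the bracket in the chart remains.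
  have hs := hF.isSymmSndFDerivAt (by simp) (chartField x X (extChartAt 𝓘(ℝ, E) x x))
    (chartField x Y (extChartAt 𝓘(ℝ, E) x x))
  simp only [map_sub, add_apply, ContinuousLinearMap.comp_apply,
    ContinuousLinearMap.flip_apply, hs]
  ring

/-- Linear functionals composed with the chart at x already separate tangent vectors, because the
differential of the chart is invertible. -/
lemma eq_of_dirDeriv_eq {x : N} {v w : TangentSpace 𝓘(ℝ, E) x}
    (h : ∀ f : N → ℝ, ContMDiffAt 𝓘(ℝ, E) 𝓘(ℝ, ℝ) ∞ f x → dirDeriv f x v = dirDeriv f x w) :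
    v = w := by
  have hc : ContMDiffAt 𝓘(ℝ, E) 𝓘(ℝ, E) ∞ (extChartAt 𝓘(ℝ, E) x) x := contMDiffAt_extChartAt
  have hd := hc.mdifferentiableAt (by simp)
  have hi := isInvertible_mfderiv_extChartAt (I := 𝓘(ℝ, E)) (mem_extChartAt_source x)
  have key : ∀ u : TangentSpace 𝓘(ℝ, E) x, ∀ l : E →L[ℝ] ℝ,
      dirDeriv (l ∘ extChartAt 𝓘(ℝ, E) x) x u =
        l (mfderiv 𝓘(ℝ, E) 𝓘(ℝ, E) (extChartAt 𝓘(ℝ, E) x) x u) := by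
    intro u l
    have h1 : mfderiv 𝓘(ℝ, E) 𝓘(ℝ, ℝ) (l ∘ extChartAt 𝓘(ℝ, E) x) x u = _ :=
      mfderiv_comp_apply x l.differentiableAt.mdifferentiableAt hd u
    rw [mfderiv_eq_fderiv, l.fderiv] at h1
    exact h1
  obtain ⟨e, he⟩ := hi
  have h2 : e v = e w := by
    rw [← ContinuousLinearEquiv.coe_coe, he]
    refine (SeparatingDual.eq_iff_forall_dual_eq (R := ℝ) (V := E)).mpr fun l => ?_
    have := h (l ∘ extChartAt 𝓘(ℝ, E) x) (l.contDiff.contMDiff.contMDiffAt.comp x hc)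
    rwa [key, key] at this
  exact e.injective h2

end VectorFields

/-! ### The Levi-Civita connection of a nondegenerate metric from the Koszul formula -/

section LeviCivitaTheory
variable {E : Type*} [NormedAddCommGroup E] [NormedSpace ℝ E]
  {N : Type*} [TopologicalSpace N] [ChartedSpace E N] [IsManifold 𝓘(ℝ, E) ∞ N]

/-- A field of bilinear forms which takes differentiable vector fields to differentiable
functions. -/
structure IsDiffBilinear (G : ∀ x : N, TangentSpace 𝓘(ℝ, E) x → TangentSpace 𝓘(ℝ, E) x → ℝ) :
    Prop where
  add_left : ∀ x u v w, G x (u + v) w = G x u w + G x v w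
  smul_left : ∀ x (c : ℝ) u w, G x (c • u) w = c * G x u w
  add_right : ∀ x u v w, G x u (v + w) = G x u v + G x u w
  smul_right : ∀ x (c : ℝ) u w, G x u (c • w) = c * G x u w
  diffAt : ∀ {x} {X Y : Π x : N, TangentSpace 𝓘(ℝ, E) x}, FieldDiffAt X x → FieldDiffAt Y x →
    FunDiffAt (E := E) (fun y => G y (X y) (Y y)) x

/-- A differentiable field of nondegenerate symmetric bilinear forms. -/
structure IsDiffMetric (G : ∀ x : N, TangentSpace 𝓘(ℝ, E) x → TangentSpace 𝓘(ℝ, E) x → ℝ) : Prop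
    extends IsDiffBilinear G where
  symm : ∀ x u v, G x u v = G x v u
  nondeg : ∀ x u, (∀ v, G x u v = 0) → u = 0

variable {G : ∀ x : N, TangentSpace 𝓘(ℝ, E) x → TangentSpace 𝓘(ℝ, E) x → ℝ} {x : N}

namespace IsDiffBilinear



lemma neg_left (hG : IsDiffBilinear G) (u v : TangentSpace 𝓘(ℝ, E) x) : G x (-u) v = - G x u v := by
  rw [← neg_one_smul ℝ u, hG.smul_left]; ring

lemma sub_left (hG : IsDiffBilinear G) (u v w : TangentSpace 𝓘(ℝ, E) x) : G x (u - v) w = G x u w - G x v w := by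
  rw [sub_eq_add_neg, hG.add_left, hG.neg_left]; ring

end IsDiffBilinear

variable [FiniteDimensional ℝ E]

namespace IsDiffMetric

/-- When Z is replaced by f Z, the terms (X f) G(Y, Z) and (Y f) G(X, Z) produced by the product
rule are cancelled by those produced by the brackets [X, f Z] and [Y, f Z]. -/
lemma koszul_tensorial_right (hG : IsDiffMetric G) {X Y : Π x : N, TangentSpace 𝓘(ℝ, E) x}
    (hX : FieldDiffAt X x) (hY : FieldDiffAt Y x) :
    TensorialAt 𝓘(ℝ, E) E (fun Z => koszul G X Y Z x) x where
  smul {f Z} hf hZ := by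
    have : CompleteSpace E := FiniteDimensional.complete ℝ E
    simp only [koszul, Pi.smul_apply', hG.smul_right, smul_eq_mul]
    rw [dirDeriv_mul hf (hG.diffAt hY hZ), dirDeriv_mul hf (hG.diffAt hX hZ), dirDeriv_vec_smul,
      VectorField.mlieBracket_smul_right hf hZ, VectorField.mlieBracket_smul_right hf hZ]
    simp only [hG.add_left, hG.smul_left]
    rw [hG.symm x (Z x) (Y x), hG.symm x (Z x) (X x)]
    simp only [dirDeriv]
    ring
  add {Z Z'} hZ hZ' := by
    have : CompleteSpace E := FiniteDimensional.complete ℝ E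
    simp only [koszul, Pi.add_apply, hG.add_right]
    rw [dirDeriv_add (hG.diffAt hY hZ) (hG.diffAt hY hZ'),
      dirDeriv_add (hG.diffAt hX hZ) (hG.diffAt hX hZ'), dirDeriv_vec_add,
      VectorField.mlieBracket_add_right hZ hZ', VectorField.mlieBracket_add_right hZ hZ']
    simp only [hG.add_left]
    ring

/-- When X is replaced by f X, the terms with Y f and Z f from the product rule are cancelled by
those from [f X, Y] and [f X, Z]. -/
lemma koszul_tensorial_left (hG : IsDiffMetric G) {Y Z : Π x : N, TangentSpace 𝓘(ℝ, E) x}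
    (hY : FieldDiffAt Y x) (hZ : FieldDiffAt Z x) :
    TensorialAt 𝓘(ℝ, E) E (fun X => koszul G X Y Z x) x where
  smul {f X} hf hX := by
    have : CompleteSpace E := FiniteDimensional.complete ℝ E
    simp only [koszul, Pi.smul_apply', hG.smul_right, hG.smul_left, smul_eq_mul]
    rw [dirDeriv_mul hf (hG.diffAt hX hZ), dirDeriv_mul hf (hG.diffAt hX hY), dirDeriv_vec_smul,
      VectorField.mlieBracket_smul_left hf hX, VectorField.mlieBracket_smul_left hf hX]
    simp only [hG.add_left, hG.smul_left]
    rw [hG.symm x (X x) (Y x)]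
    simp only [dirDeriv]
    ring
  add {X X'} hX hX' := by
    have : CompleteSpace E := FiniteDimensional.complete ℝ E
    simp only [koszul, Pi.add_apply, hG.add_right, hG.add_left]
    rw [dirDeriv_add (hG.diffAt hX hZ) (hG.diffAt hX' hZ),
      dirDeriv_add (hG.diffAt hX hY) (hG.diffAt hX' hY), dirDeriv_vec_add,
      VectorField.mlieBracket_add_left hX hX', VectorField.mlieBracket_add_left hX hX']
    simp only [hG.add_left]
    ring

/-- A nondegenerate form represents every linear functional. -/
lemma exists_repr (hG : IsDiffMetric G) (l : TangentSpace 𝓘(ℝ, E) x →ₗ[ℝ] ℝ) :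
    ∃ w, ∀ z, G x w z = l z := by
  have : FiniteDimensional ℝ (TangentSpace 𝓘(ℝ, E) x) := inferInstanceAs (FiniteDimensional ℝ E)
  let B : TangentSpace 𝓘(ℝ, E) x →ₗ[ℝ] (TangentSpace 𝓘(ℝ, E) x →ₗ[ℝ] ℝ) :=
    LinearMap.mk₂ ℝ (G x) (hG.add_left x) (hG.smul_left x) (hG.add_right x) (hG.smul_right x)
  have hB : Function.Injective B := by
    rw [← LinearMap.ker_eq_bot, LinearMap.ker_eq_bot']
    intro u hu
    exact hG.nondeg x u fun v => LinearMap.congr_fun hu v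
  have hs := (LinearMap.injective_iff_surjective_of_finrank_eq_finrank
    (Subspace.dual_finrank_eq (K := ℝ) (V := TangentSpace 𝓘(ℝ, E) x)).symm).mp hB
  obtain ⟨w, hw⟩ := hs l
  exact ⟨w, fun z => LinearMap.congr_fun hw z⟩

/-- This justifies the choice made in `leviCivita`. By tensoriality in Z the Koszul expression is a
linear functional of Z(x), and a nondegenerate form in finite dimension represents it. -/
lemma leviCivita_spec (hG : IsDiffMetric G) {X Y Z : Π x : N, TangentSpace 𝓘(ℝ, E) x}
    (hX : FieldDiffAt X x) (hY : FieldDiffAt Y x) (hZ : FieldDiffAt Z x)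
    {v : TangentSpace 𝓘(ℝ, E) x} (hv : X x = v) :
    2 * G x (leviCivita G v Y) (Z x) = koszul G X Y Z x := by
  have ex : ∃ w, ∀ X Z : Π y : N, TangentSpace 𝓘(ℝ, E) y,
      FieldDiffAt X x → FieldDiffAt Z x → X x = v → 2 * G x w (Z x) = koszul G X Y Z x := by
    have hV : FieldDiffAt (FiberBundle.extend E v) x :=
      FiberBundle.mdifferentiableAt_extend 𝓘(ℝ, E) E v
    have hV' : FiberBundle.extend E v x = v := FiberBundle.extend_apply_self E v
    obtain ⟨w, hw⟩ := hG.exists_repr (x := x)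
      ((1 / 2 : ℝ) • (TensorialAt.mkHom _ x (hG.koszul_tensorial_right hV hY)).toLinearMap)
    refine ⟨w, fun X Z hX hZ hv => ?_⟩
    rw [hw]
    have := TensorialAt.mkHom_apply (hG.koszul_tensorial_right hV hY) hZ
    simp only [LinearMap.smul_apply, ContinuousLinearMap.coe_coe, this, smul_eq_mul]
    -- The representing vector was built from one extension of v; tensoriality in X makes it serve
    -- for every extension.
    rw [(hG.koszul_tensorial_left hY hZ).pointwise hV hX (by rw [hv, hV'])]
    ring
  exact Classical.epsilon_spec ex X Z hX hZ hv

lemma eq_of_forall (hG : IsDiffMetric G) {u v : TangentSpace 𝓘(ℝ, E) x}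
    (h : ∀ Z : Π x : N, TangentSpace 𝓘(ℝ, E) x, FieldDiffAt Z x → G x u (Z x) = G x v (Z x)) :
    u = v := by
  rw [← sub_eq_zero]
  refine hG.nondeg x _ fun w => ?_
  have := h (FiberBundle.extend E w) (FiberBundle.mdifferentiableAt_extend 𝓘(ℝ, E) E w)
  rw [FiberBundle.extend_apply_self] at this
  rw [hG.sub_left, this, sub_self]

lemma leviCivita_add_left (hG : IsDiffMetric G) {Y : Π x : N, TangentSpace 𝓘(ℝ, E) x}
    (hY : FieldDiffAt Y x) (u v : TangentSpace 𝓘(ℝ, E) x) :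
    leviCivita G (u + v) Y = leviCivita G u Y + leviCivita G v Y := by
  refine hG.eq_of_forall fun Z hZ => ?_
  have h1 := FiberBundle.mdifferentiableAt_extend 𝓘(ℝ, E) E u
  have h2 := FiberBundle.mdifferentiableAt_extend 𝓘(ℝ, E) E v
  have e1 := hG.leviCivita_spec (mdifferentiableAt_add_section h1 h2) hY hZ (v := u + v) (by simp [FiberBundle.extend_apply_self])
  have e2 := hG.leviCivita_spec h1 hY hZ (v := u) (by simp)
  have e3 := hG.leviCivita_spec h2 hY hZ (v := v) (by simp)
  have e4 := (hG.koszul_tensorial_left hY hZ).add h1 h2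
  rw [hG.add_left]
  linarith

lemma leviCivita_smul_left (hG : IsDiffMetric G) {Y : Π x : N, TangentSpace 𝓘(ℝ, E) x}
    (hY : FieldDiffAt Y x) (c : ℝ) (u : TangentSpace 𝓘(ℝ, E) x) :
    leviCivita G (c • u) Y = c • leviCivita G u Y := by
  refine hG.eq_of_forall fun Z hZ => ?_
  have h1 := FiberBundle.mdifferentiableAt_extend 𝓘(ℝ, E) E u
  have hc : FunDiffAt (E := E) (fun _ : N => c) x := mdifferentiableAt_const
  have e1 := hG.leviCivita_spec (hc.smul_section h1) hY hZ (v := c • u) (by simp)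
  have e2 := hG.leviCivita_spec h1 hY hZ (v := u) (by simp)
  have e4 := (hG.koszul_tensorial_left hY hZ).smul hc h1
  rw [hG.smul_left]
  simp only [smul_eq_mul] at e4
  linear_combination (1/2) * e1 + (1/2) * e4 - (1/2) * c * e2

/-- In the sum of the Koszul formulas for (X, Y, Z) and (X, Z, Y) only the derivative of G(Y, Z)
along X survives. -/
lemma leviCivita_metric (hG : IsDiffMetric G) {Y Z : Π x : N, TangentSpace 𝓘(ℝ, E) x}
    (hY : FieldDiffAt Y x) (hZ : FieldDiffAt Z x) (v : TangentSpace 𝓘(ℝ, E) x) :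
    dirDeriv (fun y => G y (Y y) (Z y)) x v =
      G x (leviCivita G v Y) (Z x) + G x (Y x) (leviCivita G v Z) := by
  have h1 := FiberBundle.mdifferentiableAt_extend 𝓘(ℝ, E) E v
  have hv : FiberBundle.extend E v x = v := FiberBundle.extend_apply_self E v
  have e1 := hG.leviCivita_spec h1 hY hZ hv
  have e2 := hG.leviCivita_spec h1 hZ hY hv
  rw [hG.symm x (Y x)]
  have e3 : (fun y => G y (Z y) (Y y)) = fun y => G y (Y y) (Z y) :=
    funext fun y => hG.symm y _ _
  simp only [koszul, e3, hv] at e1 e2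
  rw [VectorField.mlieBracket_swap_apply (V := Z), hG.neg_left] at e2
  linarith

/-- In the difference of the Koszul formulas for (X, Y, Z) and (Y, X, Z) only the bracket [X, Y]
survives. -/
lemma leviCivita_torsion (hG : IsDiffMetric G) {X Y : Π x : N, TangentSpace 𝓘(ℝ, E) x}
    (hX : FieldDiffAt X x) (hY : FieldDiffAt Y x) :
    leviCivita G (X x) Y - leviCivita G (Y x) X = VectorField.mlieBracket 𝓘(ℝ, E) X Y x := by
  refine hG.eq_of_forall fun Z hZ => ?_
  have e1 := hG.leviCivita_spec hX hY hZ rfl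
  have e2 := hG.leviCivita_spec hY hX hZ rfl
  have e3 : (fun y => G y (Y y) (X y)) = fun y => G y (X y) (Y y) :=
    funext fun y => hG.symm y _ _
  rw [hG.sub_left]
  simp only [koszul, e3] at e1 e2
  rw [VectorField.mlieBracket_swap_apply (V := Y), hG.neg_left] at e2
  linarith

/-- Metric compatibility already determines ∇_v Y through its pairings with arbitrary Z, and the
other terms there are additive in Y. The Leibniz rule and locality below follow in the same way. -/
lemma leviCivita_add_right (hG : IsDiffMetric G) {Y Y' : Π x : N, TangentSpace 𝓘(ℝ, E) x}
    (hY : FieldDiffAt Y x) (hY' : FieldDiffAt Y' x) (v : TangentSpace 𝓘(ℝ, E) x) :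
    leviCivita G v (Y + Y') = leviCivita G v Y + leviCivita G v Y' := by
  refine hG.eq_of_forall fun Z hZ => ?_
  have e0 := hG.leviCivita_metric (mdifferentiableAt_add_section hY hY') hZ v
  have e1 := hG.leviCivita_metric hY hZ v
  have e2 := hG.leviCivita_metric hY' hZ v
  simp only [Pi.add_apply, hG.add_left] at e0
  rw [dirDeriv_add (hG.diffAt hY hZ) (hG.diffAt hY' hZ)] at e0
  rw [hG.add_left]
  linarith

lemma leviCivita_smul_right (hG : IsDiffMetric G) {Y : Π x : N, TangentSpace 𝓘(ℝ, E) x}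
    {f : N → ℝ} (hf : FunDiffAt (E := E) f x) (hY : FieldDiffAt Y x)
    (v : TangentSpace 𝓘(ℝ, E) x) :
    leviCivita G v (f • Y) = dirDeriv f x v • Y x + f x • leviCivita G v Y := by
  refine hG.eq_of_forall fun Z hZ => ?_
  have e0 := hG.leviCivita_metric (hf.smul_section hY) hZ v
  have e1 := hG.leviCivita_metric hY hZ v
  simp only [Pi.smul_apply', hG.smul_left] at e0
  rw [dirDeriv_mul hf (hG.diffAt hY hZ)] at e0
  rw [hG.add_left, hG.smul_left, hG.smul_left]
  linear_combination e0 + f x * e1 - 2 * e0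

lemma leviCivita_congr (hG : IsDiffMetric G) {Y Y' : Π x : N, TangentSpace 𝓘(ℝ, E) x}
    (hY : FieldDiffAt Y x) (hY' : FieldDiffAt Y' x) (h : ∀ᶠ y in 𝓝 x, Y y = Y' y)
    (v : TangentSpace 𝓘(ℝ, E) x) : leviCivita G v Y = leviCivita G v Y' := by
  refine hG.eq_of_forall fun Z hZ => ?_
  have e0 := hG.leviCivita_metric hY hZ v
  have e1 := hG.leviCivita_metric hY' hZ v
  rw [dirDeriv_congr (g := fun y => G y (Y' y) (Z y)) (h.mono fun y hy => by simp only [hy])] at e0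
  rw [h.self_of_nhds] at e0
  linarith

/-- The definition uses one particular pair of extensions. The right-hand side is tensorial in B and
in C, the derivatives of the factors cancelling by the Leibniz rule, so any differentiable
extensions may be used; this permits fields adapted to a frame. -/
lemma covDerivTwoForm_eq (hG : IsDiffMetric G)
    {η : ∀ x : N, TangentSpace 𝓘(ℝ, E) x → TangentSpace 𝓘(ℝ, E) x → ℝ} (hη : IsDiffBilinear η)
    {B C : Π x : N, TangentSpace 𝓘(ℝ, E) x} (hB : FieldDiffAt B x) (hC : FieldDiffAt C x)
    (a : TangentSpace 𝓘(ℝ, E) x) :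
    covDerivTwoForm G η x a (B x) (C x) = dirDeriv (fun y => η y (B y) (C y)) x a -
      η x (leviCivita G a B) (C x) - η x (B x) (leviCivita G a C) := by
  let Φ : (Π x : N, TangentSpace 𝓘(ℝ, E) x) → (Π x : N, TangentSpace 𝓘(ℝ, E) x) → ℝ :=
    fun B C => dirDeriv (fun y => η y (B y) (C y)) x a -
      η x (leviCivita G a B) (C x) - η x (B x) (leviCivita G a C)
  have h1 : ∀ C, FieldDiffAt C x → TensorialAt 𝓘(ℝ, E) E (fun B => Φ B C) x := by
    intro C hC
    refine ⟨fun {f B} hf hB => ?_, fun {B B'} hB hB' => ?_⟩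
    · simp only [Φ, hG.leviCivita_smul_right hf hB, Pi.smul_apply', hη.smul_left, hη.add_left,
        smul_eq_mul]
      rw [dirDeriv_mul hf (hη.diffAt hB hC)]; ring
    · simp only [Φ, hG.leviCivita_add_right hB hB', Pi.add_apply, hη.add_left]
      rw [dirDeriv_add (hη.diffAt hB hC) (hη.diffAt hB' hC)]; ring
  have h2 : ∀ B, FieldDiffAt B x → TensorialAt 𝓘(ℝ, E) E (fun C => Φ B C) x := by
    intro B hB
    refine ⟨fun {f C} hf hC => ?_, fun {C C'} hC hC' => ?_⟩
    · simp only [Φ, hG.leviCivita_smul_right hf hC, Pi.smul_apply', hη.smul_right, hη.add_right,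
        smul_eq_mul]
      rw [dirDeriv_mul hf (hη.diffAt hB hC)]; ring
    · simp only [Φ, hG.leviCivita_add_right hC hC', Pi.add_apply, hη.add_right]
      rw [dirDeriv_add (hη.diffAt hB hC) (hη.diffAt hB hC')]; ring
  have h3 := TensorialAt.pointwise₂ h1 h2
    (FiberBundle.mdifferentiableAt_extend 𝓘(ℝ, E) E (B x)) hB
    (FiberBundle.mdifferentiableAt_extend 𝓘(ℝ, E) E (C x)) hC (by simp) (by simp)
  simp only [Φ, FiberBundle.extend_apply_self] at h3
  exact h3

/-- The covariant derivative of a 2-form `η = G(J·, ·)` in terms of the Koszul formula. -/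
lemma two_mul_covDerivTwoForm (hG : IsDiffMetric G)
    {η : ∀ x : N, TangentSpace 𝓘(ℝ, E) x → TangentSpace 𝓘(ℝ, E) x → ℝ} (hη : IsDiffBilinear η)
    {A B C P Q : Π x : N, TangentSpace 𝓘(ℝ, E) x} (hA : FieldDiffAt A x) (hB : FieldDiffAt B x)
    (hC : FieldDiffAt C x) (hP : FieldDiffAt P x) (hQ : FieldDiffAt Q x)
    (hPC : ∀ u, η x u (C x) = - G x u (P x)) (hQB : ∀ u, η x (B x) u = G x u (Q x)) :
    2 * covDerivTwoForm G η x (A x) (B x) (C x) =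
      2 * dirDeriv (fun y => η y (B y) (C y)) x (A x) + koszul G A B P x - koszul G A C Q x := by
  -- For η = G(J·, ·) with J skew, P(x) = J C(x) and Q(x) = J B(x). Only these values enter, so J C
  -- and J B never have to be differentiated as vector fields.
  rw [hG.covDerivTwoForm_eq hη hB hC, hPC, hQB, ← hG.leviCivita_spec hA hB hP rfl,
    ← hG.leviCivita_spec hA hC hQ rfl]
  ring

end IsDiffMetric

end LeviCivitaTheory

/-! ### Curvature of the base manifold and its symmetries -/

section BaseGeometry
variable {M : Type*} [TopologicalSpace M] [ChartedSpace E4 M] [IsManifold I4 ∞ M]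
  [RiemannianBundle (fun p : M => TangentSpace I4 p)]
  [IsContMDiffRiemannianBundle I4 ∞ E4 (fun p : M => TangentSpace I4 p)]

/-- A vector field on the base is twice continuously differentiable at a point. -/
abbrev FieldC2At (X : Π p : M, TangentSpace I4 p) (p : M) : Prop :=
  ContMDiffAt I4 (I4.prod 𝓘(ℝ, E4)) 2 (T% X) p

lemma FieldC2At.fieldDiffAt {X : Π p : M, TangentSpace I4 p} {p : M} (h : FieldC2At X p) :
    FieldDiffAt X p := h.mdifferentiableAt (by norm_num)

attribute [local instance] isManifold_minSmoothness_two isManifold_minSmoothness_three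

instance instC1RiemannianBundle : IsContMDiffRiemannianBundle I4 1 E4 (TangentSpace I4 (M := M)) :=
  IsContMDiffRiemannianBundle.of_le (n := ∞) (WithTop.coe_le_coe.mpr le_top)

instance instC2RiemannianBundle : IsContMDiffRiemannianBundle I4 2 E4 (TangentSpace I4 (M := M)) :=
  IsContMDiffRiemannianBundle.of_le (n := ∞) two_le_infty

lemma isDiffMetric_baseMetric : IsDiffMetric (baseMetric (M := M)) where
  add_left _ _ _ _ := inner_add_left _ _ _
  smul_left _ _ _ _ := real_inner_smul_left _ _ _
  add_right _ _ _ _ := inner_add_right _ _ _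
  smul_right _ _ _ _ := real_inner_smul_right _ _ _
  diffAt hX hY := MDifferentiableAt.inner_bundle hX hY
  symm _ u v := real_inner_comm v u
  nondeg _ u h := inner_self_eq_zero.mp (h u)


lemma FieldC2At.inner {X Y : Π p : M, TangentSpace I4 p} {p : M} (hX : FieldC2At X p)
    (hY : FieldC2At Y p) : ContMDiffAt I4 𝓘(ℝ, ℝ) 2 (fun q => baseMetric q (X q) (Y q)) p :=
  ContMDiffAt.inner_bundle hX hY

lemma FieldC2At.eventually {X : Π p : M, TangentSpace I4 p} {p : M} (h : FieldC2At X p) :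
    ∀ᶠ q in 𝓝 p, FieldC2At X q := by
  have : IsManifold (I4.prod 𝓘(ℝ, E4)) 2 (TangentBundle I4 M) :=
    Bundle.TotalSpace.isManifold E4 (TangentSpace I4)
  exact (contMDiffAt_iff_contMDiffAt_nhds (by simp)).mp h

lemma FieldC2At.bracket {X Y : Π p : M, TangentSpace I4 p} {p : M} (hX : FieldC2At X p)
    (hY : FieldC2At Y p) : FieldDiffAt (VectorField.mlieBracket I4 X Y) p := by
  have : IsManifold I4 ((2 : ℕ∞) + 1) M := inferInstanceAs (IsManifold I4 3 M)
  have h := ContMDiffAt.mlieBracket_vectorField (m := 1) (n := 2) hX hY (by simp; norm_num)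
  exact h.mdifferentiableAt (by norm_num)

lemma FieldC2At.koszul_diffAt {X Y Z : Π p : M, TangentSpace I4 p} {p : M} (hX : FieldC2At X p)
    (hY : FieldC2At Y p) (hZ : FieldC2At Z p) :
    FunDiffAt (E := E4) (koszul (baseMetric (M := M)) X Y Z) p := by
  have hG := isDiffMetric_baseMetric (M := M)
  have h1 := mdifferentiableAt_dirDeriv (hY.inner hZ) hX.fieldDiffAt
  have h2 := mdifferentiableAt_dirDeriv (hX.inner hZ) hY.fieldDiffAt
  have h3 := mdifferentiableAt_dirDeriv (hX.inner hY) hZ.fieldDiffAt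
  exact ((((h1.add h2).sub h3).add (hG.diffAt (hX.bracket hY) hZ.fieldDiffAt)).sub
    (hG.diffAt (hX.bracket hZ) hY.fieldDiffAt)).sub (hG.diffAt (hY.bracket hZ) hX.fieldDiffAt)

variable {o : ManifoldOrientation M} (F : OrientedFrame o)

lemma OrientedFrame.fieldC2At {p : M} (hp : p ∈ F.domain) (a : Fin 4) :
    FieldC2At (fun q => F.basis q a) p :=
  ((F.contMDiffOn a).contMDiffAt (F.isOpen_domain.mem_nhds hp)).of_le two_le_infty

lemma OrientedFrame.eventually_mem {p : M} (hp : p ∈ F.domain) : ∀ᶠ q in 𝓝 p, q ∈ F.domain :=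
  F.isOpen_domain.mem_nhds hp

/-- `∇_X Y` is differentiable. -/
lemma OrientedFrame.fieldDiffAt_leviCivita {X Y : Π p : M, TangentSpace I4 p} {p : M} (hp : p ∈ F.domain)
    (hX : FieldC2At X p) (hY : FieldC2At Y p) :
    FieldDiffAt (fun q => leviCivita (baseMetric (M := M)) (X q) Y) p := by
  have hG := isDiffMetric_baseMetric (M := M)
  -- In an orthonormal frame the coefficients of ∇_X Y are half the Koszul expressions against the
  -- frame fields, and these are differentiable functions for C² fields.
  have h1 : FieldDiffAt (fun q => ∑ a, (fun q => (1 / 2 : ℝ) *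
      koszul (baseMetric (M := M)) X Y (fun q => F.basis q a) q) q • F.basis q a) p :=
    MDifferentiableAt.sum_section fun a _ => MDifferentiableAt.smul_section
      (mdifferentiableAt_const.mul (hX.koszul_diffAt hY (F.fieldC2At hp a)))
      (F.fieldC2At hp a).fieldDiffAt
  refine h1.congr_of_eventuallyEq ?_
  filter_upwards [hX.eventually, hY.eventually, F.eventually_mem hp] with q hX hY hq
  congr 1
  conv_lhs => rw [← (F.basis q).sum_repr' (leviCivita _ _ _)]
  refine Finset.sum_congr rfl fun a _ => ?_
  congr 1
  rw [← hG.leviCivita_spec hX.fieldDiffAt hY.fieldDiffAt (F.fieldC2At hq a).fieldDiffAt rfl,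
    baseMetric, real_inner_comm]
  ring


/-- `R(X, Y) Z = ∇_[X,Y] Z - [∇_X, ∇_Y] Z` for vector fields. -/
def curvatureField (X Y Z : Π p : M, TangentSpace I4 p) (p : M) : TangentSpace I4 p :=
  leviCivita (baseMetric (M := M)) (VectorField.mlieBracket I4 X Y p) Z
    - (leviCivita (baseMetric (M := M)) (X p) (fun q => leviCivita (baseMetric (M := M)) (Y q) Z)
      - leviCivita (baseMetric (M := M)) (Y p) (fun q => leviCivita (baseMetric (M := M)) (X q) Z))

lemma curvature_eq_curvatureField (p : M) (u v w : TangentSpace I4 p) :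
    curvature (baseMetric (M := M)) p u v w = curvatureField (FiberBundle.extend E4 u)
      (FiberBundle.extend E4 v) (FiberBundle.extend E4 w) p := by
  simp only [curvature, curvatureField, FiberBundle.extend_apply_self]

lemma curvatureField_swap {X Y Z : Π p : M, TangentSpace I4 p} {p : M} (hZ : FieldDiffAt Z p) :
    curvatureField X Y Z p = - curvatureField Y X Z p := by
  simp only [curvatureField]
  rw [VectorField.mlieBracket_swap_apply (V := Y), ← neg_one_smul ℝ (VectorField.mlieBracket _ _ _ _),
    isDiffMetric_baseMetric.leviCivita_smul_left hZ]
  module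

section symmetries
variable {p : M} {X Y Z W : Π p : M, TangentSpace I4 p}

/-- Metric compatibility is applied twice. The two middle terms are symmetric in X and Y, so they
disappear from the commutator in `curvatureField_skew`. -/
lemma OrientedFrame.dirDeriv_dirDeriv_inner (X : Π p : M, TangentSpace I4 p) (hp : p ∈ F.domain)
    (hY : FieldC2At Y p) (hZ : FieldC2At Z p) (hW : FieldC2At W p) :
    dirDeriv (fun q => dirDeriv (fun q => baseMetric q (Z q) (W q)) q (Y q)) p (X p) =
      baseMetric p (leviCivita baseMetric (X p) (fun q => leviCivita baseMetric (Y q) Z)) (W p) +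
      baseMetric p (leviCivita baseMetric (Y p) Z) (leviCivita baseMetric (X p) W) +
      baseMetric p (leviCivita baseMetric (X p) Z) (leviCivita baseMetric (Y p) W) +
      baseMetric p (Z p) (leviCivita baseMetric (X p) (fun q => leviCivita baseMetric (Y q) W)) := by
  have hG := isDiffMetric_baseMetric (M := M)
  have hYZ := F.fieldDiffAt_leviCivita hp hY hZ
  have hYW := F.fieldDiffAt_leviCivita hp hY hW
  rw [dirDeriv_congr (g := fun q => baseMetric q (leviCivita baseMetric (Y q) Z) (W q) +
      baseMetric q (Z q) (leviCivita baseMetric (Y q) W)),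
    dirDeriv_add (hG.diffAt hYZ hW.fieldDiffAt) (hG.diffAt hZ.fieldDiffAt hYW),
    hG.leviCivita_metric hYZ hW.fieldDiffAt, hG.leviCivita_metric hZ.fieldDiffAt hYW]
  · ring
  · filter_upwards [hZ.eventually, hW.eventually] with q hZ hW
    exact hG.leviCivita_metric hZ.fieldDiffAt hW.fieldDiffAt _

/-- The operator [X, Y] - (X Y - Y X) annihilates the function g(Z, W); expanding by metric
compatibility gives the skew-symmetry. -/
lemma OrientedFrame.curvatureField_skew (hp : p ∈ F.domain) (hX : FieldC2At X p)
    (hY : FieldC2At Y p) (hZ : FieldC2At Z p) (hW : FieldC2At W p) :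
    ⟪curvatureField X Y Z p, W p⟫ = - ⟪curvatureField X Y W p, Z p⟫ := by
  have hG := isDiffMetric_baseMetric (M := M)
  have h1 := F.dirDeriv_dirDeriv_inner X hp hY hZ hW
  have h2 := F.dirDeriv_dirDeriv_inner Y hp hX hZ hW
  have h3 := dirDeriv_mlieBracket (hZ.inner hW) hX.fieldDiffAt hY.fieldDiffAt
  have h4 := hG.leviCivita_metric hZ.fieldDiffAt hW.fieldDiffAt
    (VectorField.mlieBracket I4 X Y p)
  rw [h1, h2, h4] at h3
  rw [real_inner_comm (Z p) (curvatureField X Y W p)]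
  simp only [curvatureField, inner_sub_left, inner_sub_right]
  simp only [baseMetric] at h3
  linarith

/-- Vanishing torsion reduces the cyclic sum to the Jacobi identity for X, Y, Z. -/
lemma OrientedFrame.curvatureField_bianchi (hp : p ∈ F.domain) (hX : FieldC2At X p)
    (hY : FieldC2At Y p) (hZ : FieldC2At Z p) :
    curvatureField X Y Z p + curvatureField Y Z X p + curvatureField Z X Y p = 0 := by
  have hG := isDiffMetric_baseMetric (M := M)
  -- Torsion-freeness is used twice: to replace ∇_Y Z - ∇_Z Y by [Y, Z] under ∇_X, and then to
  -- exchange X and [Y, Z].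
  have key : ∀ {X Y Z : Π p : M, TangentSpace I4 p}, FieldC2At X p → FieldC2At Y p →
      FieldC2At Z p → leviCivita baseMetric (X p) (fun q => leviCivita baseMetric (Y q) Z) -
        leviCivita baseMetric (X p) (fun q => leviCivita baseMetric (Z q) Y) =
        leviCivita baseMetric (VectorField.mlieBracket I4 Y Z p) X +
          VectorField.mlieBracket I4 X (VectorField.mlieBracket I4 Y Z) p := by
    intro X Y Z hX hY hZ
    have h1 := hG.leviCivita_torsion hX.fieldDiffAt (hY.bracket hZ)
    rw [← h1, add_sub_cancel, sub_eq_iff_eq_add, ← hG.leviCivita_add_right (hY.bracket hZ)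
      (F.fieldDiffAt_leviCivita hp hZ hY)]
    refine hG.leviCivita_congr (F.fieldDiffAt_leviCivita hp hY hZ) ?_ ?_ _
    · exact mdifferentiableAt_add_section (hY.bracket hZ) (F.fieldDiffAt_leviCivita hp hZ hY)
    · filter_upwards [hY.eventually, hZ.eventually] with q hY hZ
      rw [Pi.add_apply, ← hG.leviCivita_torsion hY.fieldDiffAt hZ.fieldDiffAt]
      abel
  have h1 := key hX hY hZ
  have h2 := key hY hZ hX
  have h3 := key hZ hX hY
  have hm : (minSmoothness ℝ 2 : ℕ∞ω) = 2 := by simp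
  have hJ := VectorField.leibniz_identity_mlieBracket_apply (I := I4) (x := p) (U := X) (V := Y)
    (W := Z) (by rw [hm]; exact hX) (by rw [hm]; exact hY) (by rw [hm]; exact hZ)
  have hJ2 : VectorField.mlieBracket I4 X (VectorField.mlieBracket I4 Y Z) p +
      VectorField.mlieBracket I4 Y (VectorField.mlieBracket I4 Z X) p +
      VectorField.mlieBracket I4 Z (VectorField.mlieBracket I4 X Y) p = 0 := by
    rw [hJ, VectorField.mlieBracket_swap_apply (V := Z),
      VectorField.mlieBracket_swap (V := Z) (W := X), ← neg_one_smul ℝ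
        (VectorField.mlieBracket I4 X Z), VectorField.mlieBracket_const_smul_right (hX.bracket hZ)]
    module
  have e : curvatureField X Y Z p + curvatureField Y Z X p + curvatureField Z X Y p = -(
      VectorField.mlieBracket I4 X (VectorField.mlieBracket I4 Y Z) p +
      VectorField.mlieBracket I4 Y (VectorField.mlieBracket I4 Z X) p +
      VectorField.mlieBracket I4 Z (VectorField.mlieBracket I4 X Y) p) := by
    rw [sub_eq_iff_eq_add] at h1 h2 h3
    simp only [curvatureField]
    rw [h1, h2, h3]
    abel
  rw [e, hJ2, neg_zero]

/-- The classical octahedron argument: the four Bianchi identities on X, Y, Z, W are added, and the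
two skew-symmetries cancel everything except the two terms compared. -/
lemma OrientedFrame.curvatureField_pair (hp : p ∈ F.domain) (hX : FieldC2At X p)
    (hY : FieldC2At Y p) (hZ : FieldC2At Z p) (hW : FieldC2At W p) :
    ⟪curvatureField X Y Z p, W p⟫ = ⟪curvatureField Z W X p, Y p⟫ := by
  have b : ∀ {X Y Z W : Π p : M, TangentSpace I4 p}, FieldC2At X p → FieldC2At Y p →
      FieldC2At Z p → ⟪curvatureField X Y Z p, W p⟫ + ⟪curvatureField Y Z X p, W p⟫ +
        ⟪curvatureField Z X Y p, W p⟫ = 0 := by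
    intro X Y Z W hX hY hZ
    rw [← inner_add_left, ← inner_add_left, F.curvatureField_bianchi hp hX hY hZ, inner_zero_left]
  have s12 : ∀ {X Y Z W : Π p : M, TangentSpace I4 p}, FieldC2At Z p →
      ⟪curvatureField X Y Z p, W p⟫ = - ⟪curvatureField Y X Z p, W p⟫ := by
    intro X Y Z W hZ
    rw [curvatureField_swap hZ.fieldDiffAt, inner_neg_left]
  have b1 := b (W := W) hX hY hZ
  have b2 := b (W := X) hY hZ hW
  have b3 := b (W := Y) hZ hW hX
  have b4 := b (W := Z) hW hX hY
  have e1 := F.curvatureField_skew hp hY hZ hX hW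
  have e2 := F.curvatureField_skew hp hZ hX hY hW
  have e3 := F.curvatureField_skew hp hX hY hZ hW
  have e4 := F.curvatureField_skew hp hZ hW hX hY
  have e5 := F.curvatureField_skew hp hW hX hY hZ
  have e6 := F.curvatureField_skew hp hW hY hZ hX
  have e7 := F.curvatureField_skew hp hY hW hX hZ
  have f1 := s12 (X := W) (Y := Y) (W := X) hZ
  have f2 := s12 (X := X) (Y := W) (W := Y) hZ
  have f3 := s12 (X := W) (Y := X) (W := Y) hZ
  have f4 := s12 (X := W) (Y := Y) (W := Z) hX
  have f5 := s12 (X := X) (Y := Z) (W := Y) hW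
  linarith

end symmetries

end BaseGeometry

/-! ### Tensoriality of the curvature and the selfadjoint curvature operator -/

section CurvatureOperator

/-- `curvatureOperator` as a linear map. -/
def curvatureOperatorₗ {V : Type*} [NormedAddCommGroup V] [InnerProductSpace ℝ V]
    [FiniteDimensional ℝ V] (R : V → V → V → V) : ⋀[ℝ]^2 V →ₗ[ℝ] ⋀[ℝ]^2 V where
  toFun := curvatureOperator R
  map_add' a b := by
    simp only [curvatureOperator, map_add, LinearMap.add_apply, add_mul, add_smul,
      Finset.sum_add_distrib]
  map_smul' c a := by
    simp only [curvatureOperator, map_smul, LinearMap.smul_apply, smul_eq_mul, mul_assoc,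
      mul_smul, Finset.smul_sum, RingHom.id_apply]

variable {M : Type*} [TopologicalSpace M] [ChartedSpace E4 M] [IsManifold I4 ∞ M]
  [RiemannianBundle (fun p : M => TangentSpace I4 p)]
  [IsContMDiffRiemannianBundle I4 ∞ E4 (fun p : M => TangentSpace I4 p)]
  {o : ManifoldOrientation M} {p : M}

lemma fieldC2At_extend (v : TangentSpace I4 p) : FieldC2At (FiberBundle.extend E4 v) p :=
  FiberBundle.contMDiffAt_extend I4 E4 v

/-- Tensoriality follows from the symmetries alone. Skew-symmetry moves Z to the slot of the inner
product, where only its value at p matters; pair symmetry then brings X and Y to the last two slots.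
-/
lemma OrientedFrame.curvatureField_congr (F : OrientedFrame o) (hp : p ∈ F.domain)
    {X Y Z W X' Y' Z' : Π p : M, TangentSpace I4 p} (hX : FieldC2At X p) (hY : FieldC2At Y p)
    (hZ : FieldC2At Z p) (hW : FieldC2At W p) (hX' : FieldC2At X' p) (hY' : FieldC2At Y' p)
    (hZ' : FieldC2At Z' p) (eX : X p = X' p) (eY : Y p = Y' p) (eZ : Z p = Z' p) :
    ⟪curvatureField X Y Z p, W p⟫ = ⟪curvatureField X' Y' Z' p, W p⟫ := by
  have h34 : ∀ {X Y Z Z' W : Π p : M, TangentSpace I4 p}, FieldC2At X p → FieldC2At Y p →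
      FieldC2At Z p → FieldC2At Z' p → FieldC2At W p → Z p = Z' p →
        ⟪curvatureField X Y Z p, W p⟫ = ⟪curvatureField X Y Z' p, W p⟫ := by
    intro X Y Z Z' W hX hY hZ hZ' hW e
    rw [F.curvatureField_skew hp hX hY hZ hW, e, F.curvatureField_skew hp hX hY hZ' hW]
  rw [h34 hX hY hZ hZ' hW eZ, F.curvatureField_pair hp hX hY hZ' hW, h34 hZ' hW hX hX' hY eX, eY,
    F.curvatureField_pair hp hX' hY' hZ' hW]

/-- The value of the curvature tensor does not depend on the extensions. -/
lemma OrientedFrame.inner_curvature_eq (F : OrientedFrame o) (hp : p ∈ F.domain)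
    {X Y Z W : Π p : M, TangentSpace I4 p} (hX : FieldC2At X p) (hY : FieldC2At Y p)
    (hZ : FieldC2At Z p) (hW : FieldC2At W p) :
    ⟪curvature (baseMetric (M := M)) p (X p) (Y p) (Z p), W p⟫ =
      ⟪curvatureField X Y Z p, W p⟫ := by
  rw [curvature_eq_curvatureField]
  exact F.curvatureField_congr hp (fieldC2At_extend _) (fieldC2At_extend _) (fieldC2At_extend _)
    hW hX hY hZ (by simp) (by simp) (by simp)

lemma inner_curvature_skew (o : ManifoldOrientation M) (u v w z : TangentSpace I4 p) :
    ⟪curvature (baseMetric (M := M)) p u v w, z⟫ =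
      - ⟪curvature (baseMetric (M := M)) p u v z, w⟫ := by
  have h := (frameAt o p).curvatureField_skew (mem_frameAt_domain o p) (fieldC2At_extend u)
    (fieldC2At_extend v) (fieldC2At_extend w) (fieldC2At_extend z)
  simp only [FiberBundle.extend_apply_self] at h
  simpa only [curvature_eq_curvatureField] using h

lemma inner_curvature_pair (o : ManifoldOrientation M) (u v w z : TangentSpace I4 p) :
    ⟪curvature (baseMetric (M := M)) p u v w, z⟫ =
      ⟪curvature (baseMetric (M := M)) p w z u, v⟫ := by
  have h := (frameAt o p).curvatureField_pair (mem_frameAt_domain o p) (fieldC2At_extend u)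
    (fieldC2At_extend v) (fieldC2At_extend w) (fieldC2At_extend z)
  simp only [FiberBundle.extend_apply_self] at h
  simpa only [curvature_eq_curvatureField] using h

lemma curvature_swap (u v w : TangentSpace I4 p) :
    curvature (baseMetric (M := M)) p u v w = - curvature (baseMetric (M := M)) p v u w := by
  simp only [curvature_eq_curvatureField]
  exact curvatureField_swap (fieldC2At_extend w).fieldDiffAt

/-- The curvature tensor as a multilinear map. -/
def curvatureₗ (o : ManifoldOrientation M) (p : M) : TangentSpace I4 p →ₗ[ℝ] TangentSpace I4 p →ₗ[ℝ] TangentSpace I4 p →ₗ[ℝ]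
    TangentSpace I4 p :=
  -- Skew-symmetry transfers linearity of the inner product to the third argument, pair symmetry
  -- transfers that to the first, and antisymmetry to the second.
  have a3 : ∀ u v w w' : TangentSpace I4 p, curvature (baseMetric (M := M)) p u v (w + w') =
      curvature baseMetric p u v w + curvature baseMetric p u v w' := fun u v w w' =>
    ext_inner_right ℝ fun z => by
      rw [inner_add_left, inner_curvature_skew o, inner_add_right, inner_curvature_skew o u v w,
        inner_curvature_skew o u v w', neg_add]
  have s3 : ∀ (c : ℝ) (u v w : TangentSpace I4 p), curvature (baseMetric (M := M)) p u v (c • w) =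
      c • curvature baseMetric p u v w := fun c u v w =>
    ext_inner_right ℝ fun z => by
      rw [real_inner_smul_left, inner_curvature_skew o, real_inner_smul_right,
        inner_curvature_skew o u v w, mul_neg]
  have a1 : ∀ u u' v w : TangentSpace I4 p, curvature (baseMetric (M := M)) p (u + u') v w =
      curvature baseMetric p u v w + curvature baseMetric p u' v w := fun u u' v w =>
    ext_inner_right ℝ fun z => by
      rw [inner_add_left, inner_curvature_pair o, a3, inner_add_left, inner_curvature_pair o u v w,
        inner_curvature_pair o u' v w]
  have s1 : ∀ (c : ℝ) (u v w : TangentSpace I4 p), curvature (baseMetric (M := M)) p (c • u) v w =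
      c • curvature baseMetric p u v w := fun c u v w =>
    ext_inner_right ℝ fun z => by
      rw [real_inner_smul_left, inner_curvature_pair o, s3, real_inner_smul_left,
        inner_curvature_pair o u v w]
  LinearMap.mk₂ ℝ (fun u v => ⟨⟨curvature (baseMetric (M := M)) p u v, a3 u v⟩,
    fun c => s3 c u v⟩) (fun u u' v => LinearMap.ext (a1 u u' v))
    (fun c u v => LinearMap.ext (s1 c u v))
    (fun u v v' => LinearMap.ext fun w => by
      change curvature _ p u (v + v') w = curvature _ p u v w + curvature _ p u v' w
      rw [curvature_swap, a1, curvature_swap u v, curvature_swap u v', neg_add])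
    (fun c u v => LinearMap.ext fun w => by
      change curvature _ p u (c • v) w = c • curvature _ p u v w
      rw [curvature_swap, s1, curvature_swap u v, smul_neg])

lemma bivInner_baseCurvatureOperator (o : ManifoldOrientation M) (x y z w : TangentSpace I4 p) :
    bivInner (baseCurvatureOperator p (wedge x y)) (wedge z w) =
      ⟪curvature (baseMetric (M := M)) p x y z, w⟫ := by
  have e : ∀ x y z, curvatureₗ o p x y z = curvature (baseMetric (M := M)) p x y z :=
    fun _ _ _ => rfl
  have h := bivInner_curvatureOperator (curvatureₗ o p)
    (fun x y z => by rw [e, e]; exact curvature_swap x y z)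
    (fun x y z w => by rw [e, e]; exact inner_curvature_skew o x y z w) x y z w
  simp only [e] at h
  exact h

/-- The curvature operator is selfadjoint. -/
lemma bivInner_baseCurvatureOperator_comm (o : ManifoldOrientation M)
    (a b : ⋀[ℝ]^2 (TangentSpace I4 p)) :
    bivInner (baseCurvatureOperator p a) b = bivInner (baseCurvatureOperator p b) a := by
  let L := curvatureOperatorₗ (curvature (baseMetric (M := M)) p)
  have h : bivInner ∘ₗ L = (bivInner ∘ₗ L).flip := by
    apply bivector_ext
    intro x y
    apply bivector_ext
    intro z w
    exact ((bivInner_baseCurvatureOperator o x y z w).trans (inner_curvature_pair o x y z w)).trans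
      (bivInner_baseCurvatureOperator o z w x y).symm
  exact LinearMap.congr_fun₂ h a b

end CurvatureOperator

/-! ### Quaternionic algebra of self-dual bivectors -/

section SelfDualAlgebra
variable {V : Type*} [NormedAddCommGroup V] [InnerProductSpace ℝ V]

/-- The bivector `∑ y_i s_i`. -/
def sdComb (e : Fin 4 → V) (y : Fin 3 → ℝ) : ⋀[ℝ]^2 V := ∑ i, y i • sdFrame e i

lemma bivInner_sdComb_sdFrame (e : OrthonormalBasis (Fin 4) ℝ V) (y : Fin 3 → ℝ) (i : Fin 3) :
    bivInner (sdComb e y) (sdFrame e i) = y i := bivInner_sum_sdFrame e y i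

lemma bivInner_sdComb (e : OrthonormalBasis (Fin 4) ℝ V) (x y : Fin 3 → ℝ) :
    bivInner (sdComb e x) (sdComb e y) = ∑ i, x i * y i := by
  conv_lhs => rw [sdComb.eq_def _ y]
  simp only [map_sum, map_smul, bivInner_sdComb_sdFrame, smul_eq_mul]
  exact Finset.sum_congr rfl fun i _ => mul_comm _ _

lemma sdComb_add (e : Fin 4 → V) (x y : Fin 3 → ℝ) :
    sdComb e (x + y) = sdComb e x + sdComb e y := by
  simp [sdComb, add_smul, Finset.sum_add_distrib]

lemma sdComb_injective (e : OrthonormalBasis (Fin 4) ℝ V) {x y : Fin 3 → ℝ}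
    (h : sdComb e x = sdComb e y) : x = y := by
  ext i
  rw [← bivInner_sdComb_sdFrame e x i, h, bivInner_sdComb_sdFrame]

/-- The components `2 g(∑ x_k s_k, e_i ∧ e_j)`. -/
def sdMatrix (x : Fin 3 → ℝ) : Matrix (Fin 4) (Fin 4) ℝ :=
  !![0, x 0, x 1, x 2; -x 0, 0, x 2, -x 1; -x 1, -x 2, 0, x 0; -x 2, x 1, -x 0, 0]

lemma two_mul_bivInner_sdComb (e : OrthonormalBasis (Fin 4) ℝ V) (x : Fin 3 → ℝ) (i j : Fin 4) :
    2 * bivInner (sdComb e x) (wedge (e i) (e j)) = sdMatrix x i j := by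
  simp only [sdComb, Fin.sum_univ_three, map_add, map_smul, LinearMap.add_apply,
    LinearMap.smul_apply, sdFrame, sdPair, bivInner_basis, Matrix.cons_val_zero,
    Matrix.cons_val_one, Matrix.cons_val, smul_eq_mul, sdMatrix]
  fin_cases i <;> fin_cases j <;> simp <;> ring

/-- The matrices of s₁, s₂, s₃ multiply like imaginary quaternions. Row i holds the components of K
e_i, so the composition of K_x after K_y is the product with the matrix of y on the left. -/
lemma sdMatrix_mul (x y : Fin 3 → ℝ) (i j : Fin 4) :
    ∑ l, sdMatrix y i l * sdMatrix x l j =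
      - (∑ k, x k * y k) * (if i = j then 1 else 0) + sdMatrix (crossProduct x y) i j := by
  simp only [Fin.sum_univ_four, Fin.sum_univ_three, sdMatrix, cross_apply]
  fin_cases i <;> fin_cases j <;> simp <;> ring

lemma bivInner_ext {a b : ⋀[ℝ]^2 V} (e : OrthonormalBasis (Fin 4) ℝ V)
    (h : ∀ i j, bivInner a (wedge (e i) (e j)) = bivInner b (wedge (e i) (e j))) : a = b := by
  rw [bivector_eq_sum e a, bivector_eq_sum e b]
  simp only [h]

variable [FiniteDimensional ℝ V]

/-- `K_a` as a linear map. -/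
def bivEndoₗ (a : ⋀[ℝ]^2 V) : V →ₗ[ℝ] V where
  toFun := bivEndo a
  map_add' x y := ext_inner_right ℝ fun z => by
    simp only [inner_add_left, inner_bivEndo, wedge_add_left, map_add]; ring
  map_smul' c x := ext_inner_right ℝ fun z => by
    simp only [real_inner_smul_left, inner_bivEndo, wedge_smul_left, map_smul, RingHom.id_apply,
      smul_eq_mul]; ring

lemma inner_bivEndo_swap (a : ⋀[ℝ]^2 V) (x y : V) : ⟪bivEndo a x, y⟫ = - ⟪x, bivEndo a y⟫ := by
  rw [inner_bivEndo, real_inner_comm, inner_bivEndo, wedge_swap, map_neg]; ring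

/-- This is the quaternion relation K_x K_y = -g(x, y) + K_{x × y}, by bilinearity a check on basis
vectors. Its left side does not mention the frame, which makes it a frame-free description of the
cross product. -/
lemma inner_bivEndo_bivEndo (e : OrthonormalBasis (Fin 4) ℝ V) (x y : Fin 3 → ℝ) (u v : V) :
    ⟪bivEndo (sdComb e x) (bivEndo (sdComb e y) u), v⟫ =
      - bivInner (sdComb e x) (sdComb e y) * ⟪u, v⟫ +
        2 * bivInner (sdComb e (crossProduct x y)) (wedge u v) := by
  have h : (innerₗ V) ∘ₗ (bivEndoₗ (sdComb e x) ∘ₗ bivEndoₗ (sdComb e y)) =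
      - bivInner (sdComb e x) (sdComb e y) • innerₗ V +
        (2 : ℝ) • LinearMap.compr₂ wedgeₗ (bivInner (sdComb e (crossProduct x y))) := by
    refine e.toBasis.ext fun i => e.toBasis.ext fun j => ?_
    have h1 : bivEndo (sdComb e y) (e i) = ∑ l, sdMatrix y i l • e l := by
      rw [← e.sum_repr' (bivEndo _ _)]
      refine Finset.sum_congr rfl fun l _ => ?_
      rw [real_inner_comm, inner_bivEndo, two_mul_bivInner_sdComb]
    have h2 : ⟪bivEndoₗ (sdComb e x) (bivEndo (sdComb e y) (e i)), e j⟫ =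
        ∑ l, sdMatrix y i l * sdMatrix x l j := by
      rw [h1, map_sum, sum_inner]
      refine Finset.sum_congr rfl fun l _ => ?_
      rw [map_smul, real_inner_smul_left]
      congr 1
      exact (inner_bivEndo _ _ _).trans (two_mul_bivInner_sdComb e x l j)
    have h3 := two_mul_bivInner_sdComb e (crossProduct x y) i j
    simp only [OrthonormalBasis.coe_toBasis]
    refine h2.trans ?_
    rw [sdMatrix_mul, ← h3, ← bivInner_sdComb e, ← orthonormal_iff_ite.mp e.orthonormal]
    rfl
  exact LinearMap.congr_fun₂ h u v

variable [Fact (finrank ℝ V = 4)]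

lemma hodgeStar_sdComb (o : Orientation ℝ V (Fin 4)) (e : OrthonormalBasis (Fin 4) ℝ V)
    (he : e.toBasis.orientation = o) (y : Fin 3 → ℝ) :
    hodgeStar o (sdComb e y) = sdComb e y := by
  simp [sdComb, map_sum, hodgeStar_sdFrame o e he]

lemma eq_sdComb (o : Orientation ℝ V (Fin 4)) (e : OrthonormalBasis (Fin 4) ℝ V)
    (he : e.toBasis.orientation = o) {a : ⋀[ℝ]^2 V} (ha : hodgeStar o a = a) :
    a = sdComb e fun i => bivInner a (sdFrame e i) := eq_sum_sdFrame o e he a ha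

/-- The cross product may be computed in any oriented orthonormal frame. -/
lemma cross_sdComb (o : Orientation ℝ V (Fin 4)) (e : OrthonormalBasis (Fin 4) ℝ V)
    (he : e.toBasis.orientation = o) (x y : Fin 3 → ℝ) :
    cross o (sdComb e x) (sdComb e y) = sdComb e (crossProduct x y) := by
  set e' := orientedBasis o with he'
  have ho := orientedBasis_orientation o
  set x' : Fin 3 → ℝ := fun i => bivInner (sdComb e x) (sdFrame e' i) with hx'
  set y' : Fin 3 → ℝ := fun i => bivInner (sdComb e y) (sdFrame e' i) with hy'
  have hx : sdComb e x = sdComb e' x' := eq_sdComb o e' ho (hodgeStar_sdComb o e he x)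
  have hy : sdComb e y = sdComb e' y' := eq_sdComb o e' ho (hodgeStar_sdComb o e he y)
  change sdComb e' (crossProduct x' y') = _
  refine bivInner_ext e fun i j => ?_
  -- The same endomorphism composition is expanded in both frames; comparing the two quaternion
  -- relations identifies the two cross products.
  have h1 := inner_bivEndo_bivEndo e x y (e i) (e j)
  have h2 := inner_bivEndo_bivEndo e' x' y' (e i) (e j)
  rw [← hx, ← hy, h1] at h2
  linarith

/-- The action of a skew endomorphism as a derivation on the self-dual frame. -/
lemma sdPair_deriv (e : OrthonormalBasis (Fin 4) ℝ V) (D : V →ₗ[ℝ] V)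
    (hD : ∀ x y, ⟪D x, y⟫ = - ⟪x, D y⟫) (i : Fin 3) :
    sdPair (fun a => D (e a)) e i + sdPair e (fun a => D (e a)) i =
      sdComb e (crossProduct ![⟪D (e 0), e 1⟫ + ⟪D (e 2), e 3⟫, ⟪D (e 0), e 2⟫ + ⟪D (e 3), e 1⟫,
        ⟪D (e 0), e 3⟫ + ⟪D (e 1), e 2⟫] (Pi.single i 1)) := by
  have hs : ∀ a b, ⟪D (e a), e b⟫ = - ⟪D (e b), e a⟫ := fun a b => by
    rw [hD, real_inner_comm]
  have hz : ∀ a, ⟪D (e a), e a⟫ = 0 := fun a => by have := hs a a; linarith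
  have hn : ∀ a b, ⟪e a, e b⟫ = if a = b then (1 : ℝ) else 0 := orthonormal_iff_ite.mp e.orthonormal
  -- The algebra so(4) acts on self-dual bivectors through its self-dual part, that is by a cross
  -- product in ℝ³; the anti-self-dual part of D cancels in every component.
  refine bivInner_ext e fun k l => ?_
  have h2 := two_mul_bivInner_sdComb e (crossProduct ![⟪D (e 0), e 1⟫ + ⟪D (e 2), e 3⟫,
    ⟪D (e 0), e 2⟫ + ⟪D (e 3), e 1⟫, ⟪D (e 0), e 3⟫ + ⟪D (e 1), e 2⟫] (Pi.single i 1)) k l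
  have h3 : ∀ a b : ℝ, 2 * a = 2 * b → a = b := fun a b h => by linarith
  apply h3
  rw [h2]
  have s10 := hs 1 0
  have s20 := hs 2 0
  have s30 := hs 3 0
  have s21 := hs 2 1
  have s31 := hs 1 3
  have s32 := hs 3 2
  fin_cases i <;> fin_cases k <;> fin_cases l <;>
    simp [sdPair, sdMatrix, bivInner_wedge, hn, hz, s10, s20, s30, s21, s31, s32,
      cross_apply] <;> ring

/-- A skew endomorphism extended to Λ² as a derivation is skew for the induced inner product. No
orthonormality of e is needed. -/
lemma bivInner_sdPair_deriv (e : Fin 4 → V) (D : V →ₗ[ℝ] V)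
    (hD : ∀ x y, ⟪D x, y⟫ = - ⟪x, D y⟫) (i : Fin 3) (u v : V) :
    bivInner (sdPair (fun a => D (e a)) e i + sdPair e (fun a => D (e a)) i) (wedge u v) =
      - bivInner (sdFrame e i) (wedge (D u) v + wedge u (D v)) := by
  fin_cases i <;>
    simp [sdPair, sdFrame, bivInner_wedge, hD] <;> ring

end SelfDualAlgebra

/-! ### Connection form and curvature of the bundle of self-dual bivectors -/

section ConnectionForms
variable {M : Type*} [TopologicalSpace M] [ChartedSpace E4 M] [IsManifold I4 ∞ M]
  [RiemannianBundle (fun p : M => TangentSpace I4 p)]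
  [IsContMDiffRiemannianBundle I4 ∞ E4 (fun p : M => TangentSpace I4 p)]
  {o : ManifoldOrientation M}

/-- The self-dual part of a skew matrix. -/
def sdPart (x : Fin 4 → Fin 4 → ℝ) : Fin 3 → ℝ :=
  ![x 0 1 + x 2 3, x 0 2 + x 3 1, x 0 3 + x 1 2]

/-- For skew x and y the matrix on the left is the commutator xy - yx. The projection of so(4) to
its self-dual summand is a Lie algebra map onto (ℝ³, ×), up to the sign fixed by these conventions.
-/
lemma sdPart_commutator {x y : Fin 4 → Fin 4 → ℝ} (hx : ∀ a b, x a b = - x b a)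
    (hy : ∀ a b, y a b = - y b a) (k : Fin 3) :
    sdPart (fun a b => ∑ c, y a c * x b c - ∑ c, x a c * y b c) k =
      - crossProduct (sdPart x) (sdPart y) k := by
  have zx : ∀ a, x a a = 0 := fun a => by have := hx a a; linarith
  have zy : ∀ a, y a a = 0 := fun a => by have := hy a a; linarith
  fin_cases k <;>
  · simp only [sdPart, cross_apply, Fin.sum_univ_four, Fin.zero_eta, Fin.mk_one,
      Fin.reduceFinMk, Matrix.cons_val_zero, Matrix.cons_val_one, Matrix.cons_val, zx, zy]
    rw [hx 1 0, hx 2 0, hx 3 0, hx 2 1, hx 3 2, hx 1 3, hy 1 0, hy 2 0, hy 3 0, hy 2 1, hy 3 2,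
      hy 1 3]
    ring

namespace OrientedFrame
variable (F : OrientedFrame o) {p : M}

/-- The connection matrix of a frame: the endomorphism `F_a ↦ ∇_v F_a`. -/
def conn (v : TangentSpace I4 p) : TangentSpace I4 p →ₗ[ℝ] TangentSpace I4 p :=
  (F.basis p).toBasis.constr ℝ fun a => leviCivita (baseMetric (M := M)) v (fun q => F.basis q a)

lemma conn_basis (v : TangentSpace I4 p) (a : Fin 4) : F.conn v (F.basis p a) =
    leviCivita (baseMetric (M := M)) v (fun q => F.basis q a) := by
  have h := (F.basis p).toBasis.constr_basis ℝ
    (fun a => leviCivita (baseMetric (M := M)) v (fun q => F.basis q a)) a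
  rwa [OrthonormalBasis.coe_toBasis] at h

/-- The inner products of the frame fields are constant, so metric compatibility makes the
connection matrix skew. -/
lemma conn_basis_skew (hp : p ∈ F.domain) (v : TangentSpace I4 p) (a b : Fin 4) :
    ⟪F.conn v (F.basis p a), F.basis p b⟫ = - ⟪F.conn v (F.basis p b), F.basis p a⟫ := by
  have h := isDiffMetric_baseMetric.leviCivita_metric (F.fieldC2At hp a).fieldDiffAt
    (F.fieldC2At hp b).fieldDiffAt v
  have e : (fun q => baseMetric q (F.basis q a) (F.basis q b)) = fun _ => if a = b then 1 else 0 :=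
    funext fun q => orthonormal_iff_ite.mp (F.basis q).orthonormal a b
  rw [e, dirDeriv_const] at h
  rw [conn_basis, conn_basis, real_inner_comm (F.basis p a)]
  simp only [baseMetric] at h
  linarith

lemma conn_skew (hp : p ∈ F.domain) (v x y : TangentSpace I4 p) :
    ⟪F.conn v x, y⟫ = - ⟪x, F.conn v y⟫ := by
  have h : innerₗ (TangentSpace I4 p) ∘ₗ F.conn v =
      - (innerₗ (TangentSpace I4 p)).compl₂ (F.conn v) := by
    refine (F.basis p).toBasis.ext fun a => (F.basis p).toBasis.ext fun b => ?_
    simp only [OrthonormalBasis.coe_toBasis]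
    refine (F.conn_basis_skew hp v a b).trans ?_
    rw [real_inner_comm]
    rfl
  exact LinearMap.congr_fun₂ h x y

lemma conn_add (hp : p ∈ F.domain) (v w : TangentSpace I4 p) :
    F.conn (v + w) = F.conn v + F.conn w := by
  refine (F.basis p).toBasis.ext fun a => ?_
  simp only [OrthonormalBasis.coe_toBasis, LinearMap.add_apply, conn_basis]
  exact isDiffMetric_baseMetric.leviCivita_add_left (F.fieldC2At hp a).fieldDiffAt v w

lemma conn_smul (hp : p ∈ F.domain) (c : ℝ) (v : TangentSpace I4 p) :
    F.conn (c • v) = c • F.conn v := by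
  refine (F.basis p).toBasis.ext fun a => ?_
  simp only [OrthonormalBasis.coe_toBasis, LinearMap.smul_apply, conn_basis]
  exact isDiffMetric_baseMetric.leviCivita_smul_left (F.fieldC2At hp a).fieldDiffAt c v

/-- The vector field with constant coefficients with respect to a frame. -/
def field (c : Fin 4 → ℝ) (q : M) : TangentSpace I4 q := ∑ a, c a • F.basis q a

lemma fieldC2At_field (hp : p ∈ F.domain) (c : Fin 4 → ℝ) : FieldC2At (F.field c) p :=
  ContMDiffAt.sum_section fun a _ => ContMDiffAt.const_smul_section (F.fieldC2At hp a)

lemma inner_field (c d : Fin 4 → ℝ) (q : M) : ⟪F.field c q, F.field d q⟫ = ∑ a, c a * d a := by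
  simp only [field, sum_inner, inner_sum, real_inner_smul_left, real_inner_smul_right,
    orthonormal_iff_ite.mp (F.basis q).orthonormal]
  simp [mul_comm]

lemma field_inner (v : TangentSpace I4 p) : F.field (fun a => ⟪F.basis p a, v⟫) p = v :=
  (F.basis p).sum_repr' v

/-- With constant coefficients the derivative term of the Leibniz rule vanishes, so ∇_v acts
algebraically through the connection matrix. -/
lemma leviCivita_field (hp : p ∈ F.domain) (c : Fin 4 → ℝ) (v : TangentSpace I4 p) :
    leviCivita (baseMetric (M := M)) v (F.field c) = F.conn v (F.field c p) := by
  have hG := isDiffMetric_baseMetric (M := M)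
  have hd : ∀ a, FieldDiffAt (fun q => F.basis q a) p := fun a => (F.fieldC2At hp a).fieldDiffAt
  have hc : ∀ a, FunDiffAt (E := E4) (fun _ : M => c a) p := fun a => mdifferentiableAt_const
  have hs : ∀ a, FieldDiffAt ((fun _ : M => c a) • (fun q => F.basis q a)) p :=
    fun a => (hc a).smul_section (hd a)
  have e : F.field c = ((fun _ : M => c 0) • (fun q => F.basis q 0)) +
      ((fun _ : M => c 1) • (fun q => F.basis q 1)) +
      ((fun _ : M => c 2) • (fun q => F.basis q 2)) +
      ((fun _ : M => c 3) • (fun q => F.basis q 3)) := by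
    funext q
    simp [field, Fin.sum_univ_four]
  have h1 : FieldDiffAt (((fun _ : M => c 0) • (fun q => F.basis q 0)) +
      ((fun _ : M => c 1) • (fun q => F.basis q 1))) p := mdifferentiableAt_add_section (hs 0) (hs 1)
  have h2 := mdifferentiableAt_add_section h1 (hs 2)
  have hl : ∀ a, leviCivita (baseMetric (M := M)) v ((fun _ : M => c a) • (fun q => F.basis q a)) =
      c a • F.conn v (F.basis p a) := fun a => by
    rw [hG.leviCivita_smul_right (hc a) (hd a), dirDeriv_const, zero_smul, zero_add, conn_basis]
  rw [e, hG.leviCivita_add_right h2 (hs 3), hG.leviCivita_add_right h1 (hs 2),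
    hG.leviCivita_add_right (hs 0) (hs 1), hl, hl, hl, hl]
  simp [map_add, map_smul]

/-- The connection form of the bundle of self-dual bivectors, as a vector in `ℝ³ = so(3)`. -/
def sdConn (v : TangentSpace I4 p) : Fin 3 → ℝ :=
  sdPart fun a b => ⟪F.conn v (F.basis p a), F.basis p b⟫

lemma sdConn_add (hp : p ∈ F.domain) (v w : TangentSpace I4 p) :
    F.sdConn (v + w) = F.sdConn v + F.sdConn w := by
  ext k
  fin_cases k <;> simp [sdConn, sdPart, F.conn_add hp, inner_add_left] <;> ring

lemma sdConn_smul (hp : p ∈ F.domain) (c : ℝ) (v : TangentSpace I4 p) :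
    F.sdConn (c • v) = c • F.sdConn v := by
  ext k
  fin_cases k <;> simp [sdConn, sdPart, F.conn_smul hp, real_inner_smul_left] <;> ring

lemma sdConn_eq_sum (hp : p ∈ F.domain) (v : TangentSpace I4 p) (k : Fin 3) :
    F.sdConn v k = ∑ a, ⟪F.basis p a, v⟫ * F.sdConn (F.basis p a) k := by
  conv_lhs => rw [← (F.basis p).sum_repr' v]
  simp only [Fin.sum_univ_four, F.sdConn_add hp, F.sdConn_smul hp, Pi.add_apply, Pi.smul_apply,
    smul_eq_mul]

lemma nablaSdFrame_eq (v : TangentSpace I4 p) (i : Fin 3) :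
    nablaSdFrame F i v = sdPair (fun a => F.conn v (F.basis p a)) (F.basis p) i +
      sdPair (F.basis p) (fun a => F.conn v (F.basis p a)) i := by
  simp only [nablaSdFrame, conn_basis]

lemma nablaSdFrame_eq_sdComb (hp : p ∈ F.domain) (v : TangentSpace I4 p) (i : Fin 3) :
    nablaSdFrame F i v = sdComb (F.basis p) (crossProduct (F.sdConn v) (Pi.single i 1)) := by
  rw [nablaSdFrame_eq, sdPair_deriv _ _ (F.conn_skew hp v)]
  rfl

lemma funDiffAt_conn (hp : p ∈ F.domain) {X : Π p : M, TangentSpace I4 p} (hX : FieldC2At X p)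
    (a b : Fin 4) : FunDiffAt (E := E4)
      (fun q => ⟪F.conn (X q) (F.basis q a), F.basis q b⟫) p := by
  simp only [conn_basis]
  exact isDiffMetric_baseMetric.diffAt (F.fieldDiffAt_leviCivita hp hX (F.fieldC2At hp a))
    (F.fieldC2At hp b).fieldDiffAt

lemma funDiffAt_sdConn (hp : p ∈ F.domain) {X : Π p : M, TangentSpace I4 p} (hX : FieldC2At X p)
    (k : Fin 3) : FunDiffAt (E := E4) (fun q => F.sdConn (X q) k) p := by
  have h := F.funDiffAt_conn hp hX
  fin_cases k
  · exact (h 0 1).add (h 2 3)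
  · exact (h 0 2).add (h 3 1)
  · exact (h 0 3).add (h 1 2)

/-- Cartan's structure equation, with the sign convention R(X, Y) = ∇_[X,Y] - [∇_X, ∇_Y]. The
quadratic terms come from g(∇_Y F_a, ∇_X F_b), expanded in the orthonormal frame. -/
lemma inner_curvatureField_basis (hp : p ∈ F.domain) {X Y : Π p : M, TangentSpace I4 p}
    (hX : FieldC2At X p) (hY : FieldC2At Y p) (a b : Fin 4) :
    ⟪curvatureField X Y (fun q => F.basis q a) p, F.basis p b⟫ =
      ⟪F.conn (VectorField.mlieBracket I4 X Y p) (F.basis p a), F.basis p b⟫ -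
      dirDeriv (fun q => ⟪F.conn (Y q) (F.basis q a), F.basis q b⟫) p (X p) +
      dirDeriv (fun q => ⟪F.conn (X q) (F.basis q a), F.basis q b⟫) p (Y p) +
      ∑ c, ⟪F.conn (Y p) (F.basis p a), F.basis p c⟫ * ⟪F.conn (X p) (F.basis p b), F.basis p c⟫ -
      ∑ c, ⟪F.conn (X p) (F.basis p a), F.basis p c⟫ *
        ⟪F.conn (Y p) (F.basis p b), F.basis p c⟫ := by
  have hG := isDiffMetric_baseMetric (M := M)
  have hF := F.fieldC2At hp
  have key : ∀ {X Y : Π p : M, TangentSpace I4 p}, FieldC2At X p → FieldC2At Y p →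
      ⟪leviCivita (baseMetric (M := M)) (X p) (fun q => leviCivita (baseMetric (M := M)) (Y q)
        (fun q => F.basis q a)), F.basis p b⟫ =
      dirDeriv (fun q => ⟪F.conn (Y q) (F.basis q a), F.basis q b⟫) p (X p) -
      ∑ c, ⟪F.conn (Y p) (F.basis p a), F.basis p c⟫ *
        ⟪F.conn (X p) (F.basis p b), F.basis p c⟫ := by
    intro X Y hX hY
    have h := hG.leviCivita_metric (F.fieldDiffAt_leviCivita hp hY (hF a)) (hF b).fieldDiffAt (X p)
    have h2 := (F.basis p).sum_inner_mul_inner (F.conn (Y p) (F.basis p a))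
      (F.conn (X p) (F.basis p b))
    simp only [conn_basis] at h2 ⊢
    simp only [baseMetric] at h ⊢ h2
    rw [h, ← h2]
    simp only [real_inner_comm]
    ring
  simp only [curvatureField, inner_sub_left]
  rw [key hX hY, key hY hX, F.conn_basis (VectorField.mlieBracket I4 X Y p)]
  ring

/-- The curvature operator on self-dual bivectors in terms of the connection form. -/
lemma bivInner_baseCurvatureOperator_sdFrame (hp : p ∈ F.domain)
    {X Y : Π p : M, TangentSpace I4 p} (hX : FieldC2At X p) (hY : FieldC2At Y p) (k : Fin 3) :
    bivInner (baseCurvatureOperator p (wedge (X p) (Y p))) (sdFrame (F.basis p) k) =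
      F.sdConn (VectorField.mlieBracket I4 X Y p) k -
      dirDeriv (fun q => F.sdConn (Y q) k) p (X p) + dirDeriv (fun q => F.sdConn (X q) k) p (Y p) -
      crossProduct (F.sdConn (X p)) (F.sdConn (Y p)) k := by
  have hF := F.fieldC2At hp
  have h : ∀ a b, bivInner (baseCurvatureOperator p (wedge (X p) (Y p)))
      (wedge (F.basis p a) (F.basis p b)) =
        ⟪curvatureField X Y (fun q => F.basis q a) p, F.basis p b⟫ := fun a b => by
    rw [bivInner_baseCurvatureOperator o]
    exact F.inner_curvature_eq (X := X) (Y := Y) (Z := fun q => F.basis q a)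
      (W := fun q => F.basis q b) hp hX hY (hF a) (hF b)
  have hadd : ∀ {Z : Π p : M, TangentSpace I4 p}, FieldC2At Z p → ∀ a b c d v,
      dirDeriv (fun q => ⟪F.conn (Z q) (F.basis q a), F.basis q b⟫ +
        ⟪F.conn (Z q) (F.basis q c), F.basis q d⟫) p v =
      dirDeriv (fun q => ⟪F.conn (Z q) (F.basis q a), F.basis q b⟫) p v +
      dirDeriv (fun q => ⟪F.conn (Z q) (F.basis q c), F.basis q d⟫) p v :=
    fun hZ a b c d v => dirDeriv_add (F.funDiffAt_conn hp hZ a b) (F.funDiffAt_conn hp hZ c d) v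
  -- The quadratic terms of the structure equation form a commutator, whose self-dual part is -α(X)
  -- × α(Y).
  have hc := sdPart_commutator (F.conn_basis_skew hp (X p)) (F.conn_basis_skew hp (Y p)) k
  have main : ∀ a b c d, bivInner (baseCurvatureOperator p (wedge (X p) (Y p)))
      (wedge (F.basis p a) (F.basis p b) + wedge (F.basis p c) (F.basis p d)) =
      (⟪F.conn (VectorField.mlieBracket I4 X Y p) (F.basis p a), F.basis p b⟫ +
        ⟪F.conn (VectorField.mlieBracket I4 X Y p) (F.basis p c), F.basis p d⟫) -
      dirDeriv (fun q => ⟪F.conn (Y q) (F.basis q a), F.basis q b⟫ +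
        ⟪F.conn (Y q) (F.basis q c), F.basis q d⟫) p (X p) +
      dirDeriv (fun q => ⟪F.conn (X q) (F.basis q a), F.basis q b⟫ +
        ⟪F.conn (X q) (F.basis q c), F.basis q d⟫) p (Y p) +
      ((∑ e, ⟪F.conn (Y p) (F.basis p a), F.basis p e⟫ *
          ⟪F.conn (X p) (F.basis p b), F.basis p e⟫ -
        ∑ e, ⟪F.conn (X p) (F.basis p a), F.basis p e⟫ *
          ⟪F.conn (Y p) (F.basis p b), F.basis p e⟫) +
      (∑ e, ⟪F.conn (Y p) (F.basis p c), F.basis p e⟫ *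
          ⟪F.conn (X p) (F.basis p d), F.basis p e⟫ -
        ∑ e, ⟪F.conn (X p) (F.basis p c), F.basis p e⟫ *
          ⟪F.conn (Y p) (F.basis p d), F.basis p e⟫)) := by
    intro a b c d
    rw [map_add, h, h, F.inner_curvatureField_basis hp hX hY,
      F.inner_curvatureField_basis hp hX hY, hadd hX, hadd hY]
    ring
  rw [sub_eq_add_neg _ (crossProduct (F.sdConn (X p)) (F.sdConn (Y p)) k)]
  refine Eq.trans ?_ (congrArg _ hc)
  fin_cases k
  · exact main 0 1 2 3
  · exact main 0 2 3 1
  · exact main 0 3 1 2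

end OrientedFrame

end ConnectionForms

/-! ### Smoothness of the projection and of the fibre coordinates -/

section TwistorManifold
variable {M : Type*} [TopologicalSpace M] [ChartedSpace E4 M] [IsManifold I4 ∞ M]
  [RiemannianBundle (fun p : M => TangentSpace I4 p)]
  [IsContMDiffRiemannianBundle I4 ∞ E4 (fun p : M => TangentSpace I4 p)]
  {o : ManifoldOrientation M}

namespace OrientedFrame
variable (F : OrientedFrame o)

lemma chart_mem_twistorCore {φ : OpenPartialHomeomorph M E4} (hφ : φ ∈ atlas E4 M)
    (v : Metric.sphere (0 : E3) 1) : F.chart φ v ∈ (twistorCore o).atlas := ⟨F, φ, v, hφ, rfl⟩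

/-- The chart of the twistor space defined by a frame, as an open partial homeomorphism. -/
def openChart {φ : OpenPartialHomeomorph M E4} (hφ : φ ∈ atlas E4 M)
    (v : Metric.sphere (0 : E3) 1) : OpenPartialHomeomorph (TwistorSpace o) (E4 × E2) :=
  (twistorCore o).openPartialHomeomorph (F.chart φ v) (F.chart_mem_twistorCore hφ v)

lemma openChart_mem_atlas {φ : OpenPartialHomeomorph M E4} (hφ : φ ∈ atlas E4 M)
    (v : Metric.sphere (0 : E3) 1) :
    F.openChart hφ v ∈ atlas (E4 × E2) (TwistorSpace o) :=
  Set.mem_iUnion.mpr ⟨F.chart φ v, Set.mem_iUnion.mpr ⟨F.chart_mem_twistorCore hφ v, rfl⟩⟩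

/-- The chart centred at a point over the domain of the frame. -/
def chartAround (σ : TwistorSpace o) : OpenPartialHomeomorph (TwistorSpace o) (E4 × E2) :=
  F.openChart (chart_mem_atlas E4 σ.base) (-(F.triv σ).2)

variable {F} in
lemma mem_chartAround_source {σ : TwistorSpace o} (h : σ.base ∈ F.domain) :
    σ ∈ (F.chartAround σ).source :=
  (F.chart_source _ _ σ).mpr ⟨⟨mem_chart_source E4 σ.base, h⟩, ne_neg_of_mem_unit_sphere ℝ _⟩

lemma coord_eq_triv (i : Fin 3) (σ : TwistorSpace o) :
    TwistorSpace.coord F i σ = ((F.triv σ).2 : E3) i := rfl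

/-- In a frame chart the fibre coordinates are the components of the inverse stereographic
projection and do not involve the base point; their smoothness is immediate from this. -/
lemma coord_chartAround_symm (σ : TwistorSpace o) (i : Fin 3) (z : E4 × E2) :
    TwistorSpace.coord F i ((F.chartAround σ).symm z) =
      ((stereographic' 2 (-(F.triv σ).2)).symm z.2 : E3) i := by
  rw [coord_eq_triv]
  change ((F.triv (F.triv.symm _)).2 : E3) i = _
  rw [Equiv.apply_symm_apply]
  rfl

variable {F}

/-- A frame chart belongs to the atlas even when it is not the preferred chart at σ, so smoothness
may be tested in it. -/
lemma contMDiffAt_of_chartAround {N E H : Type*} [NormedAddCommGroup E] [NormedSpace ℝ E]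
    [TopologicalSpace H] {I : ModelWithCorners ℝ E H} [TopologicalSpace N] [ChartedSpace H N]
    {g : TwistorSpace o → N} {σ : TwistorSpace o} (h : σ.base ∈ F.domain)
    (hg : ContMDiffOn I6 I ∞ (g ∘ (F.chartAround σ).symm) (F.chartAround σ).target) :
    ContMDiffAt I6 I ∞ g σ := by
  have hs := (F.chartAround σ).open_source
  have hm := mem_chartAround_source h
  have hc : ContMDiffOn I6 I6 ∞ (F.chartAround σ) (F.chartAround σ).source :=
    contMDiffOn_of_mem_maximalAtlas (IsManifold.subset_maximalAtlas (F.openChart_mem_atlas _ _))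
  have h1 : ContMDiffOn I6 I ∞ ((g ∘ (F.chartAround σ).symm) ∘ F.chartAround σ)
      (F.chartAround σ).source := hg.comp hc (F.chartAround σ).mapsTo
  refine (h1.congr fun x hx => ?_).contMDiffAt (hs.mem_nhds hm)
  simp [(F.chartAround σ).left_inv hx]

lemma contMDiffAt_base {σ : TwistorSpace o} (h : σ.base ∈ F.domain) :
    ContMDiffAt I6 I4 ∞ (TwistorSpace.base (o := o)) σ := by
  refine contMDiffAt_of_chartAround h ?_
  have h1 : ContMDiffOn I4 I4 ∞ (chartAt E4 σ.base).symm (chartAt E4 σ.base).target :=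
    contMDiffOn_chart_symm
  have h2 : ContMDiff I6 I4 ∞ (Prod.fst : E4 × E2 → E4) := contDiff_fst.contMDiff
  exact h1.comp h2.contMDiffOn fun z hz => ((F.chart_target _ _ z).mp hz).1

lemma contMDiffAt_coord {σ : TwistorSpace o} (h : σ.base ∈ F.domain) (i : Fin 3) :
    ContMDiffAt I6 𝓘(ℝ, ℝ) ∞ (TwistorSpace.coord F i) σ := by
  refine contMDiffAt_of_chartAround h ?_
  have : TwistorSpace.coord F i ∘ (F.chartAround σ).symm = fun z =>
      ((stereographic' 2 (-(F.triv σ).2)).symm z.2 : E3) i :=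
    funext fun z => F.coord_chartAround_symm σ i z
  rw [this]
  exact ((contDiff_euclidean.mp (contDiff_stereographic'_symm _) i).comp
    contDiff_snd).contMDiff.contMDiffOn

lemma sum_coord_sq (F : OrientedFrame o) (σ : TwistorSpace o) :
    ∑ i, TwistorSpace.coord F i σ ^ 2 = 1 := by
  have h := (F.triv σ).2.2
  rw [mem_sphere_zero_iff_norm, EuclideanSpace.norm_eq, Real.sqrt_eq_one] at h
  simpa only [coord_eq_triv, Real.norm_eq_abs, sq_abs] using h

end OrientedFrame

namespace TwistorSpace

lemma contMDiff_base : ContMDiff I6 I4 ∞ (TwistorSpace.base (o := o)) :=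
  fun σ => OrientedFrame.contMDiffAt_base (mem_frameAt_domain o σ.base)

lemma mdifferentiable_base : MDifferentiable I6 I4 (TwistorSpace.base (o := o)) :=
  contMDiff_base.mdifferentiable (by simp)

lemma projDeriv_add (σ : TwistorSpace o) (A B : TangentSpace I6 σ) :
    σ.projDeriv (A + B) = σ.projDeriv A + σ.projDeriv B := map_add _ _ _

lemma projDeriv_smul (σ : TwistorSpace o) (c : ℝ) (A : TangentSpace I6 σ) :
    σ.projDeriv (c • A) = c • σ.projDeriv A := map_smul _ _ _

lemma dirDeriv_comp_base {g : M → ℝ} {σ : TwistorSpace o} (hg : FunDiffAt (E := E4) g σ.base)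
    (A : TangentSpace I6 σ) :
    dirDeriv (fun τ : TwistorSpace o => g τ.base) σ A = dirDeriv g σ.base (σ.projDeriv A) := by
  have h : mfderiv I6 𝓘(ℝ, ℝ) (g ∘ TwistorSpace.base (o := o)) σ =
      (mfderiv I4 𝓘(ℝ, ℝ) g σ.base).comp (mfderiv I6 I4 (TwistorSpace.base (o := o)) σ) :=
    mfderiv_comp σ hg (mdifferentiable_base σ)
  exact congrArg (fun L => L A) h

/-- The differentials of the fibre coordinates. -/
def dCoord (F : OrientedFrame o) (σ : TwistorSpace o) (A : TangentSpace I6 σ) : Fin 3 → ℝ :=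
  fun i => dirDeriv (coord F i) σ A

/-- The fibre coordinates as a vector. -/
def coords (F : OrientedFrame o) (σ : TwistorSpace o) : Fin 3 → ℝ := fun i => coord F i σ

variable {F : OrientedFrame o} {σ : TwistorSpace o}

/-- The relation |y|² = 1 holds identically and is differentiated along A. -/
lemma coords_dot_dCoord (h : σ.base ∈ F.domain) (A : TangentSpace I6 σ) :
    ∑ i, coord F i σ * dCoord F σ A i = 0 := by
  have hd : ∀ i, FunDiffAt (E := E4 × E2) (coord F i) σ := fun i =>
    (OrientedFrame.contMDiffAt_coord h i).mdifferentiableAt (by simp)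
  have h1 := (dirDeriv_sum Finset.univ (f := fun i τ => coord F i τ * coord F i τ) (x := σ)
    (fun i _ => (hd i).mul (hd i)) A).2
  have h2 : (fun τ => ∑ i, coord F i τ * coord F i τ) = fun _ => (1 : ℝ) :=
    funext fun τ => by simpa [pow_two] using F.sum_coord_sq τ
  rw [h2, dirDeriv_const] at h1
  simp only [fun i => dirDeriv_mul (hd i) (hd i) A] at h1
  simp only [dCoord]
  simp only [Finset.sum_add_distrib] at h1
  linarith

end TwistorSpace

end TwistorManifold

section Chart
variable {E : Type*} [NormedAddCommGroup E] [NormedSpace ℝ E]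
  {N : Type*} [TopologicalSpace N] [ChartedSpace E N] [IsManifold 𝓘(ℝ, E) 1 N]

/-- Near x the trivialisation of the tangent bundle at x is the differential of the chart at x. -/
lemma fieldDiffAt_iff {X : Π x : N, TangentSpace 𝓘(ℝ, E) x} {x : N} : FieldDiffAt X x ↔
    MDifferentiableAt 𝓘(ℝ, E) 𝓘(ℝ, E)
      (fun y => (mfderiv 𝓘(ℝ, E) 𝓘(ℝ, E) (extChartAt 𝓘(ℝ, E) x) y (X y) : E)) x := by
  refine (mdifferentiableAt_section 𝓘(ℝ, E) (F := E) X).trans ?_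
  refine Filter.EventuallyEq.mdifferentiableAt_iff ?_
  filter_upwards [(chartAt E x).open_source.mem_nhds (mem_chart_source E x)] with y hy
  rw [← TangentBundle.continuousLinearMapAt_trivializationAt hy]
  exact (Trivialization.continuousLinearMapAt_apply_of_mem (R := ℝ) _
    (by simpa using hy) (X y)).symm

end Chart

/-! ### Leibniz rules for inner products of bivectors -/

section ScalarDeriv
variable {E : Type*} [NormedAddCommGroup E] [NormedSpace ℝ E]
  {N : Type*} [TopologicalSpace N] [ChartedSpace E N] {a b c d : N → ℝ} {x : N}

lemma dirDeriv_half_det (ha : FunDiffAt (E := E) a x) (hb : FunDiffAt (E := E) b x)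
    (hc : FunDiffAt (E := E) c x) (hd : FunDiffAt (E := E) d x) (v : TangentSpace 𝓘(ℝ, E) x) :
    FunDiffAt (E := E) (fun y => 1 / 2 * (a y * b y - c y * d y)) x ∧
    dirDeriv (fun y => 1 / 2 * (a y * b y - c y * d y)) x v =
      1 / 2 * ((a x * dirDeriv b x v + b x * dirDeriv a x v) -
        (c x * dirDeriv d x v + d x * dirDeriv c x v)) := by
  have h1 : FunDiffAt (E := E) (fun y => a y * b y) x := ha.mul hb
  have h2 : FunDiffAt (E := E) (fun y => c y * d y) x := hc.mul hd
  have h3 : FunDiffAt (E := E) (fun y => a y * b y - c y * d y) x := h1.sub h2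
  refine ⟨mdifferentiableAt_const.mul h3, ?_⟩
  rw [dirDeriv_const_mul _ h3, dirDeriv_sub h1 h2, dirDeriv_mul ha hb, dirDeriv_mul hc hd]

lemma dirDeriv_add_four {v : TangentSpace 𝓘(ℝ, E) x} {a' b' c' d' : ℝ}
    (ha : FunDiffAt (E := E) a x ∧ dirDeriv a x v = a')
    (hb : FunDiffAt (E := E) b x ∧ dirDeriv b x v = b')
    (hc : FunDiffAt (E := E) c x ∧ dirDeriv c x v = c')
    (hd : FunDiffAt (E := E) d x ∧ dirDeriv d x v = d') {g : N → ℝ}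
    (hg : ∀ y, g y = a y + b y + (c y + d y)) :
    FunDiffAt (E := E) g x ∧ dirDeriv g x v = a' + b' + (c' + d') := by
  obtain rfl := funext hg
  have h1 : FunDiffAt (E := E) (fun y => a y + b y) x := ha.1.add hb.1
  have h2 : FunDiffAt (E := E) (fun y => c y + d y) x := hc.1.add hd.1
  refine ⟨h1.add h2, ?_⟩
  rw [dirDeriv_add h1 h2, dirDeriv_add ha.1 hb.1, dirDeriv_add hc.1 hd.1, ha.2, hb.2, hc.2, hd.2]

end ScalarDeriv

section BivectorDeriv
variable {M : Type*} [TopologicalSpace M] [ChartedSpace E4 M] [IsManifold I4 ∞ M]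
  [RiemannianBundle (fun p : M => TangentSpace I4 p)]
  [IsContMDiffRiemannianBundle I4 ∞ E4 (fun p : M => TangentSpace I4 p)]
  {o : ManifoldOrientation M} {p : M}

lemma bivInner_wedge_deriv {V : Type*} [NormedAddCommGroup V] [InnerProductSpace ℝ V]
    (a b c d a' b' c' d' : V) :
    1 / 2 * ((⟪a, c⟫ * (⟪b', d⟫ + ⟪b, d'⟫) + ⟪b, d⟫ * (⟪a', c⟫ + ⟪a, c'⟫)) -
      (⟪a, d⟫ * (⟪b', c⟫ + ⟪b, c'⟫) + ⟪b, c⟫ * (⟪a', d⟫ + ⟪a, d'⟫))) =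
    bivInner (wedge a' b + wedge a b') (wedge c d) +
      bivInner (wedge a b) (wedge c' d + wedge c d') := by
  simp only [map_add, LinearMap.add_apply, bivInner_wedge]
  ring

lemma dirDeriv_bivInner_wedge {A B C D : Π p : M, TangentSpace I4 p} (hA : FieldDiffAt A p)
    (hB : FieldDiffAt B p) (hC : FieldDiffAt C p) (hD : FieldDiffAt D p)
    (v : TangentSpace I4 p) {g : M → ℝ}
    (hg : ∀ q, g q = bivInner (wedge (A q) (B q)) (wedge (C q) (D q))) :
    FunDiffAt (E := E4) g p ∧ dirDeriv g p v =
      bivInner (wedge (leviCivita (baseMetric (M := M)) v A) (B p) +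
        wedge (A p) (leviCivita (baseMetric (M := M)) v B)) (wedge (C p) (D p)) +
      bivInner (wedge (A p) (B p)) (wedge (leviCivita (baseMetric (M := M)) v C) (D p) +
        wedge (C p) (leviCivita (baseMetric (M := M)) v D)) := by
  have hG := isDiffMetric_baseMetric (M := M)
  have hAC : FunDiffAt (E := E4) (fun q => baseMetric q (A q) (C q)) p := hG.diffAt hA hC
  have hBD : FunDiffAt (E := E4) (fun q => baseMetric q (B q) (D q)) p := hG.diffAt hB hD
  have hAD : FunDiffAt (E := E4) (fun q => baseMetric q (A q) (D q)) p := hG.diffAt hA hD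
  have hBC : FunDiffAt (E := E4) (fun q => baseMetric q (B q) (C q)) p := hG.diffAt hB hC
  have h := dirDeriv_half_det (E := E4) hAC hBD hAD hBC v
  rw [hG.leviCivita_metric hA hC, hG.leviCivita_metric hB hD, hG.leviCivita_metric hA hD,
    hG.leviCivita_metric hB hC] at h
  obtain rfl : g = fun q => 1 / 2 * (baseMetric q (A q) (C q) * baseMetric q (B q) (D q) -
        baseMetric q (A q) (D q) * baseMetric q (B q) (C q)) :=
    funext fun q => (hg q).trans (bivInner_wedge _ _ _ _)
  exact ⟨h.1, h.2.trans (bivInner_wedge_deriv _ _ _ _ _ _ _ _)⟩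

lemma bivInner_congr {V : Type*} [NormedAddCommGroup V] [InnerProductSpace ℝ V]
    {a b c d : ⋀[ℝ]^2 V} (h : a = b) (h' : c = d) : bivInner a c = bivInner b d := by rw [h, h']

lemma bivInner_add_add {V : Type*} [NormedAddCommGroup V] [InnerProductSpace ℝ V]
    (a b c d : ⋀[ℝ]^2 V) : bivInner (a + b) (c + d) =
      bivInner a c + bivInner b c + (bivInner a d + bivInner b d) := by
  simp only [map_add, LinearMap.add_apply]

lemma bivInner_sum_deriv {V : Type*} [NormedAddCommGroup V] [InnerProductSpace ℝ V]
    (a a₁ a₂ b b₁ b₂ c c₁ c₂ d d₁ d₂ : ⋀[ℝ]^2 V) :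
    bivInner (a₁ + a₂) c + bivInner a (c₁ + c₂) + (bivInner (b₁ + b₂) c + bivInner b (c₁ + c₂)) +
      (bivInner (a₁ + a₂) d + bivInner a (d₁ + d₂) +
        (bivInner (b₁ + b₂) d + bivInner b (d₁ + d₂))) =
    bivInner (a₁ + b₁ + (a₂ + b₂)) (c + d) + bivInner (a + b) (c₁ + d₁ + (c₂ + d₂)) := by
  simp only [map_add, LinearMap.add_apply]
  ring

/-- Each of the three expressions is a sum of two wedges. Recording the indices existentially lets
s₁, s₂, s₃ be treated by one argument. -/
lemma exists_sdPair_eq (i : Fin 3) : ∃ a b c d : Fin 4, ∀ (p : M)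
    (e e' : Fin 4 → TangentSpace I4 p), sdPair e e' i = wedge (e a) (e' b) + wedge (e c) (e' d) := by
  fin_cases i
  · exact ⟨0, 1, 2, 3, fun _ _ _ => rfl⟩
  · exact ⟨0, 2, 3, 1, fun _ _ _ => rfl⟩
  · exact ⟨0, 3, 1, 2, fun _ _ _ => rfl⟩

/-- The connection induced on Λ² is metric. With two different frames this gives the derivative of
the transition functions between their fibre coordinates. -/
lemma dirDeriv_bivInner_sdFrame (F F' : OrientedFrame o) (hp : p ∈ F.domain) (hp' : p ∈ F'.domain)
    (i j : Fin 3) (v : TangentSpace I4 p) {g : M → ℝ}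
    (hg : ∀ q, g q = bivInner (sdFrame (F.basis q) i) (sdFrame (F'.basis q) j)) :
    FunDiffAt (E := E4) g p ∧ dirDeriv g p v =
      bivInner (nablaSdFrame F i v) (sdFrame (F'.basis p) j) +
        bivInner (sdFrame (F.basis p) i) (nablaSdFrame F' j v) := by
  obtain ⟨a, b, c, d, h⟩ := exists_sdPair_eq (M := M) i
  obtain ⟨a', b', c', d', h'⟩ := exists_sdPair_eq (M := M) j
  have hF := fun a => (F.fieldC2At hp a).fieldDiffAt
  have hF' := fun a => (F'.fieldC2At hp' a).fieldDiffAt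
  have k1 := dirDeriv_bivInner_wedge (hF a) (hF b) (hF' a') (hF' b') v fun _ => rfl
  have k2 := dirDeriv_bivInner_wedge (hF a) (hF b) (hF' c') (hF' d') v fun _ => rfl
  have k3 := dirDeriv_bivInner_wedge (hF c) (hF d) (hF' a') (hF' b') v fun _ => rfl
  have k4 := dirDeriv_bivInner_wedge (hF c) (hF d) (hF' c') (hF' d') v fun _ => rfl
  have e : ∀ v, nablaSdFrame F i v = _ := fun v => congrArg₂ (· + ·) (h p _ _) (h p _ _)
  have e' : ∀ v, nablaSdFrame F' j v = _ := fun v => congrArg₂ (· + ·) (h' p _ _) (h' p _ _)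
  have k := dirDeriv_add_four (E := E4) k1 k3 k2 k4 (g := g) fun q =>
    (hg q).trans ((bivInner_congr (h q _ _) (h' q _ _)).trans (bivInner_add_add _ _ _ _))
  refine ⟨k.1, k.2.trans ((bivInner_sum_deriv _ _ _ _ _ _ _ _ _ _ _ _).trans ?_)⟩
  exact congrArg₂ (· + ·) (bivInner_congr (e v).symm (h' p _ _).symm)
    (bivInner_congr (h p _ _).symm (e' v).symm)

/-- The linear algebra behind frame independence, with N_i in the role of ∇s_i. Hypothesis h₁ is the
derivative of y'_j = ∑ y_i B(s_i, s'_j), and h₂ says that the connection is skew in the orthonormal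
frame s'. -/
lemma bilin_frame_change {W : Type*} [AddCommGroup W] [Module ℝ W] (B : W →ₗ[ℝ] W →ₗ[ℝ] ℝ)
    {s s' N N' : Fin 3 → W} {y y' d d' : Fin 3 → ℝ} {j : Fin 3}
    (hy : ∑ i, y' i • s' i = ∑ i, y i • s i)
    (h₁ : d' j = ∑ i, (y i * (B (N i) (s' j) + B (s i) (N' j)) + B (s i) (s' j) * d i))
    (h₂ : ∀ i, B (N' i) (s' j) = - B (s' i) (N' j))
    (h₃ : ∀ i, B (s' i) (s' j) = if i = j then 1 else 0) :
    B (∑ i, (d i • s i + y i • N i)) (s' j) = B (∑ i, (d' i • s' i + y' i • N' i)) (s' j) := by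
  have h₄ := congrArg (fun a => B a (N' j)) hy
  simp only [map_sum, map_add, LinearMap.sum_apply, LinearMap.add_apply, map_smul,
    LinearMap.smul_apply, smul_eq_mul, h₂, h₃, Finset.sum_add_distrib, mul_neg,
    Finset.sum_neg_distrib, mul_ite, mul_one, mul_zero, Finset.sum_ite_eq', Finset.mem_univ,
    if_true, mul_add] at h₄ h₁ ⊢
  rw [h₄, h₁]
  simp only [mul_comm (d _)]
  ring

end BivectorDeriv

/-! ### The vertical part in fibre coordinates and its independence of the frame -/

section TwistorTangent
variable {M : Type*} [TopologicalSpace M] [ChartedSpace E4 M] [IsManifold I4 ∞ M]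
  [RiemannianBundle (fun p : M => TangentSpace I4 p)]
  [IsContMDiffRiemannianBundle I4 ∞ E4 (fun p : M => TangentSpace I4 p)]
  {o : ManifoldOrientation M}

namespace TwistorSpace
variable {F : OrientedFrame o} {σ : TwistorSpace o}

lemma funDiffAt_coord (h : σ.base ∈ F.domain) (i : Fin 3) :
    FunDiffAt (E := E4 × E2) (coord F i) σ :=
  (OrientedFrame.contMDiffAt_coord h i).mdifferentiableAt (by simp)

lemma funDiffAt_comp_base {g : M → ℝ} (hg : FunDiffAt (E := E4) g σ.base) :
    FunDiffAt (E := E4 × E2) (fun τ : TwistorSpace o => g τ.base) σ :=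
  MDifferentiableAt.comp σ hg (mdifferentiable_base σ)

lemma fiber_vec_eq (F : OrientedFrame o) (σ : TwistorSpace o) :
    σ.fiber.vec = sdComb (F.basis σ.base) (coords F σ) :=
  eq_sdComb _ _ (F.orientation_eq _) σ.fiber.selfDual

/-- The vertical part of a tangent vector in the fibre coordinates of a frame. -/
def vertCoord (F : OrientedFrame o) (σ : TwistorSpace o) (A : TangentSpace I6 σ) : Fin 3 → ℝ :=
  dCoord F σ A + crossProduct (F.sdConn (σ.projDeriv A)) (coords F σ)

lemma sdComb_cross_coords (e : Fin 4 → TangentSpace I4 σ.base) (α y : Fin 3 → ℝ) :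
    sdComb e (crossProduct α y) = ∑ i, y i • sdComb e (crossProduct α (Pi.single i 1)) := by
  simp only [sdComb, Fin.sum_univ_three, cross_apply]
  simp
  module

lemma sdComb_vertCoord (h : σ.base ∈ F.domain) (A : TangentSpace I6 σ) :
    sdComb (F.basis σ.base) (vertCoord F σ A) = ∑ i, (dCoord F σ A i • sdFrame (F.basis σ.base) i +
      coord F i σ • nablaSdFrame F i (σ.projDeriv A)) := by
  simp only [F.nablaSdFrame_eq_sdComb h]
  rw [vertCoord, sdComb_add, sdComb_cross_coords, Finset.sum_add_distrib]
  rfl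

lemma coord_eq_sum (F F' : OrientedFrame o) (j : Fin 3) (τ : TwistorSpace o) :
    coord F' j τ = ∑ i, coord F i τ *
      bivInner (sdFrame (F.basis τ.base) i) (sdFrame (F'.basis τ.base) j) := by
  conv_lhs => rw [coord, fiber_vec_eq F τ, sdComb]
  simp only [map_sum, LinearMap.sum_apply, map_smul, LinearMap.smul_apply, smul_eq_mul, coords]

lemma dirDeriv_sum_coord_mul (h : σ.base ∈ F.domain) {m : Fin 3 → M → ℝ}
    (hm : ∀ i, FunDiffAt (E := E4) (m i) σ.base) (A : TangentSpace I6 σ)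
    {g : TwistorSpace o → ℝ} (hg : ∀ τ, g τ = ∑ i, coord F i τ * m i τ.base) :
    dirDeriv g σ A =
      ∑ i, (coord F i σ * dirDeriv (m i) σ.base (σ.projDeriv A) + m i σ.base * dCoord F σ A i) := by
  obtain rfl := funext hg
  refine ((dirDeriv_sum _ (fun i _ => (funDiffAt_coord h i).mul
    (funDiffAt_comp_base (hm i))) A).2).trans ?_
  refine Finset.sum_congr rfl fun i _ => ?_
  refine (dirDeriv_mul (funDiffAt_coord h i) (funDiffAt_comp_base (hm i)) A).trans ?_
  rw [dirDeriv_comp_base (hm i)]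
  rfl

/-- Differentiating y'_j = ∑ y_i g(s_i, s'_j) shows that dy and the connection terms change
together. `vertPart` refers to a frame chosen separately at each base point; this lemma allows one
fixed frame in a whole neighbourhood, as differentiation requires. -/
lemma sdComb_vertCoord_congr {F' : OrientedFrame o} (h : σ.base ∈ F.domain)
    (h' : σ.base ∈ F'.domain) (A : TangentSpace I6 σ) :
    sdComb (F.basis σ.base) (vertCoord F σ A) = sdComb (F'.basis σ.base) (vertCoord F' σ A) := by
  have hs : hodgeStar (o.orient σ.base) (sdComb (F.basis σ.base) (vertCoord F σ A)) = _ :=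
    hodgeStar_sdComb _ _ (F.orientation_eq _) _
  rw [eq_sdComb _ _ (F'.orientation_eq _) hs]
  congr 1
  ext j
  have hd := fun i => dirDeriv_bivInner_sdFrame F F' h h' i j (σ.projDeriv A) fun _ => rfl
  -- Applied to one frame twice, where the inner products are the constants δ_ij, the rule expresses
  -- the skewness of the connection in that frame.
  have hd' := fun i => dirDeriv_bivInner_sdFrame F' F' h' h' i j (σ.projDeriv A)
    (g := fun _ => if i = j then (1 : ℝ) else 0) fun q => (bivInner_sdFrame _ _ _).symm
  have e1 : dCoord F' σ A j = _ :=
    dirDeriv_sum_coord_mul h (fun i => (hd i).1) A (coord_eq_sum F F' j)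
  have e2 : ∀ i, bivInner (nablaSdFrame F' i (σ.projDeriv A)) (sdFrame (F'.basis σ.base) j) =
      - bivInner (sdFrame (F'.basis σ.base) i) (nablaSdFrame F' j (σ.projDeriv A)) := fun i => by
    have := (hd' i).2
    rw [dirDeriv_const] at this
    linarith
  have e3 := bivInner_sdComb_sdFrame (F'.basis σ.base) (vertCoord F' σ A) j
  have e4 := (fiber_vec_eq F' σ).symm.trans (fiber_vec_eq F σ)
  refine (bivInner_congr (sdComb_vertCoord h A) rfl).trans (Eq.trans ?_
    ((bivInner_congr (sdComb_vertCoord h' A) rfl).symm.trans e3))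
  refine bilin_frame_change bivInner e4 (e1.trans ?_) e2 fun i => bivInner_sdFrame _ _ _
  exact Finset.sum_congr rfl fun i _ =>
    congrArg₂ (· + ·) (congrArg (coord F i σ * ·) (hd i).2) rfl

/-- The vertical part may be computed in any frame. -/
lemma vertPart_eq (h : σ.base ∈ F.domain) (A : TangentSpace I6 σ) :
    σ.vertPart A = sdComb (F.basis σ.base) (vertCoord F σ A) := by
  rw [sdComb_vertCoord_congr h (mem_frameAt_domain o σ.base),
    sdComb_vertCoord (mem_frameAt_domain o σ.base)]
  rfl

end TwistorSpace

end TwistorTangent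

/-! ### Tangent vectors and vector fields of the twistor space in frame charts -/

section VectorValued
variable {E G G' : Type*} [NormedAddCommGroup E] [NormedSpace ℝ E] [NormedAddCommGroup G]
  [NormedSpace ℝ G] [NormedAddCommGroup G'] [NormedSpace ℝ G']
  {N : Type*} [TopologicalSpace N] [ChartedSpace E N] {x : N}

lemma mfderiv_comp_differentiable {T : G → G'} {g : N → G} (hT : DifferentiableAt ℝ T (g x))
    (hg : MDifferentiableAt 𝓘(ℝ, E) 𝓘(ℝ, G) g x) (v : TangentSpace 𝓘(ℝ, E) x) :
    (mfderiv 𝓘(ℝ, E) 𝓘(ℝ, G') (fun y => T (g y)) x v : G') =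
      fderiv ℝ T (g x) (mfderiv 𝓘(ℝ, E) 𝓘(ℝ, G) g x v : G) := by
  have h : mfderiv 𝓘(ℝ, E) 𝓘(ℝ, G') (T ∘ g) x = _ := mfderiv_comp x hT.mdifferentiableAt hg
  have h2 := congrArg (fun L => L v) h
  rw [mfderiv_eq_fderiv] at h2
  exact h2

lemma mfderiv_comp_clm (L : G →L[ℝ] G') {g : N → G}
    (hg : MDifferentiableAt 𝓘(ℝ, E) 𝓘(ℝ, G) g x) (v : TangentSpace 𝓘(ℝ, E) x) :
    (mfderiv 𝓘(ℝ, E) 𝓘(ℝ, G') (fun y => L (g y)) x v : G') =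
      L (mfderiv 𝓘(ℝ, E) 𝓘(ℝ, G) g x v : G) := by
  rw [mfderiv_comp_differentiable L.differentiableAt hg, ContinuousLinearMap.fderiv]

lemma dirDeriv_eq_mfderiv_pi {ι : Type*} [Fintype ι] {g : N → ι → ℝ}
    (hg : MDifferentiableAt 𝓘(ℝ, E) 𝓘(ℝ, ι → ℝ) g x) (v : TangentSpace 𝓘(ℝ, E) x) (i : ι) :
    dirDeriv (fun y => g y i) x v = (mfderiv 𝓘(ℝ, E) 𝓘(ℝ, ι → ℝ) g x v : ι → ℝ) i :=
  mfderiv_comp_clm (ContinuousLinearMap.proj (R := ℝ) (φ := fun _ : ι => ℝ) i) hg v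

end VectorValued

section Stereographic

/-- The stereographic projection as a map on the ambient space. -/
def stereoMap (v : Metric.sphere (0 : E3) 1) (y : Fin 3 → ℝ) : E2 :=
  (OrthonormalBasis.fromOrthogonalSpanSingleton (𝕜 := ℝ) 2 (ne_zero_of_mem_unit_sphere v)).repr
    (stereoToFun (v : E3) (WithLp.toLp 2 y))

/-- The formula for the stereographic projection is smooth on the open set of x in ℝ³ with ⟨v, x⟩ ≠
1, and on the unit sphere this excludes only v. Working in the ambient space avoids differentiating
on the sphere. -/
lemma contDiffAt_stereoMap (v : Metric.sphere (0 : E3) 1) {y : Fin 3 → ℝ}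
    {z : Metric.sphere (0 : E3) 1} (hy : WithLp.toLp 2 y = (z : E3)) (hz : z ≠ v) :
    ContDiffAt ℝ ∞ (stereoMap v) y := by
  have h1 : ContDiffOn ℝ ∞ (stereoToFun (v : E3)) _ := contDiffOn_stereoToFun
  have ho : IsOpen {x : E3 | innerSL ℝ (v : E3) x ≠ (1 : ℝ)} :=
    isOpen_ne_fun (by fun_prop) continuous_const
  have hm : (z : E3) ∈ {x : E3 | innerSL ℝ (v : E3) x ≠ (1 : ℝ)} := by
    intro h
    exact hz ((sphere_ext_iff z v).mpr (by rw [real_inner_comm]; simpa using h))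
  have h2 : ContDiffAt ℝ ∞ (stereoToFun (v : E3)) (WithLp.toLp 2 y) := by
    rw [hy]; exact h1.contDiffAt (ho.mem_nhds hm)
  have h3 : ContDiffAt ℝ ∞ (fun y : Fin 3 → ℝ => (WithLp.toLp 2 y : E3)) y :=
    (PiLp.continuousLinearEquiv 2 ℝ (fun _ : Fin 3 => ℝ)).symm.contDiff.contDiffAt
  exact (LinearIsometryEquiv.contDiff _).contDiffAt.comp y (h2.comp y h3)

end Stereographic

section TwistorTangent
variable {M : Type*} [TopologicalSpace M] [ChartedSpace E4 M] [IsManifold I4 ∞ M]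
  [RiemannianBundle (fun p : M => TangentSpace I4 p)]
  [IsContMDiffRiemannianBundle I4 ∞ E4 (fun p : M => TangentSpace I4 p)]
  {o : ManifoldOrientation M}

namespace TwistorSpace
variable {F : OrientedFrame o} {σ τ : TwistorSpace o}

lemma contMDiffAt_coords (h : σ.base ∈ F.domain) :
    ContMDiffAt I6 𝓘(ℝ, Fin 3 → ℝ) ∞ (coords F) σ :=
  contMDiffAt_pi_space.mpr fun i => OrientedFrame.contMDiffAt_coord h i

lemma mdifferentiableAt_coords (h : σ.base ∈ F.domain) :
    MDifferentiableAt I6 𝓘(ℝ, Fin 3 → ℝ) (coords F) σ :=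
  (contMDiffAt_coords h).mdifferentiableAt (by simp)

lemma mfderiv_coords (h : σ.base ∈ F.domain) (A : TangentSpace I6 σ) :
    (mfderiv I6 𝓘(ℝ, Fin 3 → ℝ) (coords F) σ A : Fin 3 → ℝ) = dCoord F σ A :=
  funext fun i => (dirDeriv_eq_mfderiv_pi (mdifferentiableAt_coords h) A i).symm

lemma mdifferentiableAt_chartAround (hτ : τ ∈ (F.chartAround σ).source) :
    MDifferentiableAt I6 𝓘(ℝ, E4 × E2) (F.chartAround σ) τ :=
  mdifferentiableAt_atlas (F.openChart_mem_atlas _ _) hτ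

/-- The chart is the pair of a chart of M composed with π and the stereographic map composed with y,
so the chain rule expresses its differential through π_* A and dy(A). -/
lemma mfderiv_chartAround (hτ : τ ∈ (F.chartAround σ).source) (A : TangentSpace I6 τ) :
    (mfderiv I6 𝓘(ℝ, E4 × E2) (F.chartAround σ) τ A : E4 × E2) =
      ((mfderiv I4 𝓘(ℝ, E4) (chartAt E4 σ.base) τ.base (τ.projDeriv A) : E4),
        fderiv ℝ (stereoMap (-(F.triv σ).2)) (coords F τ) (dCoord F τ A)) := by
  have hd := mdifferentiableAt_chartAround hτ
  obtain ⟨⟨h1, h2⟩, h3⟩ := (F.chart_source _ _ τ).mp hτ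
  refine Prod.ext ?_ ?_
  · have h := mfderiv_comp_clm (ContinuousLinearMap.fst ℝ E4 E2) hd A
    refine h.symm.trans ?_
    have hc : mfderiv I6 𝓘(ℝ, E4) ((chartAt E4 σ.base) ∘ TwistorSpace.base (o := o)) τ = _ :=
      mfderiv_comp τ (mdifferentiableAt_atlas (chart_mem_atlas E4 σ.base) h1)
        (mdifferentiable_base τ)
    exact congrArg (fun L => L A) hc
  · have h := mfderiv_comp_clm (ContinuousLinearMap.snd ℝ E4 E2) hd A
    refine h.symm.trans ?_
    rw [← mfderiv_coords h2]
    exact mfderiv_comp_differentiable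
      ((contDiffAt_stereoMap _ (z := (F.triv τ).2) rfl h3).differentiableAt (by simp))
      (mdifferentiableAt_coords h2) A

/-- A tangent vector of the twistor space is determined by its projection and the derivatives of
the fibre coordinates. -/
lemma eq_zero_of_projDeriv_dCoord (h : σ.base ∈ F.domain) {A : TangentSpace I6 σ}
    (h₁ : σ.projDeriv A = 0) (h₂ : dCoord F σ A = 0) : A = 0 := by
  have hs := OrientedFrame.mem_chartAround_source h
  have hm := (mdifferentiable_of_mem_atlas (I := I6) (F.openChart_mem_atlas
    (chart_mem_atlas E4 σ.base) (-(F.triv σ).2))).mfderiv_injective hs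
  refine hm ?_
  refine (mfderiv_chartAround hs A).trans ?_
  rw [h₁, h₂, map_zero, map_zero, map_zero]
  rfl

/-- Differentiability of a vector field on the twistor space in terms of its components. -/
lemma fieldDiffAt_of_components {A : Π τ : TwistorSpace o, TangentSpace I6 τ}
    {X : Π p : M, TangentSpace I4 p} {w : TwistorSpace o → Fin 3 → ℝ} (hX : FieldDiffAt X σ.base)
    (hw : MDifferentiableAt I6 𝓘(ℝ, Fin 3 → ℝ) w σ)
    (h₁ : ∀ᶠ τ in 𝓝 σ, τ.projDeriv (A τ) = X τ.base)
    (h₂ : ∀ᶠ τ in 𝓝 σ, dCoord (frameAt o σ.base) τ (A τ) = w τ) : FieldDiffAt A σ := by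
  set F := frameAt o σ.base with hF
  have hσ : σ.base ∈ F.domain := mem_frameAt_domain o σ.base
  have hs := OrientedFrame.mem_chartAround_source hσ
  have h3 := ((F.chart_source _ _ σ).mp hs).2
  -- The criterion uses the preferred chart at σ, which is built from `frameAt o σ.base`; for this
  -- reason the components are required in that frame.
  rw [fieldDiffAt_iff]
  have h4 := (fieldDiffAt_iff.mp hX).comp σ (mdifferentiable_base σ)
  have h5 : DifferentiableAt ℝ (fderiv ℝ (stereoMap (-(F.triv σ).2))) (coords F σ) :=
    ((contDiffAt_stereoMap _ (z := (F.triv σ).2) rfl h3).fderiv_right (m := 1)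
      (by norm_cast)).differentiableAt (by simp)
  have h6 := (h5.mdifferentiableAt.comp σ (mdifferentiableAt_coords hσ)).clm_apply hw
  refine (h4.prodMk_space h6).congr_of_eventuallyEq ?_
  filter_upwards [h₁, h₂, (F.chartAround σ).open_source.mem_nhds hs] with τ e1 e2 hτ
  refine (mfderiv_chartAround hτ (A τ)).trans ?_
  rw [e1, e2]
  rfl

end TwistorSpace

end TwistorTangent

/-! ### Lifts, the metric and the Kähler form in fibre coordinates -/

section TwistorMetric
variable {M : Type*} [TopologicalSpace M] [ChartedSpace E4 M] [IsManifold I4 ∞ M]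
  [RiemannianBundle (fun p : M => TangentSpace I4 p)]
  [IsContMDiffRiemannianBundle I4 ∞ E4 (fun p : M => TangentSpace I4 p)]
  {o : ManifoldOrientation M}

namespace TwistorSpace
variable {F : OrientedFrame o} {σ : TwistorSpace o}

lemma eventually_base_mem (h : σ.base ∈ F.domain) : ∀ᶠ τ : TwistorSpace o in 𝓝 σ,
    τ.base ∈ F.domain :=
  contMDiff_base.continuous.continuousAt.eventually (F.eventually_mem h)

lemma dCoord_add (F : OrientedFrame o) (A B : TangentSpace I6 σ) :
    dCoord F σ (A + B) = dCoord F σ A + dCoord F σ B := funext fun _ => dirDeriv_vec_add _ _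

lemma dCoord_smul (F : OrientedFrame o) (c : ℝ) (A : TangentSpace I6 σ) :
    dCoord F σ (c • A) = c • dCoord F σ A := funext fun _ => dirDeriv_vec_smul _ _

lemma vertCoord_add (h : σ.base ∈ F.domain) (A B : TangentSpace I6 σ) :
    vertCoord F σ (A + B) = vertCoord F σ A + vertCoord F σ B := by
  simp only [vertCoord, dCoord_add, projDeriv_add, F.sdConn_add h, map_add, LinearMap.add_apply]
  abel

lemma vertCoord_smul (h : σ.base ∈ F.domain) (c : ℝ) (A : TangentSpace I6 σ) :
    vertCoord F σ (c • A) = c • vertCoord F σ A := by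
  simp only [vertCoord, dCoord_smul, projDeriv_smul, F.sdConn_smul h, map_smul,
    LinearMap.smul_apply, smul_add]

lemma coords_dot_self (F : OrientedFrame o) (σ : TwistorSpace o) :
    coords F σ ⬝ᵥ coords F σ = 1 := by
  have h := F.sum_coord_sq σ
  simp only [pow_two] at h
  exact h

lemma dot_cross_right (x y : Fin 3 → ℝ) : y ⬝ᵥ crossProduct x y = 0 := by
  rw [dotProduct, Fin.sum_univ_three, cross_apply]
  simp
  ring

lemma coords_dot_vertCoord (h : σ.base ∈ F.domain) (A : TangentSpace I6 σ) :
    coords F σ ⬝ᵥ vertCoord F σ A = 0 := by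
  rw [vertCoord, dotProduct_add, dot_cross_right, add_zero]
  exact coords_dot_dCoord h A

lemma eq_zero_of_projDeriv_vertCoord (h : σ.base ∈ F.domain) {A : TangentSpace I6 σ}
    (h₁ : σ.projDeriv A = 0) (h₂ : vertCoord F σ A = 0) : A = 0 := by
  refine eq_zero_of_projDeriv_dCoord h h₁ ?_
  have : F.sdConn (0 : TangentSpace I4 σ.base) = 0 := by
    have := F.sdConn_smul h 0 (0 : TangentSpace I4 σ.base)
    simpa using this
  rw [vertCoord, h₁, this] at h₂
  simpa using h₂

/-- A dimension count. The map (A, r) ↦ (π_* A, v(A) + r y), with v(A) the vertical coordinates,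
goes between spaces of dimension 7. Pairing with y recovers r because v(A) is orthogonal to y, so
the map is injective and hence onto; r = 0 when the target is orthogonal to y. -/
lemma exists_of_projDeriv_vertCoord (h : σ.base ∈ F.domain) (X : TangentSpace I4 σ.base)
    {w : Fin 3 → ℝ} (hw : coords F σ ⬝ᵥ w = 0) :
    ∃ A : TangentSpace I6 σ, σ.projDeriv A = X ∧ vertCoord F σ A = w := by
  let L : (TangentSpace I6 σ × ℝ) →ₗ[ℝ] TangentSpace I4 σ.base × (Fin 3 → ℝ) :=
    { toFun := fun z => (σ.projDeriv z.1, vertCoord F σ z.1 + z.2 • coords F σ)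
      map_add' := fun a b => by
        simp only [Prod.fst_add, Prod.snd_add, projDeriv_add, vertCoord_add h, Prod.mk_add_mk,
          add_smul]
        congr 1; abel
      map_smul' := fun c a => by
        simp only [Prod.smul_fst, Prod.smul_snd, projDeriv_smul, vertCoord_smul h, Prod.smul_mk,
          smul_add, RingHom.id_apply, smul_eq_mul, mul_smul] }
  have h6 : FiniteDimensional ℝ (TangentSpace I6 σ) :=
    inferInstanceAs (FiniteDimensional ℝ (E4 × E2))
  have d6 : finrank ℝ (TangentSpace I6 σ) = 6 := by
    have : finrank ℝ (E4 × E2) = 6 := by simp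
    exact this
  have d4 : finrank ℝ (TangentSpace I4 σ.base) = 4 := Fact.out
  have hdim : finrank ℝ (TangentSpace I6 σ × ℝ) =
      finrank ℝ (TangentSpace I4 σ.base × (Fin 3 → ℝ)) := by
    rw [Module.finrank_prod, Module.finrank_prod, d6, d4]
    simp
  have key : ∀ z : TangentSpace I6 σ × ℝ,
      coords F σ ⬝ᵥ (vertCoord F σ z.1 + z.2 • coords F σ) = z.2 := fun z => by
    rw [dotProduct_add, dotProduct_smul, coords_dot_vertCoord h, coords_dot_self]
    simp
  have hinj : Function.Injective L := by
    rw [← LinearMap.ker_eq_bot, LinearMap.ker_eq_bot']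
    rintro ⟨A, r⟩ hz
    obtain ⟨e1, e2⟩ := Prod.ext_iff.mp hz
    have hr : r = 0 :=
      (key (A, r)).symm.trans ((congrArg (coords F σ ⬝ᵥ ·) e2).trans (dotProduct_zero _))
    subst hr
    have e3 : vertCoord F σ A = 0 := by simpa [L] using e2
    exact Prod.ext (eq_zero_of_projDeriv_vertCoord h e1 e3) rfl
  obtain ⟨⟨A, r⟩, hA⟩ := (LinearMap.injective_iff_surjective_of_finrank_eq_finrank hdim).mp hinj
    (X, w)
  obtain ⟨e1, e2⟩ := Prod.ext_iff.mp hA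
  have hr : r = 0 :=
     (key (A, r)).symm.trans ((congrArg (coords F σ ⬝ᵥ ·) e2).trans hw)
  subst hr
  exact ⟨A, e1, by simpa [L] using e2⟩

lemma isVertical_sdComb {w : Fin 3 → ℝ} (hw : coords F σ ⬝ᵥ w = 0) :
    σ.IsVertical (sdComb (F.basis σ.base) w) :=
  ⟨hodgeStar_sdComb _ _ (F.orientation_eq _) _,
    (bivInner_congr (fiber_vec_eq F σ) rfl).trans ((bivInner_sdComb _ _ _).trans hw)⟩

lemma IsVertical.exists_eq {U : ⋀[ℝ]^2 (TangentSpace I4 σ.base)} (hU : σ.IsVertical U)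
    (F : OrientedFrame o) : ∃ w, U = sdComb (F.basis σ.base) w ∧ coords F σ ⬝ᵥ w = 0 := by
  have e := eq_sdComb _ _ (F.orientation_eq _) hU.1
  refine ⟨_, e, ?_⟩
  exact (bivInner_sdComb _ _ _).symm.trans
    ((bivInner_congr (fiber_vec_eq F σ) e).symm.trans hU.2)

/-- The choice in `lift` is justified by the existence just proved, since a vertical bivector has
coordinates orthogonal to y. -/
lemma lift_spec (X : TangentSpace I4 σ.base) {U : ⋀[ℝ]^2 (TangentSpace I4 σ.base)}
    (hU : σ.IsVertical U) : σ.projDeriv (σ.lift X U) = X ∧ σ.vertPart (σ.lift X U) = U := by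
  have h := mem_frameAt_domain o σ.base
  obtain ⟨w, e, hw⟩ := hU.exists_eq (frameAt o σ.base)
  obtain ⟨A, h1, h2⟩ := exists_of_projDeriv_vertCoord h X hw
  have ex : ∃ A, σ.projDeriv A = X ∧ σ.vertPart A = U :=
    ⟨A, h1, by rw [vertPart_eq h, h2, e]⟩
  exact Classical.epsilon_spec ex

lemma lift_vertCoord (h : σ.base ∈ F.domain) (X : TangentSpace I4 σ.base) {w : Fin 3 → ℝ}
    (hw : coords F σ ⬝ᵥ w = 0) : vertCoord F σ (σ.lift X (sdComb (F.basis σ.base) w)) = w := by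
  have h2 := (lift_spec X (isVertical_sdComb hw)).2
  rw [vertPart_eq h] at h2
  exact sdComb_injective _ h2

lemma eq_of_projDeriv_vertCoord (h : σ.base ∈ F.domain) {A B : TangentSpace I6 σ}
    (h₁ : σ.projDeriv A = σ.projDeriv B) (h₂ : vertCoord F σ A = vertCoord F σ B) : A = B := by
  have e : A + (-1 : ℝ) • B = 0 := by
    refine eq_zero_of_projDeriv_vertCoord h ?_ ?_
    · rw [projDeriv_add, projDeriv_smul, h₁]; module
    · rw [vertCoord_add h, vertCoord_smul h, h₂]; module
  rwa [neg_one_smul, ← sub_eq_add_neg, sub_eq_zero] at e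

lemma metric_eq (h : σ.base ∈ F.domain) (t : ℝ) (A B : TangentSpace I6 σ) :
    metric t σ A B = ⟪σ.projDeriv A, σ.projDeriv B⟫ +
      t * (vertCoord F σ A ⬝ᵥ vertCoord F σ B) :=
  congrArg (fun r => ⟪σ.projDeriv A, σ.projDeriv B⟫ + t * r)
    ((bivInner_congr (vertPart_eq h A) (vertPart_eq h B)).trans (bivInner_sdComb _ _ _))

variable {f : ∀ p : M, TwistorFiber (o.orient p) → TwistorFiber (o.orient p)}

lemma cross_vertPart (h : σ.base ∈ F.domain) (A : TangentSpace I6 σ) :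
    cross (o.orient σ.base) σ.fiber.vec (σ.vertPart A) =
      sdComb (F.basis σ.base) (crossProduct (coords F σ) (vertCoord F σ A)) := by
  rw [vertPart_eq h, fiber_vec_eq F σ, cross_sdComb _ _ (F.orientation_eq _)]

lemma dot_cross_left (x y : Fin 3 → ℝ) : x ⬝ᵥ crossProduct x y = 0 := by
  rw [dotProduct, Fin.sum_univ_three, cross_apply]
  simp
  ring

lemma projDeriv_almostComplex (A : TangentSpace I6 σ) : σ.projDeriv (almostComplex f σ A) =
    bivEndo (f σ.base σ.fiber).vec (σ.projDeriv A) := by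
  have h := mem_frameAt_domain o σ.base
  rw [almostComplex, cross_vertPart h]
  exact (lift_spec _ (isVertical_sdComb (dot_cross_left _ _))).1

lemma vertCoord_almostComplex (h : σ.base ∈ F.domain) (A : TangentSpace I6 σ) :
    vertCoord F σ (almostComplex f σ A) = crossProduct (coords F σ) (vertCoord F σ A) := by
  rw [almostComplex, cross_vertPart h]
  exact lift_vertCoord h _ (dot_cross_left _ _)

lemma kaehlerForm_eq (h : σ.base ∈ F.domain) (t : ℝ) (A B : TangentSpace I6 σ) :
    kaehlerForm f t σ A B = ⟪bivEndo (f σ.base σ.fiber).vec (σ.projDeriv A), σ.projDeriv B⟫ +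
      t * (crossProduct (coords F σ) (vertCoord F σ A) ⬝ᵥ vertCoord F σ B) := by
  rw [kaehlerForm, metric_eq h, vertCoord_almostComplex h, projDeriv_almostComplex]

/-- The almost complex structure is skew for the metric: K_a is skew on the horizontal part and u ↦
y × u on the vertical part. -/
lemma kaehlerForm_eq_neg (t : ℝ) (A B : TangentSpace I6 σ) :
    kaehlerForm f t σ A B = - metric t σ A (almostComplex f σ B) := by
  have h := mem_frameAt_domain o σ.base
  rw [kaehlerForm_eq h, metric_eq h, vertCoord_almostComplex h, projDeriv_almostComplex,
    inner_bivEndo_swap]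
  simp only [dotProduct, Fin.sum_univ_three, cross_apply]
  simp
  ring

end TwistorSpace

end TwistorMetric

/-! ### Differentiability of the metric and of the Kähler form -/

section VectorDifferentiability
variable {E : Type*} [NormedAddCommGroup E] [NormedSpace ℝ E]
  {N : Type*} [TopologicalSpace N] [ChartedSpace E N] {x : N} {u v : N → Fin 3 → ℝ}

lemma funDiffAt_cross (hu : ∀ i, FunDiffAt (E := E) (fun z => u z i) x)
    (hv : ∀ i, FunDiffAt (E := E) (fun z => v z i) x) (k : Fin 3) :
    FunDiffAt (E := E) (fun z => crossProduct (u z) (v z) k) x := by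
  simp only [cross_apply]
  fin_cases k
  · exact ((hu 1).mul (hv 2)).sub ((hu 2).mul (hv 1))
  · exact ((hu 2).mul (hv 0)).sub ((hu 0).mul (hv 2))
  · exact ((hu 0).mul (hv 1)).sub ((hu 1).mul (hv 0))

lemma funDiffAt_dot (hu : ∀ i, FunDiffAt (E := E) (fun z => u z i) x)
    (hv : ∀ i, FunDiffAt (E := E) (fun z => v z i) x) :
    FunDiffAt (E := E) (fun z => u z ⬝ᵥ v z) x :=
  (dirDeriv_sum Finset.univ (fun i _ => (hu i).mul (hv i)) 0).1

end VectorDifferentiability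

section TwistorDifferentiability
variable {M : Type*} [TopologicalSpace M] [ChartedSpace E4 M] [IsManifold I4 ∞ M]
  [RiemannianBundle (fun p : M => TangentSpace I4 p)]
  [IsContMDiffRiemannianBundle I4 ∞ E4 (fun p : M => TangentSpace I4 p)]
  {o : ManifoldOrientation M}

namespace TwistorSpace
variable {F : OrientedFrame o} {σ : TwistorSpace o}
  {A B : Π τ : TwistorSpace o, TangentSpace I6 τ}

/-- The field along π is the composition of A with the tangent map of π, which is C¹. -/
lemma mdifferentiableAt_projDeriv (hA : FieldDiffAt A σ) :
    MDifferentiableAt I6 (I4.prod 𝓘(ℝ, E4))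
      (fun τ => (⟨τ.base, τ.projDeriv (A τ)⟩ : TangentBundle I4 M)) σ := by
  have h : ContMDiff I6.tangent I4.tangent 1 (tangentMap I6 I4 (TwistorSpace.base (o := o))) :=
    contMDiff_base.contMDiff_tangentMap (by norm_cast)
  exact MDifferentiableAt.comp σ (h.mdifferentiable (by simp) _) hA

lemma funDiffAt_inner_field (h : σ.base ∈ F.domain) (hA : FieldDiffAt A σ) (a : Fin 4) :
    FunDiffAt (E := E4 × E2) (fun τ => ⟪F.basis τ.base a, τ.projDeriv (A τ)⟫) σ := by
  have h1 : MDifferentiableAt I6 (I4.prod 𝓘(ℝ, E4))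
      (fun τ : TwistorSpace o => (⟨τ.base, F.basis τ.base a⟩ : TangentBundle I4 M)) σ :=
    MDifferentiableAt.comp σ (F.fieldC2At h a).fieldDiffAt (mdifferentiable_base σ)
  exact MDifferentiableAt.inner_bundle h1 (mdifferentiableAt_projDeriv hA)

lemma funDiffAt_inner_projDeriv (hA : FieldDiffAt A σ) (hB : FieldDiffAt B σ) :
    FunDiffAt (E := E4 × E2) (fun τ => ⟪τ.projDeriv (A τ), τ.projDeriv (B τ)⟫) σ :=
  MDifferentiableAt.inner_bundle (mdifferentiableAt_projDeriv hA) (mdifferentiableAt_projDeriv hB)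

/-- The field π_* A lives along π and need not come from a vector field on M. Linearity of α
separates its frame components, functions on the twistor space, from the values of α on the frame,
which are functions on M. -/
lemma funDiffAt_sdConn_projDeriv (h : σ.base ∈ F.domain) (hA : FieldDiffAt A σ) (k : Fin 3) :
    FunDiffAt (E := E4 × E2) (fun τ => F.sdConn (τ.projDeriv (A τ)) k) σ := by
  have h1 : FunDiffAt (E := E4 × E2) (fun τ : TwistorSpace o =>
      ∑ a, ⟪F.basis τ.base a, τ.projDeriv (A τ)⟫ * F.sdConn (F.basis τ.base a) k) σ :=
    (dirDeriv_sum Finset.univ (fun a _ => (funDiffAt_inner_field h hA a).mul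
      (funDiffAt_comp_base (F.funDiffAt_sdConn h (F.fieldC2At h a) k))) 0).1
  refine h1.congr_of_eventuallyEq ?_
  filter_upwards [eventually_base_mem h] with τ hτ
  exact F.sdConn_eq_sum hτ _ k

lemma funDiffAt_vertCoord (h : σ.base ∈ F.domain) (hA : FieldDiffAt A σ) (k : Fin 3) :
    FunDiffAt (E := E4 × E2) (fun τ => vertCoord F τ (A τ) k) σ := by
  have h1 : FunDiffAt (E := E4 × E2) (fun τ => dirDeriv (coord F k) τ (A τ)) σ :=
    mdifferentiableAt_dirDeriv ((OrientedFrame.contMDiffAt_coord h k).of_le two_le_infty) hA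
  exact h1.add (funDiffAt_cross (fun k => funDiffAt_sdConn_projDeriv h hA k)
    (fun i => funDiffAt_coord h i) k)

/-- Near σ the metric is a polynomial in differentiable functions, taken in one fixed frame.
Nondegeneracy follows by testing u against itself: for t > 0 both summands are nonnegative, and a
vector with zero projection and zero vertical part is zero. -/
lemma isDiffMetric_metric {t : ℝ} (ht : 0 < t) : IsDiffMetric (metric (o := o) t) where
  add_left σ u v w := by
    have h := mem_frameAt_domain o σ.base
    rw [metric_eq h, metric_eq h, metric_eq h, projDeriv_add, vertCoord_add h, inner_add_left,
      add_dotProduct]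
    ring
  smul_left σ c u w := by
    have h := mem_frameAt_domain o σ.base
    rw [metric_eq h, metric_eq h, projDeriv_smul, vertCoord_smul h, real_inner_smul_left,
      smul_dotProduct, smul_eq_mul]
    ring
  add_right σ u v w := by
    have h := mem_frameAt_domain o σ.base
    rw [metric_eq h, metric_eq h, metric_eq h, projDeriv_add, vertCoord_add h, inner_add_right,
      dotProduct_add]
    ring
  smul_right σ c u w := by
    have h := mem_frameAt_domain o σ.base
    rw [metric_eq h, metric_eq h, projDeriv_smul, vertCoord_smul h, real_inner_smul_right,
      dotProduct_smul, smul_eq_mul]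
    ring
  diffAt {σ A B} hA hB := by
    have h := mem_frameAt_domain o σ.base
    have h1 := (funDiffAt_inner_projDeriv hA hB).add ((mdifferentiableAt_const (c := t)).mul
      (funDiffAt_dot (fun k => funDiffAt_vertCoord h hA k) (fun k => funDiffAt_vertCoord h hB k)))
    refine h1.congr_of_eventuallyEq ?_
    filter_upwards [eventually_base_mem h] with τ hτ
    exact metric_eq hτ t _ _
  symm σ u v := by
    have h := mem_frameAt_domain o σ.base
    rw [metric_eq h, metric_eq h, real_inner_comm, dotProduct_comm]
  nondeg σ u hu := by
    have h := mem_frameAt_domain o σ.base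
    have h0 := hu u
    rw [metric_eq h] at h0
    have h1 : 0 ≤ ⟪σ.projDeriv u, σ.projDeriv u⟫ := real_inner_self_nonneg
    have h2 : 0 ≤ vertCoord (frameAt o σ.base) σ u ⬝ᵥ vertCoord (frameAt o σ.base) σ u :=
      Finset.sum_nonneg fun i _ => mul_self_nonneg _
    have h3 := mul_nonneg ht.le h2
    have h4 : σ.projDeriv u = 0 := inner_self_eq_zero (𝕜 := ℝ).mp (by linarith)
    refine eq_zero_of_projDeriv_vertCoord h h4 ?_
    refine dotProduct_self_eq_zero.mp ?_
    have : t * (vertCoord (frameAt o σ.base) σ u ⬝ᵥ vertCoord (frameAt o σ.base) σ u) = 0 := by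
      linarith
    exact (mul_eq_zero.mp this).resolve_left ht.ne'

variable {f : ∀ p : M, TwistorFiber (o.orient p) → TwistorFiber (o.orient p)}

lemma funDiffAt_coord_fibreMap (hf : ContMDiff I6 I6 ∞ (fibreMap f)) (h : σ.base ∈ F.domain)
    (i : Fin 3) : FunDiffAt (E := E4 × E2) (fun τ => coord F i (fibreMap f τ)) σ :=
  MDifferentiableAt.comp (g := coord F i) σ (funDiffAt_coord (σ := fibreMap f σ) h i)
    (hf.mdifferentiable (by simp) σ)

lemma bivEndo_add {V : Type*} [NormedAddCommGroup V] [InnerProductSpace ℝ V]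
    [FiniteDimensional ℝ V] (a : ⋀[ℝ]^2 V) (u v : V) :
    bivEndo a (u + v) = bivEndo a u + bivEndo a v := (bivEndoₗ a).map_add u v

lemma bivEndo_smul {V : Type*} [NormedAddCommGroup V] [InnerProductSpace ℝ V]
    [FiniteDimensional ℝ V] (a : ⋀[ℝ]^2 V) (c : ℝ) (v : V) :
    bivEndo a (c • v) = c • bivEndo a v := (bivEndoₗ a).map_smul c v

/-- Written in components, K involves only constants, the coordinates of the bivector and the frame
components of the vectors; differentiability and derivatives of Ω are read off from this. -/
lemma inner_bivEndo_sdComb {V : Type*} [NormedAddCommGroup V] [InnerProductSpace ℝ V]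
    [FiniteDimensional ℝ V]
    (e : OrthonormalBasis (Fin 4) ℝ V) (x : Fin 3 → ℝ) (u v : V) :
    ⟪bivEndo (sdComb e x) u, v⟫ =
      ∑ k, x k * ∑ a, ∑ b, sdMatrix (Pi.single k 1) a b * (⟪e a, u⟫ * ⟪e b, v⟫) := by
  have h : ∀ k, sdFrame e k = sdComb e (Pi.single k 1) := fun k => by
    simp [sdComb, Pi.single_apply]
  rw [inner_bivEndo, wedge_eq_sum e u v, sdComb]
  simp only [h, map_sum, map_smul, LinearMap.sum_apply, LinearMap.smul_apply, smul_eq_mul,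
    ← two_mul_bivInner_sdComb e, Finset.mul_sum]
  rw [Finset.sum_comm_cycle]
  refine Finset.sum_congr rfl fun k _ => Finset.sum_congr rfl fun a _ =>
    Finset.sum_congr rfl fun b _ => ?_
  ring

/-- The map f enters only through the fibre coordinates of f(σ), which are differentiable because f
is smooth. -/
lemma isDiffBilinear_kaehlerForm (hf : ContMDiff I6 I6 ∞ (fibreMap f)) {t : ℝ} (ht : 0 < t) :
    IsDiffBilinear (kaehlerForm f t) where
  add_left σ u v w := by
    have h := mem_frameAt_domain o σ.base
    rw [kaehlerForm_eq h, kaehlerForm_eq h, kaehlerForm_eq h, projDeriv_add, vertCoord_add h,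
      map_add, add_dotProduct, bivEndo_add, inner_add_left]
    ring
  smul_left σ c u w := by
    have h := mem_frameAt_domain o σ.base
    rw [kaehlerForm_eq h, kaehlerForm_eq h, projDeriv_smul, vertCoord_smul h,
      map_smul, smul_dotProduct, bivEndo_smul, real_inner_smul_left, smul_eq_mul]
    ring
  add_right σ u v w := (isDiffMetric_metric ht).add_right _ _ _ _
  smul_right σ c u w := (isDiffMetric_metric ht).smul_right _ _ _ _
  diffAt {σ A B} hA hB := by
    have h := mem_frameAt_domain o σ.base
    set F := frameAt o σ.base
    have h1 : FunDiffAt (E := E4 × E2) (fun τ => ∑ k, coord F k (fibreMap f τ) *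
        ∑ a, ∑ b, sdMatrix (Pi.single k 1) a b *
          (⟪F.basis τ.base a, τ.projDeriv (A τ)⟫ * ⟪F.basis τ.base b, τ.projDeriv (B τ)⟫)) σ :=
      (dirDeriv_sum Finset.univ (fun k _ => (funDiffAt_coord_fibreMap hf h k).mul
        (dirDeriv_sum Finset.univ (fun a _ => (dirDeriv_sum Finset.univ (fun b _ =>
          mdifferentiableAt_const.mul ((funDiffAt_inner_field h hA a).mul
            (funDiffAt_inner_field h hB b))) 0).1) 0).1) 0).1
    have h2 := h1.add ((mdifferentiableAt_const (c := t)).mul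
      (funDiffAt_dot (funDiffAt_cross (fun k => funDiffAt_coord h k)
        (fun k => funDiffAt_vertCoord h hA k)) (fun k => funDiffAt_vertCoord h hB k)))
    refine h2.congr_of_eventuallyEq ?_
    filter_upwards [eventually_base_mem h] with τ hτ
    refine (kaehlerForm_eq hτ t _ _).trans (congrArg (· + _) ?_)
    have e := congrArg (fun a => ⟪bivEndo a (τ.projDeriv (A τ)), τ.projDeriv (B τ)⟫)
      (fiber_vec_eq F (fibreMap f τ))
    exact e.trans (inner_bivEndo_sdComb _ _ _ _)

end TwistorSpace

end TwistorDifferentiability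

/-! ### Product rules for functions with values in ℝ³ -/

section VectorCalculus
variable {E : Type*} [NormedAddCommGroup E] [NormedSpace ℝ E]
  {N : Type*} [TopologicalSpace N] [ChartedSpace E N] {x : N} {u v : N → Fin 3 → ℝ}

/-- The derivative of an `ℝ³`-valued function in the direction of a tangent vector. -/
def vecDeriv (u : N → Fin 3 → ℝ) (x : N) (w : TangentSpace 𝓘(ℝ, E) x) : Fin 3 → ℝ :=
  fun i => dirDeriv (fun z => u z i) x w

lemma vecDeriv_cross (hu : ∀ i, FunDiffAt (E := E) (fun z => u z i) x)
    (hv : ∀ i, FunDiffAt (E := E) (fun z => v z i) x) (w : TangentSpace 𝓘(ℝ, E) x) :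
    vecDeriv (fun z => crossProduct (u z) (v z)) x w =
      crossProduct (vecDeriv u x w) (v x) + crossProduct (u x) (vecDeriv v x w) := by
  have key : ∀ i j, dirDeriv (fun z => u z i * v z j - u z j * v z i) x w =
      (u x i * dirDeriv (fun z => v z j) x w + v x j * dirDeriv (fun z => u z i) x w) -
      (u x j * dirDeriv (fun z => v z i) x w + v x i * dirDeriv (fun z => u z j) x w) := by
    intro i j
    have h1 : FunDiffAt (E := E) (fun z => u z i * v z j) x := (hu i).mul (hv j)
    have h2 : FunDiffAt (E := E) (fun z => u z j * v z i) x := (hu j).mul (hv i)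
    rw [dirDeriv_sub h1 h2, dirDeriv_mul (hu i) (hv j), dirDeriv_mul (hu j) (hv i)]
  ext k
  simp only [vecDeriv, cross_apply]
  fin_cases k
  · exact (key 1 2).trans (by simp; ring)
  · exact (key 2 0).trans (by simp; ring)
  · exact (key 0 1).trans (by simp; ring)

lemma dirDeriv_dot (hu : ∀ i, FunDiffAt (E := E) (fun z => u z i) x)
    (hv : ∀ i, FunDiffAt (E := E) (fun z => v z i) x) (w : TangentSpace 𝓘(ℝ, E) x) :
    dirDeriv (fun z => u z ⬝ᵥ v z) x w = vecDeriv u x w ⬝ᵥ v x + u x ⬝ᵥ vecDeriv v x w := by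
  refine ((dirDeriv_sum Finset.univ (fun i _ => (hu i).mul (hv i)) w).2).trans ?_
  rw [dotProduct, dotProduct, ← Finset.sum_add_distrib]
  refine Finset.sum_congr rfl fun i _ => (dirDeriv_mul (hu i) (hv i) w).trans ?_
  simp only [vecDeriv]
  ring

lemma vecDeriv_congr (h : ∀ᶠ z in 𝓝 x, u z = v z) (w : TangentSpace 𝓘(ℝ, E) x) :
    vecDeriv u x w = vecDeriv v x w :=
  funext fun i => dirDeriv_congr (h.mono fun _ hz => congrFun hz i) w

lemma vecDeriv_const_sub (c : Fin 3 → ℝ) (hv : ∀ i, FunDiffAt (E := E) (fun z => v z i) x)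
    (w : TangentSpace 𝓘(ℝ, E) x) : vecDeriv (fun z => c - v z) x w = - vecDeriv v x w :=
  funext fun i => by
    refine (dirDeriv_sub mdifferentiableAt_const (hv i) w).trans ?_
    rw [dirDeriv_const, zero_sub]; rfl

lemma vecDeriv_const_sub_cross (c : Fin 3 → ℝ) (hu : ∀ i, FunDiffAt (E := E) (fun z => u z i) x)
    (hv : ∀ i, FunDiffAt (E := E) (fun z => v z i) x) {w : TangentSpace 𝓘(ℝ, E) x}
    {u' v' : Fin 3 → ℝ} (hu' : vecDeriv u x w = u') (hv' : vecDeriv v x w = v') :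
    vecDeriv (fun z => crossProduct (c - u z) (v z)) x w =
      - crossProduct u' (v x) + crossProduct (c - u x) v' := by
  rw [vecDeriv_cross (u := fun z => c - u z) (fun i => mdifferentiableAt_const.sub (hu i)) hv,
    vecDeriv_const_sub c hu, hu', hv', map_neg, LinearMap.neg_apply]

lemma vecDeriv_const_cross (c : Fin 3 → ℝ) (hv : ∀ i, FunDiffAt (E := E) (fun z => v z i) x)
    {w : TangentSpace 𝓘(ℝ, E) x} {v' : Fin 3 → ℝ} (hv' : vecDeriv v x w = v') :
    vecDeriv (fun z => crossProduct c (v z)) x w = crossProduct c v' := by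
  have h := vecDeriv_cross (u := fun _ : N => c) (fun _ => mdifferentiableAt_const) hv w
  have h0 : vecDeriv (fun _ : N => c) x w = 0 := funext fun _ => dirDeriv_const _ _
  rw [h, h0, hv', map_zero, LinearMap.zero_apply, zero_add]

lemma mdifferentiableAt_pi_of (hu : ∀ i, FunDiffAt (E := E) (fun z => u z i) x) :
    MDifferentiableAt 𝓘(ℝ, E) 𝓘(ℝ, Fin 3 → ℝ) u x :=
  ⟨(continuousWithinAt_univ _ _).mpr (continuousAt_pi.mpr fun i => (hu i).continuousAt),
    differentiableWithinAt_pi.mpr fun i => (hu i).2⟩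

end VectorCalculus

/-! ### Adapted vector fields and their brackets -/

section StandardFields
variable {M : Type*} [TopologicalSpace M] [ChartedSpace E4 M] [IsManifold I4 ∞ M]
  [RiemannianBundle (fun p : M => TangentSpace I4 p)]
  [IsContMDiffRiemannianBundle I4 ∞ E4 (fun p : M => TangentSpace I4 p)]
  {o : ManifoldOrientation M}

namespace TwistorSpace
variable {F : OrientedFrame o} {σ τ : TwistorSpace o}

/-- The vector field on the twistor space whose projection has constant components `x` in the frame
and whose vertical part is `c × y`. -/
def stdField (F : OrientedFrame o) (x : Fin 4 → ℝ) (c : Fin 3 → ℝ) (τ : TwistorSpace o) :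
    TangentSpace I6 τ :=
  τ.lift (F.field x τ.base) (sdComb (F.basis τ.base) (crossProduct c (coords F τ)))

lemma projDeriv_stdField (x : Fin 4 → ℝ) (c : Fin 3 → ℝ) (τ : TwistorSpace o) :
    τ.projDeriv (stdField F x c τ) = F.field x τ.base := by
  have h : coords F τ ⬝ᵥ crossProduct c (coords F τ) = 0 := dot_cross_right _ _
  exact (lift_spec _ (isVertical_sdComb h)).1

lemma vertCoord_stdField (h : τ.base ∈ F.domain) (x : Fin 4 → ℝ) (c : Fin 3 → ℝ) :
    vertCoord F τ (stdField F x c τ) = crossProduct c (coords F τ) :=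
  lift_vertCoord h _ (dot_cross_right _ _)

/-- From dy + α × y = c × y. The fibre coordinates are thus rotated by the vector c - α. -/
lemma dCoord_stdField (h : τ.base ∈ F.domain) (x : Fin 4 → ℝ) (c : Fin 3 → ℝ) :
    dCoord F τ (stdField F x c τ) =
      crossProduct (c - F.sdConn (F.field x τ.base)) (coords F τ) := by
  have h1 := vertCoord_stdField h x c
  rw [vertCoord, projDeriv_stdField] at h1
  rw [map_sub, LinearMap.sub_apply, ← h1]
  abel

lemma funDiffAt_sdConn_field (h : σ.base ∈ F.domain) (x : Fin 4 → ℝ) (k : Fin 3) :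
    FunDiffAt (E := E4 × E2) (fun τ : TwistorSpace o => F.sdConn (F.field x τ.base) k) σ :=
  funDiffAt_comp_base (F.funDiffAt_sdConn h (F.fieldC2At_field h x) k)

lemma fieldDiffAt_stdField (hF : frameAt o σ.base = F) (x : Fin 4 → ℝ) (c : Fin 3 → ℝ) :
    FieldDiffAt (stdField F x c) σ := by
  have h : σ.base ∈ F.domain := hF ▸ mem_frameAt_domain o σ.base
  refine fieldDiffAt_of_components (F.fieldC2At_field h x).fieldDiffAt (w := fun τ =>
    crossProduct (c - F.sdConn (F.field x τ.base)) (coords F τ)) ?_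
    (.of_forall fun τ => projDeriv_stdField x c τ) ?_
  · have h1 := funDiffAt_cross (x := σ) (u := fun τ => c - F.sdConn (F.field x τ.base))
      (fun i => mdifferentiableAt_const.sub (funDiffAt_sdConn_field h x i))
      (fun i => funDiffAt_coord h i)
    exact mdifferentiableAt_pi_of h1
  · rw [hF]
    filter_upwards [eventually_base_mem h] with τ hτ
    exact dCoord_stdField hτ x c

/-- Brackets of π-related fields are π-related: both sides act in the same way on functions g ∘ π,
by the commutator formula for the bracket. -/
lemma projDeriv_mlieBracket {A B : Π τ : TwistorSpace o, TangentSpace I6 τ}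
    {X Y : Π p : M, TangentSpace I4 p} (hA : FieldDiffAt A σ) (hB : FieldDiffAt B σ)
    (hX : FieldDiffAt X σ.base) (hY : FieldDiffAt Y σ.base)
    (h₁ : ∀ τ : TwistorSpace o, τ.projDeriv (A τ) = X τ.base) (h₂ : ∀ τ : TwistorSpace o, τ.projDeriv (B τ) = Y τ.base) :
    σ.projDeriv (VectorField.mlieBracket I6 A B σ) = VectorField.mlieBracket I4 X Y σ.base := by
  refine eq_of_dirDeriv_eq fun g hg => ?_
  have hg2 : ContMDiffAt I4 𝓘(ℝ, ℝ) 2 g σ.base := hg.of_le two_le_infty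
  have hg1 := hg2.mdifferentiableAt (by norm_num)
  have hgπ : ContMDiffAt I6 𝓘(ℝ, ℝ) 2 (fun τ : TwistorSpace o => g τ.base) σ :=
    ContMDiffAt.comp σ hg2 ((contMDiff_base σ).of_le two_le_infty)
  have hev : ∀ᶠ τ : TwistorSpace o in 𝓝 σ, FunDiffAt (E := E4) g τ.base :=
    contMDiff_base.continuous.continuousAt.eventually
      (eventually_funDiffAt (hg2.of_le (by norm_num)))
  have key : ∀ {A B : Π τ : TwistorSpace o, TangentSpace I6 τ} {X Y : Π p : M, TangentSpace I4 p},
      FieldDiffAt Y σ.base → (∀ τ : TwistorSpace o, τ.projDeriv (A τ) = X τ.base) →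
      (∀ τ : TwistorSpace o, τ.projDeriv (B τ) = Y τ.base) →
      dirDeriv (fun τ => dirDeriv (fun τ : TwistorSpace o => g τ.base) τ (B τ)) σ (A σ) =
        dirDeriv (fun q => dirDeriv g q (Y q)) σ.base (X σ.base) := by
    intro A B X Y hY h₁ h₂
    rw [← h₁, ← dirDeriv_comp_base (mdifferentiableAt_dirDeriv hg2 hY)]
    refine dirDeriv_congr ?_ _
    filter_upwards [hev] with τ hτ
    rw [dirDeriv_comp_base hτ, h₂]
  rw [← dirDeriv_comp_base hg1, dirDeriv_mlieBracket hgπ hA hB, dirDeriv_mlieBracket hg2 hX hY,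
    key hY h₁ h₂, key hX h₂ h₁]

/-- The curvature of the bundle of self-dual bivectors in the fibre coordinates of a frame. -/
def curvCoord (F : OrientedFrame o) (p : M) (x x' : Fin 4 → ℝ) : Fin 3 → ℝ := fun k =>
  bivInner (baseCurvatureOperator p (wedge (F.field x p) (F.field x' p))) (sdFrame (F.basis p) k)

lemma cross_jacobi (u v y : Fin 3 → ℝ) : crossProduct (crossProduct u v) y =
    crossProduct u (crossProduct v y) - crossProduct v (crossProduct u y) := by
  ext k
  fin_cases k <;> simp [cross_apply] <;> ring

/-- The product rule for (b - β) × y, where β depends on the base point and y is itself rotated by a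
- α. -/
lemma vecDeriv_dCoord_stdField (h : σ.base ∈ F.domain) (x x' : Fin 4 → ℝ) (a b : Fin 3 → ℝ) :
    vecDeriv (fun τ => dCoord F τ (stdField F x' b τ)) σ (stdField F x a σ) =
      - crossProduct (vecDeriv (fun q => F.sdConn (F.field x' q)) σ.base (F.field x σ.base))
        (coords F σ) +
      crossProduct (b - F.sdConn (F.field x' σ.base))
        (crossProduct (a - F.sdConn (F.field x σ.base)) (coords F σ)) := by
  have e3 : vecDeriv (fun τ : TwistorSpace o => F.sdConn (F.field x' τ.base)) σ
      (stdField F x a σ) =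
      vecDeriv (fun q => F.sdConn (F.field x' q)) σ.base (F.field x σ.base) := funext fun i =>
    (dirDeriv_comp_base (F.funDiffAt_sdConn h (F.fieldC2At_field h x') i) _).trans
      (congrArg (dirDeriv (fun q => F.sdConn (F.field x' q) i) σ.base) (projDeriv_stdField x a σ))
  exact (vecDeriv_congr ((eventually_base_mem h).mono fun τ hτ => dCoord_stdField hτ x' b) _).trans
    (vecDeriv_const_sub_cross b (fun i => funDiffAt_sdConn_field h x' i)
      (fun i => funDiffAt_coord h i) e3 (dCoord_stdField h x a))

/-- The bracket acts on y by the commutator of the two rotations. The derivatives of α together with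
α([X, X']) become curvature by the structure equation, at the cost of α × β. The Jacobi identity
turns the nested products into α × β - (a - α) × (b - β), applied to y. -/
lemma vertCoord_mlieBracket_stdField (hF : frameAt o σ.base = F) (x x' : Fin 4 → ℝ)
    (a b : Fin 3 → ℝ) :
    vertCoord F σ (VectorField.mlieBracket I6 (stdField F x a) (stdField F x' b) σ) =
      crossProduct (curvCoord F σ.base x x' + crossProduct a (F.sdConn (F.field x' σ.base)) +
        crossProduct (F.sdConn (F.field x σ.base)) b - crossProduct a b) (coords F σ) := by
  have h : σ.base ∈ F.domain := hF ▸ mem_frameAt_domain o σ.base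
  have hA := fieldDiffAt_stdField hF x a
  have hB := fieldDiffAt_stdField hF x' b
  have hX := F.fieldC2At_field h x
  have hY := F.fieldC2At_field h x'
  have e1 : dCoord F σ (VectorField.mlieBracket I6 (stdField F x a) (stdField F x' b) σ) =
      vecDeriv (fun τ => dCoord F τ (stdField F x' b τ)) σ (stdField F x a σ) -
      vecDeriv (fun τ => dCoord F τ (stdField F x a τ)) σ (stdField F x' b σ) := funext fun i =>
    dirDeriv_mlieBracket ((OrientedFrame.contMDiffAt_coord h i).of_le two_le_infty) hA hB
  have e2 : curvCoord F σ.base x x' =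
      F.sdConn (VectorField.mlieBracket I4 (F.field x) (F.field x') σ.base) -
      vecDeriv (fun q => F.sdConn (F.field x' q)) σ.base (F.field x σ.base) +
      vecDeriv (fun q => F.sdConn (F.field x q)) σ.base (F.field x' σ.base) -
      crossProduct (F.sdConn (F.field x σ.base)) (F.sdConn (F.field x' σ.base)) :=
    funext fun k => F.bivInner_baseCurvatureOperator_sdFrame h hX hY k
  rw [vertCoord, projDeriv_mlieBracket hA hB hX.fieldDiffAt hY.fieldDiffAt
    (projDeriv_stdField x a) (projDeriv_stdField x' b), e1, vecDeriv_dCoord_stdField h,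
    vecDeriv_dCoord_stdField h, e2]
  -- Only the Jacobi identity in ℝ³ is left, valid for arbitrary vectors in place of the connection
  -- values and their derivatives.
  generalize F.sdConn (VectorField.mlieBracket I4 (F.field x) (F.field x') σ.base) = w
  generalize F.sdConn (F.field x σ.base) = α
  generalize F.sdConn (F.field x' σ.base) = β
  generalize vecDeriv (fun q => F.sdConn (F.field x q)) σ.base (F.field x' σ.base) = r
  generalize vecDeriv (fun q => F.sdConn (F.field x' q)) σ.base (F.field x σ.base) = s
  generalize coords F σ = y
  simp only [map_add, map_sub, LinearMap.add_apply, LinearMap.sub_apply, cross_jacobi]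
  abel

end TwistorSpace

end StandardFields

section
variable {E : Type*} [NormedAddCommGroup E] [NormedSpace ℝ E]
  {N : Type*} [TopologicalSpace N] [ChartedSpace E N] {x : N}

lemma dirDeriv_add_const_mul {f g : N → ℝ} (t : ℝ) (hf : FunDiffAt (E := E) f x)
    (hg : FunDiffAt (E := E) g x) (w : TangentSpace 𝓘(ℝ, E) x) :
    dirDeriv (fun z => f z + t * g z) x w = dirDeriv f x w + t * dirDeriv g x w := by
  have h1 : FunDiffAt (E := E) (fun z => t * g z) x := mdifferentiableAt_const.mul hg
  rw [dirDeriv_add hf h1, dirDeriv_const_mul t hg]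

lemma dirDeriv_const_add_const_mul {g : N → ℝ} (c t : ℝ) (hg : FunDiffAt (E := E) g x)
    (w : TangentSpace 𝓘(ℝ, E) x) :
    dirDeriv (fun z => c + t * g z) x w = t * dirDeriv g x w := by
  rw [dirDeriv_add_const_mul t mdifferentiableAt_const hg, dirDeriv_const, zero_add]

end

/-! ### Vector algebra on the fibre sphere -/

section FibreAlgebra

/-- The derivative of `(b × y) · (c × y)` in the direction `u × y`. -/
def dotDeriv (y b c u : Fin 3 → ℝ) : ℝ :=
  crossProduct b (crossProduct u y) ⬝ᵥ crossProduct c y +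
    crossProduct b y ⬝ᵥ crossProduct c (crossProduct u y)

/-- The derivative of `(y × (b × y)) · (c × y)` in the direction `u × y`. -/
def fibreFormDeriv (y b c u : Fin 3 → ℝ) : ℝ :=
  (crossProduct (crossProduct u y) (crossProduct b y) +
    crossProduct y (crossProduct b (crossProduct u y))) ⬝ᵥ crossProduct c y +
  crossProduct y (crossProduct b y) ⬝ᵥ crossProduct c (crossProduct u y)

/-- The vertical part of the Koszul formula for the fields `a × y`, `b × y`, `c × y` along which the
connection form has the values `α`, `β`, `γ` and the curvature the values `r₁`, `r₂`, `r₃`. -/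
def fibreKoszul (y a α b β c γ r₁ r₂ r₃ : Fin 3 → ℝ) : ℝ :=
  dotDeriv y b c (a - α) + dotDeriv y a c (b - β) - dotDeriv y a b (c - γ) +
    crossProduct (r₁ + crossProduct a β + crossProduct α b - crossProduct a b) y ⬝ᵥ
      crossProduct c y -
    crossProduct (r₂ + crossProduct a γ + crossProduct α c - crossProduct a c) y ⬝ᵥ
      crossProduct b y -
    crossProduct (r₃ + crossProduct b γ + crossProduct β c - crossProduct b c) y ⬝ᵥ
      crossProduct a y

/-- By Lagrange's identity (b × y) · (c × y) = (b · c) |y|² - (b · y)(c · y), and |y|² is constant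
along the rotation u × y. -/
lemma dotDeriv_eq (y b c u : Fin 3 → ℝ) : dotDeriv y b c u =
    - ((b ⬝ᵥ crossProduct u y) * (c ⬝ᵥ y) + (b ⬝ᵥ y) * (c ⬝ᵥ crossProduct u y)) := by
  simp only [dotDeriv, dotProduct, Fin.sum_univ_three, cross_apply]
  simp
  ring

/-- Without curvature, the fibre form is parallel. -/
lemma fibreForm_parallel (y a α b β c γ δ κ : Fin 3 → ℝ) :
    2 * fibreFormDeriv y b c (a - α) + fibreKoszul y a α b β (crossProduct y c) δ 0 0 0 -
      fibreKoszul y a α c γ (crossProduct y b) κ 0 0 0 = 0 := by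
  simp only [fibreKoszul, dotDeriv_eq, fibreFormDeriv, dotProduct, Fin.sum_univ_three, cross_apply]
  simp
  ring

/-- The curvature enters additively, so it can be separated from the part that cancels in
`fibreForm_parallel`. -/
lemma fibreKoszul_eq (y a α b β c γ r₁ r₂ r₃ : Fin 3 → ℝ) :
    fibreKoszul y a α b β c γ r₁ r₂ r₃ = fibreKoszul y a α b β c γ 0 0 0 +
      crossProduct r₁ y ⬝ᵥ crossProduct c y - crossProduct r₂ y ⬝ᵥ crossProduct b y -
      crossProduct r₃ y ⬝ᵥ crossProduct a y := by
  simp only [fibreKoszul, map_add, map_sub, map_zero, LinearMap.add_apply, LinearMap.sub_apply,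
    LinearMap.zero_apply, add_dotProduct, sub_dotProduct, zero_dotProduct]
  ring

lemma cross_dot_eq (r y u : Fin 3 → ℝ) : crossProduct r y ⬝ᵥ u = r ⬝ᵥ crossProduct y u := by
  simp only [dotProduct, Fin.sum_univ_three, cross_apply]
  simp
  ring

/-- The constant c = y × u, frozen at σ, is the one for which the adapted field has vertical part u
at σ. -/
lemma cross_cross_unit {y u : Fin 3 → ℝ} (hy : y ⬝ᵥ y = 1) (hu : y ⬝ᵥ u = 0) :
    crossProduct (crossProduct y u) y = u := by
  simp only [dotProduct, Fin.sum_univ_three] at hy hu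
  ext k
  fin_cases k <;> simp [cross_apply]
  · linear_combination u 0 * hy - y 0 * hu
  · linear_combination u 1 * hy - y 1 * hu
  · linear_combination u 2 * hy - y 2 * hu

/-- The connection acts on Λ² by a skew derivation, so in the pairing with u ∧ v it can be moved
onto u and v. This produces the base terms of the Koszul formula. -/
lemma bivInner_connection {V : Type*} [NormedAddCommGroup V] [InnerProductSpace ℝ V]
    [FiniteDimensional ℝ V] [Fact (finrank ℝ V = 4)] (e : Fin 4 → V) (D : V →ₗ[ℝ] V)
    (hD : ∀ x y, ⟪D x, y⟫ = - ⟪x, D y⟫) (d y : Fin 3 → ℝ) (u v : V) :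
    2 * bivInner (∑ i, (d i • sdFrame e i + y i • (sdPair (fun a => D (e a)) e i +
      sdPair e (fun a => D (e a)) i))) (wedge u v) =
    2 * bivInner (sdComb e d) (wedge u v) - ⟪bivEndo (sdComb e y) (D u), v⟫ -
      ⟪bivEndo (sdComb e y) u, D v⟫ := by
  have h : ∀ i, bivInner (y i • (sdPair (fun a => D (e a)) e i +
      sdPair e (fun a => D (e a)) i)) (wedge u v) =
      - bivInner (y i • sdFrame e i) (wedge (D u) v + wedge u (D v)) := fun i => by
    rw [map_smul, LinearMap.smul_apply, bivInner_sdPair_deriv e D hD, map_smul,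
      LinearMap.smul_apply, smul_eq_mul, smul_eq_mul]
    ring
  rw [Finset.sum_add_distrib, map_add, LinearMap.add_apply, inner_bivEndo, inner_bivEndo,
    map_sum bivInner (fun i => y i • _), LinearMap.sum_apply]
  simp only [h, Finset.sum_neg_distrib]
  simp only [sdComb, map_sum, map_add, LinearMap.sum_apply, Finset.sum_add_distrib]
  ring

end FibreAlgebra

/-! ### The Koszul formula on the twistor space -/

section KoszulFormula
variable {M : Type*} [TopologicalSpace M] [ChartedSpace E4 M] [IsManifold I4 ∞ M]
  [RiemannianBundle (fun p : M => TangentSpace I4 p)]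
  [IsContMDiffRiemannianBundle I4 ∞ E4 (fun p : M => TangentSpace I4 p)]
  {o : ManifoldOrientation M}

lemma OrientedFrame.inner_basis_field (F : OrientedFrame o) (x : Fin 4 → ℝ) (q : M) (a : Fin 4) :
    ⟪F.basis q a, F.field x q⟫ = x a := by
  simp only [field, inner_sum, real_inner_smul_right, orthonormal_iff_ite.mp (F.basis q).orthonormal]
  simp

/-- Inner products of fields with constant frame components are constant, so the derivative terms of
the Koszul formula vanish and the brackets alone compute ∇. -/
lemma OrientedFrame.koszul_field (F : OrientedFrame o) {p : M} (h : p ∈ F.domain)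
    (x x' x'' : Fin 4 → ℝ) :
    ⟪VectorField.mlieBracket I4 (F.field x) (F.field x') p, F.field x'' p⟫ -
      ⟪VectorField.mlieBracket I4 (F.field x) (F.field x'') p, F.field x' p⟫ -
      ⟪VectorField.mlieBracket I4 (F.field x') (F.field x'') p, F.field x p⟫ =
    2 * ⟪F.conn (F.field x p) (F.field x' p), F.field x'' p⟫ := by
  have hG := isDiffMetric_baseMetric (M := M)
  have hX := fun x => (F.fieldC2At_field h x).fieldDiffAt
  have e := hG.leviCivita_spec (hX x) (hX x') (hX x'') rfl
  have hc : ∀ x x' : Fin 4 → ℝ, (fun q => baseMetric q (F.field x q) (F.field x' q)) =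
      fun _ => ∑ a, x a * x' a := fun x x' => funext fun q => F.inner_field x x' q
  rw [F.leviCivita_field h, koszul, hc, hc, hc, dirDeriv_const, dirDeriv_const,
    dirDeriv_const] at e
  simp only [baseMetric] at e
  rw [e]
  ring

namespace TwistorSpace
variable {F : OrientedFrame o} {σ τ : TwistorSpace o}

/-- The horizontal part of the inner product is constant. The vertical part changes only through y,
which is rotated by a - α. -/
lemma dirDeriv_metric_stdField (h : σ.base ∈ F.domain) (t : ℝ) (x x' x'' : Fin 4 → ℝ)
    (a b c : Fin 3 → ℝ) :
    dirDeriv (fun τ => metric t τ (stdField F x' b τ) (stdField F x'' c τ)) σ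
      (stdField F x a σ) =
      t * dotDeriv (coords F σ) b c (a - F.sdConn (F.field x σ.base)) := by
  have hy := fun i => funDiffAt_coord h i
  have hd : ∀ b : Fin 3 → ℝ, ∀ k, FunDiffAt (E := E4 × E2)
      (fun τ : TwistorSpace o => crossProduct b (coords F τ) k) σ := fun b =>
    funDiffAt_cross (u := fun _ => b) (fun _ => mdifferentiableAt_const) hy
  have hv : ∀ b : Fin 3 → ℝ, vecDeriv (fun τ : TwistorSpace o => crossProduct b (coords F τ)) σ
      (stdField F x a σ) = _ := fun b => vecDeriv_const_cross b hy (dCoord_stdField h x a)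
  have e : (fun τ => metric t τ (stdField F x' b τ) (stdField F x'' c τ)) =ᶠ[𝓝 σ]
      fun τ => ∑ i, x' i * x'' i +
        t * (crossProduct b (coords F τ) ⬝ᵥ crossProduct c (coords F τ)) := by
    filter_upwards [eventually_base_mem h] with τ hτ
    rw [metric_eq hτ, projDeriv_stdField, projDeriv_stdField, vertCoord_stdField hτ,
      vertCoord_stdField hτ, F.inner_field]
  have h1 := funDiffAt_dot (hd b) (hd c)
  rw [dirDeriv_congr e, dirDeriv_const_add_const_mul _ t h1, dirDeriv_dot (hd b) (hd c), hv b, hv c]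
  rfl

/-- The Koszul formula on the twistor space. -/
lemma koszul_stdField (hF : frameAt o σ.base = F) (t : ℝ) (x x' x'' : Fin 4 → ℝ)
    (a b c : Fin 3 → ℝ) :
    koszul (metric t) (stdField F x a) (stdField F x' b) (stdField F x'' c) σ =
      2 * ⟪F.conn (F.field x σ.base) (F.field x' σ.base), F.field x'' σ.base⟫ +
      t * fibreKoszul (coords F σ) a (F.sdConn (F.field x σ.base)) b
        (F.sdConn (F.field x' σ.base)) c (F.sdConn (F.field x'' σ.base))
        (curvCoord F σ.base x x') (curvCoord F σ.base x x'') (curvCoord F σ.base x' x'') := by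
  have h : σ.base ∈ F.domain := hF ▸ mem_frameAt_domain o σ.base
  have hb : ∀ (x x' x'' : Fin 4 → ℝ) (a b c : Fin 3 → ℝ),
      metric t σ (VectorField.mlieBracket I6 (stdField F x a) (stdField F x' b) σ)
        (stdField F x'' c σ) =
      ⟪VectorField.mlieBracket I4 (F.field x) (F.field x') σ.base, F.field x'' σ.base⟫ +
      t * (crossProduct (curvCoord F σ.base x x' + crossProduct a (F.sdConn (F.field x' σ.base)) +
        crossProduct (F.sdConn (F.field x σ.base)) b - crossProduct a b) (coords F σ) ⬝ᵥ
        crossProduct c (coords F σ)) := fun x x' x'' a b c => by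
    rw [metric_eq h, vertCoord_mlieBracket_stdField hF, vertCoord_stdField h, projDeriv_stdField,
      projDeriv_mlieBracket (fieldDiffAt_stdField hF x a) (fieldDiffAt_stdField hF x' b)
        (F.fieldC2At_field h x).fieldDiffAt (F.fieldC2At_field h x').fieldDiffAt
        (projDeriv_stdField x a) (projDeriv_stdField x' b)]
  rw [koszul, dirDeriv_metric_stdField h, dirDeriv_metric_stdField h, dirDeriv_metric_stdField h,
    hb, hb, hb, ← F.koszul_field h, fibreKoszul]
  ring

end TwistorSpace

end KoszulFormula

section FibreAlgebra

lemma two_mul_bivInner_connection {V : Type*} [NormedAddCommGroup V] [InnerProductSpace ℝ V]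
    [FiniteDimensional ℝ V] [Fact (finrank ℝ V = 4)] (e : Fin 4 → V) (D : V →ₗ[ℝ] V)
    (hD : ∀ x y, ⟪D x, y⟫ = - ⟪x, D y⟫) (d y : Fin 3 → ℝ) (u v : V) {r s : ⋀[ℝ]^2 V}
    (hr : r = ∑ i, (d i • sdFrame e i + y i • (sdPair (fun a => D (e a)) e i +
      sdPair e (fun a => D (e a)) i))) (hs : s = sdComb e y) :
    2 * bivInner r (wedge u v) = 2 * bivInner (sdComb e d) (wedge u v) - ⟪bivEndo s (D u), v⟫ -
      ⟪bivEndo s u, D v⟫ := by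
  subst hr hs
  exact bivInner_connection e D hD d y u v

lemma bivInner_sdComb_right {V : Type*} [NormedAddCommGroup V] [InnerProductSpace ℝ V]
    (e : Fin 4 → V) (w : Fin 3 → ℝ) (r : ⋀[ℝ]^2 V) :
    bivInner r (sdComb e w) = (fun k => bivInner r (sdFrame e k)) ⬝ᵥ w := by
  simp only [sdComb, map_sum, map_smul, smul_eq_mul, dotProduct, mul_comm]

/-- The fibre part of the covariant derivative of the Kähler form. -/
lemma fibreForm_add_fibreKoszul {y u v w : Fin 3 → ℝ} (hy : y ⬝ᵥ y = 1) (hu : y ⬝ᵥ u = 0)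
    (hv : y ⬝ᵥ v = 0) (hw : y ⬝ᵥ w = 0) (α β γ δ κ r₁ r₂ r₃ s₁ s₂ s₃ : Fin 3 → ℝ) :
    2 * fibreFormDeriv y (crossProduct y v) (crossProduct y w) (crossProduct y u - α) +
      fibreKoszul y (crossProduct y u) α (crossProduct y v) β
        (crossProduct y (crossProduct y w)) δ r₁ r₂ r₃ -
      fibreKoszul y (crossProduct y u) α (crossProduct y w) γ
        (crossProduct y (crossProduct y v)) κ s₁ s₂ s₃ =
    - (r₁ ⬝ᵥ w) - r₂ ⬝ᵥ crossProduct y v - r₃ ⬝ᵥ crossProduct y u + s₁ ⬝ᵥ v +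
      s₂ ⬝ᵥ crossProduct y w + s₃ ⬝ᵥ crossProduct y u := by
  have h2 : ∀ u : Fin 3 → ℝ, y ⬝ᵥ u = 0 → crossProduct y (crossProduct y u) = - u := fun u hu => by
    rw [← cross_anticomm, cross_cross_unit hy hu]
  have h3 : ∀ u : Fin 3 → ℝ, y ⬝ᵥ u = 0 → crossProduct y (crossProduct u y) = u := fun u hu => by
    rw [← neg_neg (crossProduct u y), cross_anticomm, map_neg, h2 u hu, neg_neg]
  -- The identity holds for all values of the connection form, so α, β, γ, δ, κ drop out. The six
  -- curvature terms reduce by (y × u) × y = u and y × (y × u) = -u.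
  have h := fibreForm_parallel y (crossProduct y u) α (crossProduct y v) β (crossProduct y w) γ δ κ
  rw [fibreKoszul_eq, fibreKoszul_eq (r₁ := s₁)]
  simp only [cross_dot_eq, cross_cross_unit hy hu, cross_cross_unit hy hv, cross_cross_unit hy hw,
    h2 v hv, h2 w hw, h3 v hv, h3 w hw, map_neg, LinearMap.neg_apply, dotProduct_neg] at h ⊢
  linear_combination h

end FibreAlgebra

section
variable {E : Type*} [NormedAddCommGroup E] [NormedSpace ℝ E]
  {N : Type*} [TopologicalSpace N] [ChartedSpace E N] {x : N}

lemma dirDeriv_sum_mul_const_add_dot {z : Fin 3 → N → ℝ} {m : Fin 3 → ℝ} {u v w : N → Fin 3 → ℝ}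
    (t : ℝ) (hz : ∀ k, FunDiffAt (E := E) (z k) x) (hu : ∀ k, FunDiffAt (E := E) (fun q => u q k) x)
    (hv : ∀ k, FunDiffAt (E := E) (fun q => v q k) x)
    (hw : ∀ k, FunDiffAt (E := E) (fun q => w q k) x) (A : TangentSpace 𝓘(ℝ, E) x)
    {u' v' w' : Fin 3 → ℝ} (hu' : vecDeriv u x A = u') (hv' : vecDeriv v x A = v')
    (hw' : vecDeriv w x A = w') :
    dirDeriv (fun q => (∑ k, z k q * m k) + t * (crossProduct (u q) (v q) ⬝ᵥ w q)) x A =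
      (∑ k, dirDeriv (z k) x A * m k) +
        t * ((crossProduct u' (v x) + crossProduct (u x) v') ⬝ᵥ w x +
          crossProduct (u x) (v x) ⬝ᵥ w') := by
  subst hu' hv' hw'
  have huv : ∀ k, FunDiffAt (E := E) (fun q => crossProduct (u q) (v q) k) x :=
    funDiffAt_cross hu hv
  have h0 := dirDeriv_sum (x := x) Finset.univ (f := fun k q => z k q * m k)
    (fun k _ => (hz k).mul mdifferentiableAt_const) A
  rw [dirDeriv_add_const_mul t h0.1 (funDiffAt_dot huv hw), h0.2, dirDeriv_dot huv hw,
    vecDeriv_cross hu hv]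
  refine congrArg (· + _) (Finset.sum_congr rfl fun k _ => ?_)
  rw [dirDeriv_mul (hz k) mdifferentiableAt_const, dirDeriv_const, mul_zero, zero_add, mul_comm]

end

/-! ### The derivative of the Kähler form on adapted fields -/

section KaehlerForm
variable {M : Type*} [TopologicalSpace M] [ChartedSpace E4 M] [IsManifold I4 ∞ M]
  [RiemannianBundle (fun p : M => TangentSpace I4 p)]
  [IsContMDiffRiemannianBundle I4 ∞ E4 (fun p : M => TangentSpace I4 p)]
  {o : ManifoldOrientation M}

namespace TwistorSpace
variable {F : OrientedFrame o} {σ : TwistorSpace o}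
  {f : ∀ p : M, TwistorFiber (o.orient p) → TwistorFiber (o.orient p)}

/-- The derivatives of the fibre coordinates of `f`. -/
def dCoordMap (F : OrientedFrame o)
    (f : ∀ p : M, TwistorFiber (o.orient p) → TwistorFiber (o.orient p)) (σ : TwistorSpace o)
    (A : TangentSpace I6 σ) : Fin 3 → ℝ :=
  fun i => dirDeriv (fun τ => coord F i (fibreMap f τ)) σ A

lemma projDeriv_mfderiv_fibreMap (hf : ContMDiff I6 I6 ∞ (fibreMap f)) (A : TangentSpace I6 σ) :
    projDeriv (fibreMap f σ) (mfderiv I6 I6 (fibreMap f) σ A) = σ.projDeriv A := by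
  have h : mfderiv I6 I4 (TwistorSpace.base (o := o) ∘ fibreMap f) σ = _ :=
    mfderiv_comp σ (mdifferentiable_base (fibreMap f σ)) (hf.mdifferentiable (by simp) σ)
  exact (congrArg (fun L => L A) h).symm

lemma dCoord_mfderiv_fibreMap (hf : ContMDiff I6 I6 ∞ (fibreMap f)) (h : σ.base ∈ F.domain)
    (A : TangentSpace I6 σ) :
    dCoord F (fibreMap f σ) (mfderiv I6 I6 (fibreMap f) σ A) = dCoordMap F f σ A := by
  funext i
  have h : mfderiv I6 𝓘(ℝ, ℝ) (coord F i ∘ fibreMap f) σ = _ :=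
    mfderiv_comp σ (funDiffAt_coord (σ := fibreMap f σ) h i) (hf.mdifferentiable (by simp) σ)
  exact (congrArg (fun L => L A) h).symm

/-- To be applied at the point f(σ) with B = f_* A, where it converts the derivatives of the
coordinates of f into the vertical part of f_* A. -/
lemma two_mul_bivInner_vertPart (h : σ.base ∈ F.domain) {B : TangentSpace I6 σ} {d : Fin 3 → ℝ}
    {X : TangentSpace I4 σ.base} (hd : dCoord F σ B = d) (hX : σ.projDeriv B = X)
    (Y Z : TangentSpace I4 σ.base) :
    2 * bivInner (σ.vertPart B) (wedge Y Z) =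
      2 * bivInner (sdComb (F.basis σ.base) d) (wedge Y Z) -
      ⟪bivEndo σ.fiber.vec (F.conn X Y), Z⟫ - ⟪bivEndo σ.fiber.vec Y, F.conn X Z⟫ := by
  subst hd hX
  refine two_mul_bivInner_connection (F.basis σ.base) (F.conn (σ.projDeriv B)) (F.conn_skew h _)
    (dCoord F σ B) (coords F σ) Y Z ?_ (fiber_vec_eq F σ)
  refine (vertPart_eq h _).trans ((sdComb_vertCoord h _).trans ?_)
  exact Finset.sum_congr rfl fun i _ => congrArg (_ + coord F i σ • ·) (F.nablaSdFrame_eq _ i)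

/-- The components of `2 g(s_k, x' ∧ x'')` for vectors with components `x'`, `x''`. -/
def sdWedge (x' x'' : Fin 4 → ℝ) (k : Fin 3) : ℝ :=
  ∑ i, ∑ j, sdMatrix (Pi.single k 1) i j * (x' i * x'' j)

lemma inner_bivEndo_field (F : OrientedFrame o) (q : M) (x' x'' : Fin 4 → ℝ) (z : Fin 3 → ℝ)
    {s : ⋀[ℝ]^2 (TangentSpace I4 q)} (hs : s = sdComb (F.basis q) z) :
    ⟪bivEndo s (F.field x' q), F.field x'' q⟫ = ∑ k, z k * sdWedge x' x'' k := by
  subst hs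
  refine (inner_bivEndo_sdComb _ _ _ _).trans ?_
  simp only [F.inner_basis_field, sdWedge]

/-- On adapted fields the horizontal part of Ω is a combination of the coordinates of f(σ) with
constant coefficients, so its derivative sees only f. -/
lemma kaehlerForm_stdField (h : σ.base ∈ F.domain) (t : ℝ) (x' x'' : Fin 4 → ℝ)
    (b c : Fin 3 → ℝ) :
    kaehlerForm f t σ (stdField F x' b σ) (stdField F x'' c σ) =
      (∑ k, coord F k (fibreMap f σ) * sdWedge x' x'' k) +
      t * (crossProduct (coords F σ) (crossProduct b (coords F σ)) ⬝ᵥ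
          crossProduct c (coords F σ)) := by
  rw [kaehlerForm_eq h, projDeriv_stdField, projDeriv_stdField, vertCoord_stdField h,
    vertCoord_stdField h]
  exact congrArg (· + _) (inner_bivEndo_field F σ.base x' x'' (coords F (fibreMap f σ))
    (fiber_vec_eq F (fibreMap f σ)))

lemma dirDeriv_kaehlerForm_stdField (hf : ContMDiff I6 I6 ∞ (fibreMap f)) (h : σ.base ∈ F.domain)
    (t : ℝ) (x x' x'' : Fin 4 → ℝ) (a b c : Fin 3 → ℝ) :
    dirDeriv (fun τ => kaehlerForm f t τ (stdField F x' b τ) (stdField F x'' c τ)) σ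
      (stdField F x a σ) =
      2 * bivInner (sdComb (F.basis σ.base) (dCoordMap F f σ (stdField F x a σ)))
        (wedge (F.field x' σ.base) (F.field x'' σ.base)) +
      t * fibreFormDeriv (coords F σ) b c (a - F.sdConn (F.field x σ.base)) := by
  have hy := fun i => funDiffAt_coord h i
  have hd : ∀ b : Fin 3 → ℝ, ∀ k, FunDiffAt (E := E4 × E2)
      (fun τ : TwistorSpace o => crossProduct b (coords F τ) k) σ := fun b =>
    funDiffAt_cross (u := fun _ => b) (fun _ => mdifferentiableAt_const) hy
  have hv : ∀ b : Fin 3 → ℝ, vecDeriv (fun τ : TwistorSpace o => crossProduct b (coords F τ)) σ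
      (stdField F x a σ) = _ := fun b => vecDeriv_const_cross b hy (dCoord_stdField h x a)
  have e := ((inner_bivEndo _ _ _).symm.trans
    (inner_bivEndo_field F σ.base x' x'' (dCoordMap F f σ (stdField F x a σ)) rfl))
  rw [e]
  refine (dirDeriv_congr ((eventually_base_mem h).mono fun τ hτ =>
    kaehlerForm_stdField hτ t x' x'' b c) _).trans ?_
  refine (dirDeriv_sum_mul_const_add_dot t (fun k => funDiffAt_coord_fibreMap hf h k) hy
    (hd b) (hd c) _ (dCoord_stdField h x a) (hv b) (hv c)).trans ?_
  rfl

lemma bivInner_baseCurvatureOperator_eq_dot (F : OrientedFrame o) {p : M} {x x' : Fin 4 → ℝ}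
    {X X' : TangentSpace I4 p} (hX : F.field x p = X) (hX' : F.field x' p = X') {w : Fin 3 → ℝ}
    {a : ⋀[ℝ]^2 (TangentSpace I4 p)} (ha : a = sdComb (F.basis p) w) :
    bivInner (baseCurvatureOperator p a) (wedge X X') = curvCoord F p x x' ⬝ᵥ w := by
  subst hX hX' ha
  exact (bivInner_baseCurvatureOperator_comm o _ _).trans (bivInner_sdComb_right _ _ _)

/-- The fields carrying the values 𝒥C and 𝒥B at σ are again adapted, so both Koszul expressions are
covered by `koszul_stdField`. -/
lemma two_mul_kaehlerFormDeriv_stdField (hf : ContMDiff I6 I6 ∞ (fibreMap f)) {t : ℝ} (ht : 0 < t)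
    (hF : frameAt o σ.base = F) {x x' x'' p q : Fin 4 → ℝ} {a b c b' c' : Fin 3 → ℝ}
    (hP : stdField F p c' σ = almostComplex f σ (stdField F x'' c σ))
    (hQ : stdField F q b' σ = almostComplex f σ (stdField F x' b σ)) :
    2 * kaehlerFormDeriv f t σ (stdField F x a σ) (stdField F x' b σ) (stdField F x'' c σ) =
      2 * dirDeriv (fun τ => kaehlerForm f t τ (stdField F x' b τ) (stdField F x'' c τ)) σ
        (stdField F x a σ) +
      koszul (metric t) (stdField F x a) (stdField F x' b) (stdField F p c') σ -
      koszul (metric t) (stdField F x a) (stdField F x'' c) (stdField F q b') σ := by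
  have hG := isDiffMetric_metric (o := o) ht
  exact hG.two_mul_covDerivTwoForm (isDiffBilinear_kaehlerForm hf ht)
    (fieldDiffAt_stdField hF x a) (fieldDiffAt_stdField hF x' b) (fieldDiffAt_stdField hF x'' c)
    (fieldDiffAt_stdField hF p c') (fieldDiffAt_stdField hF q b')
    (fun u => (kaehlerForm_eq_neg t u _).trans (congrArg (fun P => - metric t σ u P) hP.symm))
    (fun u => (hG.symm _ _ _).trans (congrArg (fun P => metric t σ u P) hQ.symm))

/-- The covariant derivative of the Kähler form in the components of a frame. -/
lemma kaehlerFormDeriv_eq_of_components (hf : ContMDiff I6 I6 ∞ (fibreMap f)) {t : ℝ} (ht : 0 < t)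
    (hF : frameAt o σ.base = F) {A B C : TangentSpace I6 σ} {x x' x'' p q : Fin 4 → ℝ}
    {u v w : Fin 3 → ℝ} (hu : coords F σ ⬝ᵥ u = 0) (hv : coords F σ ⬝ᵥ v = 0)
    (hw : coords F σ ⬝ᵥ w = 0) (hA : stdField F x (crossProduct (coords F σ) u) σ = A)
    (hB : stdField F x' (crossProduct (coords F σ) v) σ = B)
    (hC : stdField F x'' (crossProduct (coords F σ) w) σ = C)
    (hP : stdField F p (crossProduct (coords F σ) (crossProduct (coords F σ) w)) σ =
      almostComplex f σ C)
    (hQ : stdField F q (crossProduct (coords F σ) (crossProduct (coords F σ) v)) σ =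
      almostComplex f σ B) :
    kaehlerFormDeriv f t σ A B C =
      2 * bivInner (σ.vertPush f A) (wedge (F.field x' σ.base) (F.field x'' σ.base)) + t / 2 * (
        - (curvCoord F σ.base x x' ⬝ᵥ w) + curvCoord F σ.base x x'' ⬝ᵥ v -
        curvCoord F σ.base x p ⬝ᵥ crossProduct (coords F σ) v +
        curvCoord F σ.base x q ⬝ᵥ crossProduct (coords F σ) w -
        curvCoord F σ.base x' p ⬝ᵥ crossProduct (coords F σ) u +
        curvCoord F σ.base x'' q ⬝ᵥ crossProduct (coords F σ) u) := by
  subst hA hB hC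
  have h : σ.base ∈ F.domain := hF ▸ mem_frameAt_domain o σ.base
  have key := two_mul_kaehlerFormDeriv_stdField hf ht hF hP hQ
    (x := x) (a := crossProduct (coords F σ) u)
  have hPp : F.field p σ.base = bivEndo (f σ.base σ.fiber).vec (F.field x'' σ.base) :=
    (projDeriv_stdField _ _ σ).symm.trans ((congrArg σ.projDeriv hP).trans
      ((projDeriv_almostComplex _).trans (congrArg (bivEndo _) (projDeriv_stdField _ _ σ))))
  have hQq : F.field q σ.base = bivEndo (f σ.base σ.fiber).vec (F.field x' σ.base) :=
    (projDeriv_stdField _ _ σ).symm.trans ((congrArg σ.projDeriv hQ).trans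
      ((projDeriv_almostComplex _).trans (congrArg (bivEndo _) (projDeriv_stdField _ _ σ))))
  -- Since π ∘ f = π, the image f_* A has the same projection as A; only its fibre derivatives come
  -- from f.
  have e1 : 2 * bivInner (σ.vertPush f (stdField F x (crossProduct (coords F σ) u) σ))
      (wedge (F.field x' σ.base) (F.field x'' σ.base)) = _ :=
    two_mul_bivInner_vertPart (σ := fibreMap f σ) h (dCoord_mfderiv_fibreMap hf h _)
      ((projDeriv_mfderiv_fibreMap hf _).trans (projDeriv_stdField _ _ _)) _ _
  have e2 := fibreForm_add_fibreKoszul (coords_dot_self F σ) hu hv hw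
    (F.sdConn (F.field x σ.base)) (F.sdConn (F.field x' σ.base)) (F.sdConn (F.field x'' σ.base))
    (F.sdConn (F.field p σ.base)) (F.sdConn (F.field q σ.base)) (curvCoord F σ.base x x')
    (curvCoord F σ.base x p) (curvCoord F σ.base x' p) (curvCoord F σ.base x x'')
    (curvCoord F σ.base x q) (curvCoord F σ.base x'' q)
  have e3 : ∀ X Y : TangentSpace I4 σ.base, ⟪X, bivEndo (f σ.base σ.fiber).vec Y⟫ = _ :=
    fun X Y => neg_eq_iff_eq_neg.mp (inner_bivEndo_swap (f σ.base σ.fiber).vec X Y).symm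
  have e4 := (congrArg (fun P => ⟪F.conn (F.field x σ.base) (F.field x' σ.base), P⟫) hPp).trans
    (e3 _ _)
  have e5 := ((congrArg (fun P => ⟪F.conn (F.field x σ.base) (F.field x'' σ.base), P⟫) hQq).trans
    (real_inner_comm _ _))
  rw [dirDeriv_kaehlerForm_stdField hf h, koszul_stdField hF, koszul_stdField hF] at key
  -- The base parts g(∇_X Y, K Z) and -g(∇_X Z, K Y) become -g(K ∇_X Y, Z) and -g(K Y, ∇_X Z),
  -- exactly the connection terms of 2 g(𝒱 f_* A, Y ∧ Z).
  linear_combination key / 2 + t / 2 * e2 - e1 + e4 - e5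

end TwistorSpace

end KaehlerForm

section
variable {V : Type*} [NormedAddCommGroup V] [InnerProductSpace ℝ V]

lemma cross_zero [Fact (finrank ℝ V = 4)] (o : Orientation ℝ V (Fin 4)) (a : ⋀[ℝ]^2 V) : cross o a 0 = 0 := by
  have h : (fun i => bivInner (0 : ⋀[ℝ]^2 V) (sdFrame (orientedBasis o) i)) = 0 :=
    funext fun i => by simp
  refine Finset.sum_eq_zero fun k _ => ?_
  rw [h, map_zero, Pi.zero_apply, zero_smul]

lemma bivEndo_zero [FiniteDimensional ℝ V] (a : ⋀[ℝ]^2 V) : bivEndo a 0 = 0 := (bivEndoₗ a).map_zero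

lemma bivInner_wedge_zero_left (r : ⋀[ℝ]^2 V) (y : V) : bivInner r (wedge 0 y) = 0 :=
  (congrArg (bivInner r) (wedgeₗ.map_zero₂ y)).trans (map_zero _)

lemma bivInner_wedge_zero_right (r : ⋀[ℝ]^2 V) (x : V) : bivInner r (wedge x 0) = 0 :=
  (congrArg (bivInner r) ((wedgeₗ x).map_zero)).trans (map_zero _)

end

/-! ### The general formula and its degenerate cases -/

section KaehlerFormDerivative
variable {M : Type*} [TopologicalSpace M] [ChartedSpace E4 M] [IsManifold I4 ∞ M]
  [RiemannianBundle (fun p : M => TangentSpace I4 p)]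
  [IsContMDiffRiemannianBundle I4 ∞ E4 (fun p : M => TangentSpace I4 p)]
  {o : ManifoldOrientation M}

/-- The pairing `g(ℛ(a), X ∧ Y)`. -/
def curvPairing (p : M) (a : ⋀[ℝ]^2 (TangentSpace I4 p)) (X Y : TangentSpace I4 p) : ℝ :=
  bivInner (baseCurvatureOperator p a) (wedge X Y)

namespace TwistorSpace
variable {F : OrientedFrame o} {σ : TwistorSpace o}
  {f : ∀ p : M, TwistorFiber (o.orient p) → TwistorFiber (o.orient p)}

/-- The witnesses are the frame components of π_* A and the constant y × v, where v is the vertical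
part; since v is orthogonal to y, (y × v) × y = v. -/
lemma stdField_components (h : σ.base ∈ F.domain) (A : TangentSpace I6 σ) :
    stdField F (fun i => ⟪F.basis σ.base i, σ.projDeriv A⟫)
      (crossProduct (coords F σ) (vertCoord F σ A)) σ = A :=
  eq_of_projDeriv_vertCoord h ((projDeriv_stdField _ _ σ).trans (F.field_inner _))
    ((vertCoord_stdField h _ _).trans
      (cross_cross_unit (coords_dot_self F σ) (coords_dot_vertCoord h A)))

lemma stdField_components_almostComplex (h : σ.base ∈ F.domain) (A : TangentSpace I6 σ) :
    stdField F (fun i => ⟪F.basis σ.base i, bivEndo (f σ.base σ.fiber).vec (σ.projDeriv A)⟫)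
      (crossProduct (coords F σ) (crossProduct (coords F σ) (vertCoord F σ A))) σ =
      almostComplex f σ A :=
  eq_of_projDeriv_vertCoord h
    ((projDeriv_stdField _ _ σ).trans ((F.field_inner _).trans (projDeriv_almostComplex A).symm))
    ((vertCoord_stdField h _ _).trans ((cross_cross_unit (coords_dot_self F σ)
      (dot_cross_left _ _)).trans (vertCoord_almostComplex h A).symm))

/-- The covariant derivative of the Kähler form on arbitrary tangent vectors. -/
theorem kaehlerFormDeriv_eq (hf : ContMDiff I6 I6 ∞ (fibreMap f)) {t : ℝ} (ht : 0 < t)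
    {A B C : TangentSpace I6 σ} {X Y Z : TangentSpace I4 σ.base}
    {U V W : ⋀[ℝ]^2 (TangentSpace I4 σ.base)}
    (hA : σ.projDeriv A = X ∧ σ.vertPart A = U) (hB : σ.projDeriv B = Y ∧ σ.vertPart B = V)
    (hC : σ.projDeriv C = Z ∧ σ.vertPart C = W) :
    kaehlerFormDeriv f t σ A B C = 2 * bivInner (σ.vertPush f A) (wedge Y Z) + t / 2 * (
      - curvPairing σ.base W X Y + curvPairing σ.base V X Z -
      curvPairing σ.base (cross (o.orient σ.base) σ.fiber.vec V) X
        (bivEndo (f σ.base σ.fiber).vec Z) +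
      curvPairing σ.base (cross (o.orient σ.base) σ.fiber.vec W) X
        (bivEndo (f σ.base σ.fiber).vec Y) -
      curvPairing σ.base (cross (o.orient σ.base) σ.fiber.vec U) Y
        (bivEndo (f σ.base σ.fiber).vec Z) +
      curvPairing σ.base (cross (o.orient σ.base) σ.fiber.vec U) Z
        (bivEndo (f σ.base σ.fiber).vec Y)) := by
  obtain ⟨rfl, rfl⟩ := hA
  obtain ⟨rfl, rfl⟩ := hB
  obtain ⟨rfl, rfl⟩ := hC
  -- The frame of the preferred chart at σ is named once, so that it stays fixed while the point
  -- varies near σ.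
  obtain ⟨F, hF⟩ : ∃ F, frameAt o σ.base = F := ⟨_, rfl⟩
  have h : σ.base ∈ F.domain := hF ▸ mem_frameAt_domain o σ.base
  have e := kaehlerFormDeriv_eq_of_components hf ht hF (coords_dot_vertCoord h A)
    (coords_dot_vertCoord h B) (coords_dot_vertCoord h C) (stdField_components h A)
    (stdField_components h B) (stdField_components h C)
    (stdField_components_almostComplex (f := f) h C)
    (stdField_components_almostComplex (f := f) h B)
  have r : ∀ (D : TangentSpace I6 σ) (X X' : TangentSpace I4 σ.base),
      curvPairing σ.base (σ.vertPart D) X X' = curvCoord F σ.base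
        (fun i => ⟪F.basis σ.base i, X⟫) (fun i => ⟪F.basis σ.base i, X'⟫) ⬝ᵥ vertCoord F σ D :=
    fun D X X' => bivInner_baseCurvatureOperator_eq_dot F (F.field_inner X) (F.field_inner X')
      (vertPart_eq h D)
  have r' : ∀ (D : TangentSpace I6 σ) (X X' : TangentSpace I4 σ.base),
      curvPairing σ.base (cross (o.orient σ.base) σ.fiber.vec (σ.vertPart D)) X X' =
        curvCoord F σ.base (fun i => ⟪F.basis σ.base i, X⟫) (fun i => ⟪F.basis σ.base i, X'⟫) ⬝ᵥ
          crossProduct (coords F σ) (vertCoord F σ D) :=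
    fun D X X' => bivInner_baseCurvatureOperator_eq_dot F (F.field_inner X) (F.field_inner X')
      (cross_vertPart h D)
  have w : bivInner (σ.vertPush f A) (wedge (F.field _ σ.base) (F.field _ σ.base)) =
      bivInner (σ.vertPush f A) (wedge (σ.projDeriv B) (σ.projDeriv C)) :=
    bivInner_congr rfl (congrArg₂ wedge (F.field_inner _) (F.field_inner _))
  refine e.trans (congrArg₂ (· + ·) (congrArg (2 * ·) w) (congrArg (t / 2 * ·) ?_))
  exact congrArg₂ (· + ·) (congrArg₂ (· - ·) (congrArg₂ (· + ·) (congrArg₂ (· - ·)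
    (congrArg₂ (· + ·) (congrArg (- ·) (r C _ _).symm) (r B _ _).symm) (r' B _ _).symm)
    (r' C _ _).symm) (r' A _ _).symm) (r' A _ _).symm

end TwistorSpace

section Degenerate

/-- Selfadjointness of ℛ moves the zero to the second slot of the inner product, where linearity
applies directly. -/
lemma curvPairing_zero_left (o : ManifoldOrientation M) (p : M) (X Y : TangentSpace I4 p) :
    curvPairing p 0 X Y = 0 :=
  (bivInner_baseCurvatureOperator_comm o _ _).trans (map_zero _)

lemma curvPairing_zero_middle (p : M) (a : ⋀[ℝ]^2 (TangentSpace I4 p)) (Y : TangentSpace I4 p) :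
    curvPairing p a 0 Y = 0 := bivInner_wedge_zero_left _ Y

lemma curvPairing_zero_right (p : M) (a : ⋀[ℝ]^2 (TangentSpace I4 p)) (X : TangentSpace I4 p) :
    curvPairing p a X 0 = 0 := bivInner_wedge_zero_right _ X

lemma curvPairing_bivEndo_zero (p : M) (a s : ⋀[ℝ]^2 (TangentSpace I4 p))
    (X : TangentSpace I4 p) : curvPairing p a X (bivEndo s 0) = 0 :=
  (congrArg (curvPairing p a X) (bivEndo_zero s)).trans (curvPairing_zero_right p a X)

lemma curvPairing_cross_zero (o : ManifoldOrientation M) (p : M) (s : ⋀[ℝ]^2 (TangentSpace I4 p))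
    (X Y : TangentSpace I4 p) : curvPairing p (cross (o.orient p) s 0) X Y = 0 :=
  (congrArg (fun a => curvPairing p a X Y) (cross_zero (o.orient p) s)).trans
    (curvPairing_zero_left o p X Y)

/-- It matches the sum Y ∧ K Z + K Y ∧ Z of the third formula with the difference of two pairings in
the general one. -/
lemma curvPairing_sub_swap (p : M) (a : ⋀[ℝ]^2 (TangentSpace I4 p))
    (X Y X' Y' : TangentSpace I4 p) :
    bivInner (baseCurvatureOperator p a) (wedge X Y + wedge X' Y') =
      curvPairing p a X Y - curvPairing p a Y' X' :=
  (map_add _ _ _).trans ((congrArg (bivInner (baseCurvatureOperator p a) (wedge X Y) + ·)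
    ((congrArg (bivInner (baseCurvatureOperator p a)) (wedge_swap X' Y')).trans
      (map_neg _ _))).trans (sub_eq_add_neg _ _).symm)

end Degenerate

namespace TwistorSpace
variable {σ : TwistorSpace o}

lemma hLift_spec (X : TangentSpace I4 σ.base) :
    σ.projDeriv (σ.hLift X) = X ∧ σ.vertPart (σ.hLift X) = 0 :=
  lift_spec X ⟨map_zero _, map_zero _⟩

lemma vLift_spec {U : ⋀[ℝ]^2 (TangentSpace I4 σ.base)} (hU : σ.IsVertical U) :
    σ.projDeriv (σ.vLift U) = 0 ∧ σ.vertPart (σ.vLift U) = U :=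
  lift_spec 0 hU

end TwistorSpace

end KaehlerFormDerivative

end TwistorGeometry

end

theorem mainTheorem3
    {M : Type*} [TopologicalSpace M] [ChartedSpace E4 M] [IsManifold I4 ∞ M]
    [RiemannianBundle (fun p : M => TangentSpace I4 p)]
    [IsContMDiffRiemannianBundle I4 ∞ E4 (fun p : M => TangentSpace I4 p)]
    (o : ManifoldOrientation M) (t : ℝ) (ht : 0 < t)
    (f : ∀ p : M, TwistorFiber (o.orient p) → TwistorFiber (o.orient p))
    (hf : ContMDiff I6 I6 ∞ (TwistorSpace.fibreMap f))
    (σ : TwistorSpace o) (X Y Z : TangentSpace I4 σ.base)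
    (U V W : ⋀[ℝ]^2 (TangentSpace I4 σ.base))
    (hU : σ.IsVertical U) (hV : σ.IsVertical V) (hW : σ.IsVertical W) :
    σ.kaehlerFormDeriv f t (σ.hLift X) (σ.hLift Y) (σ.hLift Z)
        = 2 * bivInner (σ.vertPush f (σ.hLift X)) (wedge Y Z) ∧
    σ.kaehlerFormDeriv f t (σ.hLift X) (σ.hLift Y) (σ.vLift U)
        = - (t / 2) * bivInner (baseCurvatureOperator σ.base U) (wedge X Y)
          + t / 2 * bivInner
              (baseCurvatureOperator σ.base (cross (o.orient σ.base) σ.fiber.vec U))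
              (wedge X (bivEndo (f σ.base σ.fiber).vec Y)) ∧
    σ.kaehlerFormDeriv f t (σ.vLift U) (σ.hLift Y) (σ.hLift Z)
        = - (t / 2) * bivInner
              (baseCurvatureOperator σ.base (cross (o.orient σ.base) σ.fiber.vec U))
              (wedge Y (bivEndo (f σ.base σ.fiber).vec Z)
                + wedge (bivEndo (f σ.base σ.fiber).vec Y) Z)
          + 2 * bivInner (σ.vertPush f (σ.vLift U)) (wedge Y Z) ∧
    σ.kaehlerFormDeriv f t (σ.hLift X) (σ.vLift U) (σ.vLift V) = 0 ∧
    σ.kaehlerFormDeriv f t (σ.vLift U) (σ.hLift Y) (σ.vLift V) = 0 ∧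
    σ.kaehlerFormDeriv f t (σ.vLift U) (σ.vLift V) (σ.vLift W) = 0 := by
  have hX := TwistorSpace.hLift_spec X
  have hY := TwistorSpace.hLift_spec Y
  have hZ := TwistorSpace.hLift_spec Z
  have hU := TwistorSpace.vLift_spec hU
  have hV := TwistorSpace.vLift_spec hV
  have hW := TwistorSpace.vLift_spec hW
  have l := fun X Y => curvPairing_zero_left o σ.base X Y
  have c := fun s X Y => curvPairing_cross_zero o σ.base s X Y
  -- A horizontal lift has zero vertical part and a vertical lift has zero projection; every term of
  -- the general formula that contains such a zero drops out.
  refine ⟨?_, ?_, ?_, ?_, ?_, ?_⟩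
  · have e := TwistorSpace.kaehlerFormDeriv_eq hf ht hX hY hZ
    simp only [l, c] at e
    rw [e]
    ring
  · have e := TwistorSpace.kaehlerFormDeriv_eq hf ht hX hY hU
    simp only [l, c, bivInner_wedge_zero_right] at e
    rw [e]
    simp only [curvPairing]
    ring
  · have e := TwistorSpace.kaehlerFormDeriv_eq hf ht hU hY hZ
    simp only [l, c] at e
    simp only [curvPairing_sub_swap]
    rw [e]
    ring
  · have e := TwistorSpace.kaehlerFormDeriv_eq hf ht hX hU hV
    simp only [c, bivInner_wedge_zero_right, curvPairing_zero_right, curvPairing_bivEndo_zero] at e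
    rw [e]
    ring
  · have e := TwistorSpace.kaehlerFormDeriv_eq hf ht hU hY hV
    simp only [l, c, bivInner_wedge_zero_right, curvPairing_zero_middle, curvPairing_bivEndo_zero] at e
    rw [e]
    ring
  · have e := TwistorSpace.kaehlerFormDeriv_eq hf ht hU hV hW
    simp only [bivInner_wedge_zero_right, curvPairing_zero_right, curvPairing_bivEndo_zero] at e
    rw [e]
    ring
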